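/- Let $k$ be an infinite field and let $X=\operatorname{Spec} k[X]$, $X'=\operatorname{Spec} k[X']$ and $B=\operatorname{Spec} k[B]$ be affine $k$-schemes with $k$-morphisms $\Pi: X'\to X$, $q: X\to B$ and $q'=q\circ\Pi$, where $X$ is smooth over $k$ and $B$ is an open subscheme of a projective space $\mathbb P^{m}_k$. Let $V\subset X$ be open, $V'=\Pi^{-1}(V)$, and let $S=X-V$, $S'=X'-V'$ carry the reduced structures. Suppose that: * the square is elementary distinguished, i.e. $\Pi$ is étale and induces an isomorphism $S'\to S$; * $q$ is an almost elementary fibration: there are an open immersion $X\hookrightarrow \overline X$ dense in each fibre over $B$ and a closed subscheme $X_\infty\subset\overline X$ with locally principal ideal sheaf and $X=\overline X-X_\infty$, such that $\overline X\to B$ (extending $q$) is smooth and projective with geometrically irreducible one-dimensional fibres and $X_\infty\to B$ is finite and flat with non-empty fibres; * $\omega_{B/k}=\Lambda^{m}\Omega_{B/k}\cong\mathcal O_B$ and $\omega_{X/k}=\Lambda^{m+1}\Omega_{X/k}\cong\mathcal O_X$; * there are a proper $B$-scheme $\overline X'$, an open embedding $X'\hookrightarrow\overline X'$ over $B$ and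 an ample effective Cartier divisor $X'_\infty\subset\overline X'$ which is finite and surjective over $B$, with $X'=\overline X'-X'_\infty$; * $S'$ is finite over $B$. Let $x'\in S'$ be a closed point, $b=q'(x')$, let $s'_0,\dots,s'_n$ be the points of $S'$ over $b$, and put $s_i=\Pi(s'_i)$. Let $W'=\operatorname{Spec}\mathcal O_{X',\{s'_0,\dots,s'_n\}}$, $W=\operatorname{Spec}\mathcal O_{X,\{s_0,\dots,s_n\}}$, and let $\pi: W'\to W$ be induced by $\Pi$. Products of $B$-schemes are over $B$; we write $W'-S'$, $W-S$ for the preimages of $X'-S'$, $X-S$ in $W'$, $W$. Let $\Delta(W')\subset W'\times X'$ be the graph of $W'\to X'$ and $J\subset k[W'\times X']$ its ideal. Then there are functions $F\in k[W\times X']$ and $h_\theta\in k[\mathbb A^1\times W'\times X']$ ($\theta$ the coordinate on $\mathbb A^1$) such that, with $h_0,h_1$ the restrictions of $h_\theta$ to $\theta=0,1$: (a) $(pr,h_\theta):\mathbb A^1\times W'\times X'\to\mathbb A^1\times W'\times\mathbb A^1$ is finite and surjective, and the closed subscheme $Z'_\theta=\{h_\theta=0\}$ is finite, flat and surjective over $\mathbb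 A^1\times W'$; (b) as closed subschemes $\{h_0=0\}=\Delta(W')\sqcup G$ with $G\subset W'\times(X'-S')$; (c) $h_1=(\pi\times \mathrm{id}_{X'})^*(F)$; (d) $Z'_\theta\cap\bigl(\mathbb A^1\times(W'-S')\times S'\bigr)=\emptyset$; (e) $(pr_W,F): W\times X'\to W\times\mathbb A^1$ is finite and surjective, and $Z_1=\{F=0\}$ is finite, flat and surjective over $W$; (f) $Z_1\cap\bigl((W-S)\times S'\bigr)=\emptyset$; (g) $h_0\in J$, and $h_0\bmod J^2$ is a free generator of the $k[W']$-module $J/J^2$. Moreover, suppose given a framing of $X'$: an integer $N\ge 1$, an étale affine $\rho:\mathcal V\to B\times\mathbb A^N$, a $B$-morphism $s: X'\to\mathcal V$ such that $\rho\circ s$ is a closed embedding and $\rho^{-1}(\rho s(X'))=s(X')$, functions $\varphi_1,\dots,\varphi_{N-1}\in k[\mathcal V]$ generating the ideal of $s(X')$, and a $B$-morphism $r:\mathcal V\to X'$ with $r\circ s=\mathrm{id}_{X'}$. Let $I\subset k[W'\times\mathcal V]$ be the ideal of the closed subscheme $(\mathrm{id},s)(W')$, let $t_1,\dots,t_N$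 be the coordinates on $\mathbb A^N$, and $t'_i=t_i-p_{W'}^*(t_i|_{W'})\in k[W'\times\mathbb A^N]$. Then $F$ and $h_\theta$ with (a)–(g) can be chosen so that, in addition, $\bigl((\mathrm{id}\times\rho)^*(t'_i)\bigr)_{1\le i\le N}$ and $\bigl((\mathrm{id}\times r)^*(h_0),pr_{\mathcal V}^*\varphi_1,\dots,pr_{\mathcal V}^*\varphi_{N-1}\bigr)$ are, modulo $I^2$, bases of the $k[W']$-module $I/I^2$, and the matrix $A(h_0)\in GL_N(k[W'])$ transforming the first basis into the second has determinant $1$. -/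

import Mathlib

open CategoryTheory AlgebraicGeometry
open scoped TensorProduct

universe u

namespace FramedExcision

noncomputable section

/-! ### Projective space and projective morphisms over an affine base -/

section Projective

variable (m : ℕ) (R : Type u) [CommRing R]

/-- Projective space of dimension `m` over `R`: the homogeneous spectrum of `R[x_0, …, x_m]`. -/
def ProjSpace : Scheme.{u} :=
  letI : GradedAlgebra (MvPolynomial.homogeneousSubmodule (Fin (m + 1)) R) :=
    MvPolynomial.gradedAlgebra
  Proj (MvPolynomial.homogeneousSubmodule (Fin (m + 1)) R)

/-- The structure morphism of projective space over `R`. -/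
def ProjSpace.toSpec : ProjSpace m R ⟶ Spec (CommRingCat.of R) :=
  letI : GradedAlgebra (MvPolynomial.homogeneousSubmodule (Fin (m + 1)) R) :=
    MvPolynomial.gradedAlgebra
  Proj.toSpecZero (MvPolynomial.homogeneousSubmodule (Fin (m + 1)) R) ≫
    Spec.map (CommRingCat.ofHom
      (algebraMap R (MvPolynomial.homogeneousSubmodule (Fin (m + 1)) R 0)))

variable {R}

/-- A morphism to an affine scheme `Spec R` is projective if it factors as a closed immersion
into some projective space over `R` followed by the structure morphism. -/
def IsProjective {Y : Scheme.{u}} (f : Y ⟶ Spec (CommRingCat.of R)) : Prop :=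
  ∃ (m : ℕ) (c : Y ⟶ ProjSpace m R), IsClosedImmersion c ∧ c ≫ ProjSpace.toSpec m R = f

end Projective

/-! ### Almost elementary fibrations and ample Cartier divisors -/

/-- The ideal of a (closed) subscheme `i : D ⟶ Y` on an open subset `V` of `Y`. -/
def idealOn {D Y : Scheme.{u}} (i : D ⟶ Y) (V : Y.Opens) : Ideal Γ(Y, V) :=
  RingHom.ker (i.app V).hom

/-- Almost elementary fibrations over an affine base `B = Spec R`: morphisms `q : X ⟶ B` that fit
into a diagram `X ⟶ Xbar ⟵ Xinf` over `B` where `j : X ⟶ Xbar` is an open immersion, dense in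
each fibre over `B`, with image the complement of `Xinf`; `qbar : Xbar ⟶ B` is smooth and
projective with geometrically irreducible one-dimensional fibres; `Xinf ⟶ B` is finite and flat
with non-empty fibres; and `i : Xinf ⟶ Xbar` is a closed immersion with locally principal ideal
sheaf. -/
def IsAlmostElementaryFibration {R : Type u} [CommRing R] {X : Scheme.{u}}
    (q : X ⟶ Spec (CommRingCat.of R)) : Prop :=
  ∃ (Xbar Xinf : Scheme.{u}) (j : X ⟶ Xbar) (qbar : Xbar ⟶ Spec (CommRingCat.of R))
    (i : Xinf ⟶ Xbar),
    j ≫ qbar = q ∧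
    IsOpenImmersion j ∧
    (∀ b, Dense ((qbar.fiberι b) ⁻¹' (Set.range j) : Set (qbar.fiber b))) ∧
    Set.range j = (Set.range i)ᶜ ∧
    Smooth qbar ∧ IsProjective qbar ∧
    GeometricallyIrreducible qbar ∧ (∀ b, topologicalKrullDim (qbar.fiber b) = 1) ∧
    IsFinite (i ≫ qbar) ∧ Flat (i ≫ qbar) ∧ Surjective (i ≫ qbar) ∧
    IsClosedImmersion i ∧
    (∀ y : Xbar, ∃ V : Xbar.Opens, IsAffineOpen V ∧ y ∈ V ∧
      ∃ t : Γ(Xbar, V), idealOn i V = Ideal.span {t})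

/-- `i : D ⟶ Y` is (the inclusion of) an effective Cartier divisor: a closed immersion whose ideal
is locally generated by one nonzerodivisor. -/
def IsEffectiveCartier {D Y : Scheme.{u}} (i : D ⟶ Y) : Prop :=
  IsClosedImmersion i ∧
    ∀ y : Y, ∃ V : Y.Opens, IsAffineOpen V ∧ y ∈ V ∧
      ∃ t ∈ nonZeroDivisors Γ(Y, V), idealOn i V = Ideal.span {t}

section Ample

variable {D Y : Scheme.{u}} (i : D ⟶ Y)

/-- Let `U` be the complement of the effective Cartier divisor `D` in `Y`. A function `f` on `U`
is a section of the line bundle `𝒪(nD)` if `a f` extends to a regular function on `V` for each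
affine open `V` of `Y` and each `a` in the `n`-th power of the ideal of `D` on `V`. (Since `D` is
locally cut out by a nonzerodivisor, all sections of `𝒪(nD)` on `Y` are of this form.) -/
def IsSectionOfMultiple (U : Y.Opens) (n : ℕ) (f : Γ(Y, U)) : Prop :=
  ∀ V : Y.Opens, IsAffineOpen V → ∀ a ∈ idealOn i V ^ n, ∃ g : Γ(Y, V),
    Y.presheaf.map (homOfLE (inf_le_left : V ⊓ U ≤ V)).op g =
      Y.presheaf.map (homOfLE (inf_le_left : V ⊓ U ≤ V)).op a *
        Y.presheaf.map (homOfLE (inf_le_right : V ⊓ U ≤ U)).op f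

/-- The set of points of `Y` where the section `f` of `𝒪(nD)` does not vanish. -/
def nonvanishingLocus (U : Y.Opens) (n : ℕ) (f : Γ(Y, U)) : Set Y :=
  {y | ∃ V : Y.Opens, IsAffineOpen V ∧ ∃ a ∈ idealOn i V ^ n, ∃ g : Γ(Y, V),
    Y.presheaf.map (homOfLE (inf_le_left : V ⊓ U ≤ V)).op g =
      Y.presheaf.map (homOfLE (inf_le_left : V ⊓ U ≤ V)).op a *
        Y.presheaf.map (homOfLE (inf_le_right : V ⊓ U ≤ U)).op f ∧
    y ∈ Y.basicOpen g}

/-- `i : D ⟶ Y` is an ample (effective) Cartier divisor: `Y` is quasi-compact and each point of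
`Y` lies in an affine open subset that is the non-vanishing locus of a section of `𝒪(nD)` for
some `n ≥ 1`. -/
def IsAmpleCartier : Prop :=
  IsEffectiveCartier i ∧ CompactSpace Y ∧
    ∃ U : Y.Opens, (U : Set Y) = (Set.range i)ᶜ ∧
      ∀ y : Y, ∃ n : ℕ, 1 ≤ n ∧ ∃ f : Γ(Y, U), IsSectionOfMultiple i U n f ∧
        ∃ V : Y.Opens, (V : Set Y) = nonvanishingLocus i U n f ∧ IsAffineOpen V ∧ y ∈ V

end Ample

/-! ### The elementary distinguished square

`X = Spec A`, `X' = Spec A'`, `V` is an open subset of `X`, `S` is its complement, `V'` and `S'`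
are the preimages of `V` and `S` in `X'`. -/

section Square

variable {A : Type u} [CommRing A] (A' : Type u) [CommRing A'] [Algebra A A']
  (V : TopologicalSpace.Opens (PrimeSpectrum A))

/-- The closed subset `S = X - V`. -/
def closedS : Set (PrimeSpectrum A) := (V : Set (PrimeSpectrum A))ᶜ

/-- The closed subset `S' = X' - V'`, where `V'` is the preimage of `V`. -/
def closedS' : Set (PrimeSpectrum A') := PrimeSpectrum.comap (algebraMap A A') ⁻¹' closedS V

/-- The ideal of `S` with its reduced structure. -/
def idealS : Ideal A := PrimeSpectrum.vanishingIdeal (closedS V)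

/-- The ideal of `S'` with its reduced structure. -/
def idealS' : Ideal A' := PrimeSpectrum.vanishingIdeal (closedS' A' V)

lemma idealS_le_comap : idealS V ≤ (idealS' A' V).comap (algebraMap A A') := by
  intro a ha
  rw [Ideal.mem_comap, idealS', PrimeSpectrum.mem_vanishingIdeal]
  intro p hp
  exact (PrimeSpectrum.mem_vanishingIdeal _ _).1 ha _ hp

/-- The square formed by `V' ⟶ X'`, `V ⟶ X` and `Π : X' ⟶ X` is elementary distinguished:
`Π` is étale and induces an isomorphism `S' ⟶ S` of reduced closed subschemes. -/
def IsElementaryDistinguished : Prop :=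
  Algebra.Etale A A' ∧
    Function.Bijective (Ideal.quotientMap (idealS' A' V) (algebraMap A A') (idealS_le_comap A' V))

end Square

/-! ### Semi-localizations -/

section Semilocal

/-- The functions on `Spec A` that vanish at no point of `T`. -/
def nonvanishingAt {A : Type u} [CommRing A] (T : Set (PrimeSpectrum A)) : Submonoid A :=
  ⨅ p ∈ T, p.asIdeal.primeCompl

lemma mem_nonvanishingAt {A : Type u} [CommRing A] {T : Set (PrimeSpectrum A)} {a : A} :
    a ∈ nonvanishingAt T ↔ ∀ p ∈ T, a ∉ p.asIdeal := by
  simp [nonvanishingAt, Submonoid.mem_iInf, Ideal.mem_primeCompl_iff]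

/-- The ring `𝒪_{Spec A, T}` of the semi-localization of `Spec A` at the set of points `T`. -/
abbrev SemiLoc {A : Type u} [CommRing A] (T : Set (PrimeSpectrum A)) : Type u :=
  Localization (nonvanishingAt T)

variable (R : Type u) {A A' : Type u} [CommRing R] [CommRing A] [CommRing A']
  [Algebra R A] [Algebra R A'] [Algebra A A'] [IsScalarTower R A A']

/-- The comorphism of the canonical morphism from the semi-localization to `Spec A`. -/
def can (T : Set (PrimeSpectrum A)) : A →ₐ[R] SemiLoc T :=
  IsScalarTower.toAlgHom R A (SemiLoc T)

/-- The comorphism of the morphism between semi-localizations at `T'` and at the image of `T'`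
that is induced by `Spec A' ⟶ Spec A`. -/
def semiLocMap (T' : Set (PrimeSpectrum A')) :
    SemiLoc (PrimeSpectrum.comap (algebraMap A A') '' T') →ₐ[R] SemiLoc T' :=
  IsLocalization.liftAlgHom
    (M := nonvanishingAt (PrimeSpectrum.comap (algebraMap A A') '' T'))
    (f := (can R T').comp (IsScalarTower.toAlgHom R A A'))
    (fun y ↦ IsLocalization.map_units (SemiLoc T')
      (⟨algebraMap A A' y.1, mem_nonvanishingAt.2 fun p hp ↦
        mem_nonvanishingAt.1 y.2 _ ⟨p, hp, rfl⟩⟩ : nonvanishingAt T'))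

/-- The points of `S'` that lie in the same fibre over `B = Spec R` as the point `x'`. -/
def fibrePoints (V : TopologicalSpace.Opens (PrimeSpectrum A)) (x' : PrimeSpectrum A') :
    Set (PrimeSpectrum A') :=
  {p | p ∈ closedS' A' V ∧
    PrimeSpectrum.comap (algebraMap R A') p = PrimeSpectrum.comap (algebraMap R A') x'}

/-- The ring `k[W']`: the semi-localization of `X'` at the points of `S'` over `b = q'(x')`. -/
abbrev ringW' (V : TopologicalSpace.Opens (PrimeSpectrum A)) (x' : PrimeSpectrum A') : Type u :=
  SemiLoc (fibrePoints R V x')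

/-- The ring `k[W]`: the semi-localization of `X` at the images of the points of `S'` over `b`,
that is, at the points of `S` over `b` when `S'` maps isomorphically onto `S`. -/
abbrev ringW (V : TopologicalSpace.Opens (PrimeSpectrum A)) (x' : PrimeSpectrum A') : Type u :=
  SemiLoc (PrimeSpectrum.comap (algebraMap A A') '' fibrePoints R V x')

end Semilocal

/-! ### Functions, zero loci, and graphs -/

section Functions

/-- The comorphism of `(f, g) : Spec Q ⟶ Spec P × 𝔸¹`, for a morphism `Spec Q ⟶ Spec P` with
comorphism `f` and a function `g` on `Spec Q`. -/
def pairHom {P Q : Type u} [CommRing P] [CommRing Q] (f : P →+* Q) (g : Q) :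
    Polynomial P →+* Q :=
  Polynomial.eval₂RingHom f g

/-- The comorphism of the restriction of `Spec Q ⟶ Spec P` to the closed subscheme `g = 0`. -/
def zeroLocusHom {P Q : Type u} [CommRing P] [CommRing Q] (f : P →+* Q) (g : Q) :
    P →+* Q ⧸ Ideal.span {g} :=
  (Ideal.Quotient.mk (Ideal.span {g})).comp f

/-- The morphism of affine schemes with comorphism `f` is finite and surjective. -/
def IsFiniteSurjective {P Q : Type u} [CommRing P] [CommRing Q] (f : P →+* Q) : Prop :=
  IsFinite (Spec.map (CommRingCat.ofHom f)) ∧ Surjective (Spec.map (CommRingCat.ofHom f))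

/-- The morphism of affine schemes with comorphism `f` is finite, flat and surjective. -/
def IsFiniteFlatSurjective {P Q : Type u} [CommRing P] [CommRing Q] (f : P →+* Q) : Prop :=
  IsFinite (Spec.map (CommRingCat.ofHom f)) ∧ Flat (Spec.map (CommRingCat.ofHom f)) ∧
    Surjective (Spec.map (CommRingCat.ofHom f))

variable {R P L : Type u} [CommRing R] [CommRing P] [CommRing L] [Algebra R P] [Algebra R L]

/-- The ideal in `L ⊗[R] P` of the graph of the morphism `Spec L ⟶ Spec P` with comorphism `g`. -/
def graphIdeal (g : P →ₐ[R] L) : Ideal (L ⊗[R] P) :=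
  RingHom.ker (Algebra.TensorProduct.lift (AlgHom.id R L) g (fun _ _ ↦ Commute.all _ _))

lemma one_tmul_sub_mem_graphIdeal (g : P →ₐ[R] L) (p : P) :
    (1 : L) ⊗ₜ[R] p - g p ⊗ₜ[R] (1 : P) ∈ graphIdeal g := by
  simp [graphIdeal, RingHom.mem_ker]

end Functions

/-! ### Framings of `X'` -/

section Framing

/-- A framing of `X' = Spec A'` over `B = Spec R`, with `N = d + 1`: an affine étale neighbourhood
`𝒱 = Spec C` of a closed subscheme `X'` of `𝔸^N_B`, with a `B`-retraction `r` of `𝒱` to `X'` and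
functions `φ_1, …, φ_{N-1}` generating the ideal of `X'` in `𝒱`. All maps are comorphisms. -/
structure Framing (R A' : Type u) [CommRing R] [CommRing A'] [Algebra R A'] (d : ℕ)
    (C : Type u) [CommRing C] [Algebra R C] where
  /-- the étale morphism `𝒱 ⟶ 𝔸^N_B` -/
  ρ : MvPolynomial (Fin (d + 1)) R →ₐ[R] C
  /-- the section `X' ⟶ 𝒱` -/
  s : C →ₐ[R] A'
  /-- the retraction `𝒱 ⟶ X'` -/
  r : A' →ₐ[R] C
  /-- the functions on `𝒱` -/
  φ : Fin d → C
  etale : ρ.toRingHom.Etale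
  /-- the composite `X' ⟶ 𝔸^N_B` is a closed embedding -/
  closedEmbedding : Function.Surjective (s.comp ρ)
  /-- the preimage of `X'` under `ρ` is the closed subscheme `s(X')` of `𝒱` -/
  preimage : (RingHom.ker (s.comp ρ)).map ρ = RingHom.ker s
  retraction : s.comp r = AlgHom.id R A'
  generates : Ideal.span (Set.range φ) = RingHom.ker s

namespace Framing

variable {R A' : Type u} [CommRing R] [CommRing A'] [Algebra R A'] {d : ℕ}
  {C : Type u} [CommRing C] [Algebra R C] (Φ : Framing R A' d C)
  {L : Type u} [CommRing L] [Algebra R L] (g : A' →ₐ[R] L)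

/-- The ideal in `k[W' × 𝒱]` of the closed subscheme `(id, s)(W')`, the graph of the composite
`W' ⟶ X' ⟶ 𝒱`; here `L = k[W']` and `g` is the comorphism of `W' ⟶ X'`. -/
abbrev ideal : Ideal (L ⊗[R] C) := graphIdeal (g.comp Φ.s)

/-- The function `(id × ρ)^*(t'_i)`, where `t'_i = t_i - p_{W'}^*(t_i|_{W'})`, as an element of the
ideal of `(id, s)(W')`. -/
def tElem (i : Fin (d + 1)) : Φ.ideal g :=
  ⟨(1 : L) ⊗ₜ[R] Φ.ρ (MvPolynomial.X i) - g (Φ.s (Φ.ρ (MvPolynomial.X i))) ⊗ₜ[R] (1 : C),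
    one_tmul_sub_mem_graphIdeal (g.comp Φ.s) _⟩

lemma map_r_mem {e : L ⊗[R] A'} (he : e ∈ graphIdeal g) :
    Algebra.TensorProduct.map (AlgHom.id R L) Φ.r e ∈ Φ.ideal g := by
  have h : (Algebra.TensorProduct.lift (AlgHom.id R L) (g.comp Φ.s)
      (fun _ _ ↦ Commute.all _ _)).comp (Algebra.TensorProduct.map (AlgHom.id R L) Φ.r) =
      Algebra.TensorProduct.lift (AlgHom.id R L) g (fun _ _ ↦ Commute.all _ _) := by
    ext a
    · simp
    · have := DFunLike.congr_fun Φ.retraction a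
      simp only [AlgHom.comp_apply, AlgHom.id_apply] at this
      simp [this]
  have h' := DFunLike.congr_fun h e
  simp only [AlgHom.comp_apply] at h'
  change _ = _
  exact h'.trans he

lemma one_tmul_φ_mem (i : Fin d) : (1 : L) ⊗ₜ[R] Φ.φ i ∈ Φ.ideal g := by
  have : Φ.s (Φ.φ i) = 0 := by
    have h : Φ.φ i ∈ RingHom.ker Φ.s := Φ.generates ▸ Ideal.subset_span ⟨i, rfl⟩
    exact h
  simp [ideal, graphIdeal, RingHom.mem_ker, this]

/-- The family `(id × r)^*(e), φ'_1, …, φ'_{N-1}` of elements of the ideal of `(id, s)(W')`, for a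
function `e` on `W' × X'` that vanishes on the diagonal. -/
def eElem {e : L ⊗[R] A'} (he : e ∈ graphIdeal g) : Fin (d + 1) → Φ.ideal g :=
  Fin.cons ⟨Algebra.TensorProduct.map (AlgHom.id R L) Φ.r e, Φ.map_r_mem g he⟩
    (fun i ↦ ⟨(1 : L) ⊗ₜ[R] Φ.φ i, Φ.one_tmul_φ_mem g i⟩)

/-- With `I` the ideal of `(id, s)(W')`: both `(id × ρ)^*(t'_1), …, (id × ρ)^*(t'_N)` and
`(id × r)^*(e), φ'_1, …, φ'_{N-1}` are bases modulo `I²` of the `k[W']`-module `I/I²`, and the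
matrix `A(e)` that transforms the first into the second has determinant `1`. -/
def HasUnitDeterminant {e : L ⊗[R] A'} (he : e ∈ graphIdeal g) : Prop :=
  ∃ bt be : Module.Basis (Fin (d + 1)) L (Φ.ideal g).Cotangent,
    (∀ i, bt i = (Φ.ideal g).toCotangent (Φ.tElem g i)) ∧
    (∀ i, be i = (Φ.ideal g).toCotangent (Φ.eElem g he i)) ∧
    (bt.toMatrix be).det = 1

end Framing

end Framing

/-! ### The required properties of `F` and `h_θ` -/

section Properties

variable (R : Type u) {A A' : Type u} [CommRing R] [CommRing A] [CommRing A']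
  [Algebra R A] [Algebra R A'] [Algebra A A'] [IsScalarTower R A A']
  (V : TopologicalSpace.Opens (PrimeSpectrum A)) (x' : PrimeSpectrum A')

/-- The ideal `J` of the diagonal `Δ(W')` in `W' × X'` (the product is over `B`). -/
abbrev idealJ : Ideal (ringW' R V x' ⊗[R] A') := graphIdeal (can R (fibrePoints R V x'))

/-- The pull-back of functions from `W × X'` to `W' × X'` along `π_W × id`. -/
abbrev pullbackToW' : ringW R V x' ⊗[R] A' →ₐ[R] ringW' R V x' ⊗[R] A' :=
  Algebra.TensorProduct.map (semiLocMap R (fibrePoints R V x')) (AlgHom.id R A')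

/-- The comorphism of the projection `W' × X' ⟶ W'`. -/
abbrev prW' : ringW' R V x' →+* ringW' R V x' ⊗[R] A' :=
  Algebra.TensorProduct.includeLeftRingHom

/-- The comorphism of the projection `W × X' ⟶ W`. -/
abbrev prW : ringW R V x' →+* ringW R V x' ⊗[R] A' :=
  Algebra.TensorProduct.includeLeftRingHom

/-- Properties of functions `F` on `W × X'` and `h = h_θ` on `𝔸¹ × W' × X'` (products over `B`;
`θ` is the polynomial variable, so that `h_0` and `h_1` are the values of `h` at `0` and `1`). -/
structure IsGoodPair (F : ringW R V x' ⊗[R] A') (h : Polynomial (ringW' R V x' ⊗[R] A')) :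
    Prop where
  /-- `(pr, h_θ) : 𝔸¹ × W' × X' ⟶ 𝔸¹ × W' × 𝔸¹` is finite and surjective -/
  finite_h : IsFiniteSurjective (pairHom (Polynomial.mapRingHom (prW' R V x')) h)
  /-- `Z'_θ = {h_θ = 0}` is finite, flat and surjective over `𝔸¹ × W'` -/
  zero_h : IsFiniteFlatSurjective (zeroLocusHom (Polynomial.mapRingHom (prW' R V x')) h)
  /-- `{h_0 = 0}` is the disjoint union of `Δ(W')` and a closed subscheme `G` of
  `W' × (X' - S')` -/
  zero_h0 : ∃ IG : Ideal (ringW' R V x' ⊗[R] A'),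
    Ideal.span {h.eval 0} = idealJ R V x' ⊓ IG ∧ idealJ R V x' ⊔ IG = ⊤ ∧
    ∀ z : PrimeSpectrum (ringW' R V x' ⊗[R] A'), IG ≤ z.asIdeal →
      PrimeSpectrum.comap (Algebra.TensorProduct.includeRight (R := R)
        (A := ringW' R V x') (B := A')).toRingHom z ∉ closedS' A' V
  /-- `h_1` is the pull-back of `F` -/
  h1_eq : h.eval 1 = pullbackToW' R V x' F
  /-- `Z'_θ` does not meet `𝔸¹ × (W' - S') × S'` -/
  avoid_h : ∀ z : PrimeSpectrum (Polynomial (ringW' R V x' ⊗[R] A')), h ∈ z.asIdeal →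
    PrimeSpectrum.comap ((Polynomial.C.comp (prW' R V x')).comp
      (can R (fibrePoints R V x')).toRingHom) z ∉ closedS' A' V →
    PrimeSpectrum.comap (Polynomial.C.comp (Algebra.TensorProduct.includeRight (R := R)
      (A := ringW' R V x') (B := A')).toRingHom) z ∉ closedS' A' V
  /-- `(pr, F) : W × X' ⟶ W × 𝔸¹` is finite and surjective -/
  finite_F : IsFiniteSurjective (pairHom (prW R V x') F)
  /-- `Z_1 = {F = 0}` is finite, flat and surjective over `W` -/
  zero_F : IsFiniteFlatSurjective (zeroLocusHom (prW R V x') F)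
  /-- `Z_1` does not meet `(W - S) × S'` -/
  avoid_F : ∀ z : PrimeSpectrum (ringW R V x' ⊗[R] A'), F ∈ z.asIdeal →
    PrimeSpectrum.comap ((prW R V x').comp
      (can R (PrimeSpectrum.comap (algebraMap A A') '' fibrePoints R V x')).toRingHom) z
        ∉ closedS V →
    PrimeSpectrum.comap (Algebra.TensorProduct.includeRight (R := R)
      (A := ringW R V x') (B := A')).toRingHom z ∉ closedS' A' V
  /-- `h_0` lies in `J` -/
  h0_mem : h.eval 0 ∈ idealJ R V x'
  /-- `h_0` is a free generator of the `k[W']`-module `J/J²` -/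
  h0_generates : Function.Bijective fun w : ringW' R V x' ↦
    w • (idealJ R V x').toCotangent ⟨h.eval 0, h0_mem⟩

end Properties

end

end FramedExcision

open FramedExcision

/-! Three ingredients are combined; P stands for k[W] or k[W'].

Finiteness. Since `k` is infinite and the fibre of X'_∞ over b is finite, some O(nX'_∞) with n ≥ 1
has a section vanishing at no point of that fibre. Let Φ be its restriction to X'. It has a pole
along X'_∞ over every generization of b, so the valuative criterion for the proper B-scheme
containing X' shows that (pr, Φ) : Spec P × X' → Spec P × 𝔸¹ is integral
(`exists_isIntegral_aeval`). Replacing Φ by y + p(Φ), with p monic of large degree, preserves this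
(`exists_forall_isIntegral_aeval_add`). A rank count with the two trivial canonical modules shows
that Ω of X over B is invertible, so the fibres are smooth curves. A smooth curve that is finite
over the affine line is torsion free over it (`eq_zero_of_aeval_mul_eq_zero`); this gives, fibre by
fibre, the surjectivity of such maps and the flatness of their zero loci. Thus (a) and (e) only ask
for a dominant monic polynomial in Φ.

Behaviour over S'. Choose u on X whose differential generates at all the s_i. Then δ = 1 ⊗ u − u ⊗ 1
generates, modulo squares, the ideal J of the diagonal in W' × X', and, modulo the functions
vanishing on S', the ideal K of the transposed graph of S' → X in W × X'. As W is semi-local and S'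
is finite over B, a correction ε ∈ K² removes the zeros of w₀δ + ε on W × S' outside the transposed
graph. Because Π is étale and S' → S is an isomorphism, S' is the scheme-theoretic preimage of S.
Hence the pull-back to W' × X' vanishes over S' only on the diagonal, and modulo the ideal of S' it
equals wδ + ε₀ with ε₀ ∈ J². Here w is any prescribed unit of k[W'] and w₀ a unit of k[W] agreeing
with it along S'.

Interpolation. Let s be a monic polynomial in Φ over `R` vanishing on S', and φ the restriction of Φ
to W'. Put F = w₀δ + ε + sΦ^(c+2), h₀ = wδ + ε₀ + sΦ^c(Φ − φ)² and h_θ = (1 − θ)h₀ + θπ^*F. The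
s-terms vanish over S', so there h_θ is independent of θ; this gives (d) and, with Nakayama, (b),
while (f) concerns F alone. As (Φ − φ)² ∈ J², the class of h₀ modulo J² is that of wδ. The s-terms
of h_θ add up to sΦ^c((1 − θ)(Φ − φ)² + θΦ²), which is monic in Φ. This is `exists_isGoodPair`.

For a framing, det A(h₀) is linear in the class of h₀ in J/J², so w is taken to be the inverse of
the determinant belonging to δ (`exists_isUnit_hasUnitDeterminant`). -/

/-! ### Invertible modules and differentials at closed points -/

section InvertibleModules

/-- In the fibre of an invertible module at a maximal ideal, each nonzero vector generates. -/
lemma Module.Invertible.span_singleton_sup_smul_top {A M : Type*} [CommRing A] [AddCommGroup M]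
    [Module A M] [Module.Invertible A M] (𝔪 : Ideal A) [h𝔪 : 𝔪.IsMaximal] {x : M}
    (hx : x ∉ 𝔪 • (⊤ : Submodule A M)) :
    Submodule.span A {x} ⊔ 𝔪 • (⊤ : Submodule A M) = ⊤ := by
  let := Ideal.Quotient.field 𝔪
  let e := TensorProduct.quotTensorEquivQuotSMul M 𝔪
  have he (m : M) : e (1 ⊗ₜ m) = Submodule.Quotient.mk m := by
    rw [← map_one (Ideal.Quotient.mk 𝔪)]
    exact (TensorProduct.quotTensorEquivQuotSMul_mk_tmul 𝔪 1 m).trans (by rw [one_smul])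
  have h0 (m : M) : (1 : A ⧸ 𝔪) ⊗ₜ[A] m = 0 ↔ m ∈ 𝔪 • (⊤ : Submodule A M) := by
    rw [← e.map_eq_zero_iff, he, Submodule.Quotient.mk_eq_zero]
  have h1 : Module.finrank (A ⧸ 𝔪) ((A ⧸ 𝔪) ⊗[A] M) = 1 := Module.Invertible.finrank_eq_one _ _
  have hx' : (1 : A ⧸ 𝔪) ⊗ₜ[A] x ≠ 0 := fun h ↦ hx ((h0 x).1 h)
  refine eq_top_iff.2 fun m _ ↦ ?_
  obtain ⟨c, hc⟩ := (finrank_eq_one_iff_of_nonzero' _ hx').1 h1 (1 ⊗ₜ m)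
  obtain ⟨c, rfl⟩ := Ideal.Quotient.mk_surjective c
  have : (1 : A ⧸ 𝔪) ⊗ₜ[A] (m - c • x) = 0 := by
    rw [TensorProduct.tmul_sub, ← hc, TensorProduct.tmul_smul, sub_eq_zero,
      ← Ideal.Quotient.algebraMap_eq, algebraMap_smul]
  rw [h0] at this
  refine Submodule.mem_sup.2 ⟨c • x, Submodule.smul_mem _ _ (Submodule.mem_span_singleton_self x),
    _, this, by abel⟩

/-- If an element of an invertible module does not vanish at a maximal ideal, then it generates
the module in a neighbourhood. -/
lemma Module.Invertible.exists_notMem_forall_smul_mem_span {A M : Type*} [CommRing A]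
    [AddCommGroup M] [Module A M] [Module.Invertible A M] (𝔪 : Ideal A) [h𝔪 : 𝔪.IsMaximal] {x : M}
    (hx : x ∉ 𝔪 • (⊤ : Submodule A M)) :
    ∃ s ∉ 𝔪, ∀ m : M, s • m ∈ Submodule.span A {x} := by
  let N := Submodule.span A {x}
  have h := Module.Invertible.span_singleton_sup_smul_top 𝔪 hx
  obtain ⟨r, hr, hr'⟩ := Submodule.exists_sub_one_mem_and_smul_eq_zero_of_fg_of_le_smul 𝔪
    (⊤ : Submodule A (M ⧸ N)) Module.Finite.fg_top (by
      have := congr_arg (Submodule.map N.mkQ) h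
      rw [Submodule.map_sup, Submodule.map_smul'', Submodule.map_top, Submodule.range_mkQ] at this
      have h0 : Submodule.map N.mkQ N = ⊥ := N.mkQ_map_self
      rw [h0, bot_sup_eq] at this
      exact this.ge)
  refine ⟨r, fun h ↦ h𝔪.ne_top ((Ideal.eq_top_iff_one _).2 ?_), fun m ↦ ?_⟩
  · simpa using 𝔪.sub_mem h hr
  · have := hr' (Submodule.Quotient.mk m) trivial
    rwa [← Submodule.Quotient.mk_smul, Submodule.Quotient.mk_eq_zero] at this

/-- Nakayama would give r ≡ 1 modulo 𝔪 killing M, but an invertible module is faithful. -/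
lemma Module.Invertible.smul_top_ne_top {A M : Type*} [CommRing A] [AddCommGroup M]
    [Module A M] [Module.Invertible A M] (𝔪 : Ideal A) [h𝔪 : 𝔪.IsMaximal] :
    𝔪 • (⊤ : Submodule A M) ≠ ⊤ := by
  intro h
  obtain ⟨r, hr, hr'⟩ := Submodule.exists_sub_one_mem_and_smul_eq_zero_of_fg_of_le_smul 𝔪
    (⊤ : Submodule A M) Module.Finite.fg_top h.ge
  have : r = 0 := FaithfulSMul.eq_of_smul_eq_smul (α := M) fun m ↦ by simp [hr' m trivial]
  subst this
  exact h𝔪.ne_top ((Ideal.eq_top_iff_one _).2 (by simpa using 𝔪.neg_mem hr))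

/-- If the module of differentials is invertible, some differential `du` does not vanish at a given
maximal ideal. -/
lemma KaehlerDifferential.exists_D_notMem_smul_top (R : Type*) {A : Type*} [CommRing R]
    [CommRing A] [Algebra R A] [Module.Invertible A Ω[A⁄R]] (𝔪 : Ideal A) [h𝔪 : 𝔪.IsMaximal] :
    ∃ u : A, KaehlerDifferential.D R A u ∉ 𝔪 • (⊤ : Submodule A Ω[A⁄R]) := by
  by_contra! H
  refine Module.Invertible.smul_top_ne_top (M := Ω[A⁄R]) 𝔪 (top_le_iff.1 ?_)
  refine (KaehlerDifferential.span_range_derivation R A).ge.trans (Submodule.span_le.2 ?_)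
  rintro _ ⟨u, rfl⟩
  exact H u

/-- If the module of differentials is invertible, there is a function whose differential vanishes
at none of finitely many given closed points. -/
lemma KaehlerDifferential.exists_forall_D_notMem_smul_top (R : Type*) {A : Type*} [CommRing R]
    [CommRing A] [Algebra R A] [Module.Invertible A Ω[A⁄R]] {T : Set (PrimeSpectrum A)}
    (hT : T.Finite) (hmax : ∀ t ∈ T, t.asIdeal.IsMaximal) :
    ∃ u : A, ∀ t ∈ T, KaehlerDifferential.D R A u ∉ t.asIdeal • (⊤ : Submodule A Ω[A⁄R]) := by
  have := hT.to_subtype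
  have (t : T) : ∃ u : A, KaehlerDifferential.D R A u ∉ t.1.asIdeal • (⊤ : Submodule A Ω[A⁄R]) :=
    have := hmax t t.2
    KaehlerDifferential.exists_D_notMem_smul_top R _
  choose v hv using this
  -- The congruences are modulo squares because D maps t² into t · Ω, so that the value of the
  -- differential at t is retained.
  obtain ⟨u, hu⟩ := Ideal.exists_forall_sub_mem_ideal (I := fun t : T ↦ t.1.asIdeal ^ 2)
    (fun s t hst ↦ by
      have := hmax s s.2
      have := hmax t t.2
      exact IsCoprime.pow <| Ideal.isCoprime_of_isMaximal fun h ↦ hst (Subtype.ext (PrimeSpectrum.ext h))) v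
  refine ⟨u, fun t ht h ↦ hv ⟨t, ht⟩ ?_⟩
  have h2 : ∀ a ∈ t.asIdeal ^ 2, KaehlerDifferential.D R A a ∈
      t.asIdeal • (⊤ : Submodule A Ω[A⁄R]) := by
    intro a ha
    rw [pow_two] at ha
    refine Submodule.mul_induction_on ha (fun x hx y hy ↦ ?_) fun x y hx hy ↦ ?_
    · rw [Derivation.leibniz]
      exact add_mem (Submodule.smul_mem_smul hx trivial) (Submodule.smul_mem_smul hy trivial)
    · rw [map_add]; exact add_mem hx hy
  have := sub_mem h (h2 _ (hu ⟨t, ht⟩))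
  rwa [map_sub, sub_sub_cancel] at this

end InvertibleModules

/-! ### Smooth curves over a field: torsion freeness over the line -/

section Curves

open Polynomial

/-- A smooth algebra whose module of differentials is freely generated by `du` is flat over the
polynomial ring in `u`. -/
lemma flat_aeval_of_basis_kaehlerDifferential {κ C : Type*} [CommRing κ] [IsNoetherianRing κ]
    [CommRing C] [Algebra κ C]
    [Algebra.Smooth κ C] (u : C)
    (hu : Function.Bijective fun c : C ↦ c • KaehlerDifferential.D κ C u) :
    (aeval u : κ[X] →ₐ[κ] C).toRingHom.Flat := by
  algebraize [(aeval u : κ[X] →ₐ[κ] C).toRingHom]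
  have : IsScalarTower κ κ[X] C := .of_algebraMap_eq' (aeval u : κ[X] →ₐ[κ] C).comp_algebraMap.symm
  have hX : algebraMap κ[X] C X = u := aeval_X u
  change Module.Flat κ[X] C
  -- Ω of `κ[X]` is generated by dX, which maps to du, so the base change map inherits bijectivity
  -- from c ↦ c du. The Jacobi–Zariski sequence then kills both Ω and H¹ of the cotangent complex of
  -- `C` over `κ[X]`, whence smoothness and flatness.
  have hinj : Function.Injective (KaehlerDifferential.mapBaseChange κ κ[X] C) := by
    have key (x : C ⊗[κ[X]] Ω[κ[X]⁄κ]) : ∃ c : C, c ⊗ₜ[κ[X]] KaehlerDifferential.D κ κ[X] X = x := by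
      induction x with
      | zero => exact ⟨0, by simp⟩
      | add x y hx hy =>
        obtain ⟨c, rfl⟩ := hx
        obtain ⟨d, rfl⟩ := hy
        exact ⟨c + d, TensorProduct.add_tmul _ _ _⟩
      | tmul c ω =>
        obtain ⟨p, rfl⟩ := (KaehlerDifferential.polynomialEquiv κ).symm.surjective ω
        refine ⟨p • c, ?_⟩
        rw [KaehlerDifferential.polynomialEquiv_symm, TensorProduct.smul_tmul]
    rw [injective_iff_map_eq_zero]
    intro x hx
    obtain ⟨c, rfl⟩ := key x
    rw [KaehlerDifferential.mapBaseChange_tmul, KaehlerDifferential.map_D, hX] at hx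
    rw [hu.1 (by simpa using hx : c • _ = (0 : C) • _), TensorProduct.zero_tmul]
  have hsurj : Function.Surjective (KaehlerDifferential.mapBaseChange κ κ[X] C) := by
    intro ω
    obtain ⟨c, rfl⟩ := hu.2 ω
    exact ⟨c ⊗ₜ KaehlerDifferential.D κ κ[X] X, by
      rw [KaehlerDifferential.mapBaseChange_tmul, KaehlerDifferential.map_D, hX]⟩
  have h1 : Subsingleton (Ω[C⁄κ[X]]) := by
    refine ⟨fun a b ↦ ?_⟩
    have key (a : Ω[C⁄κ[X]]) : a = 0 := by
      obtain ⟨a, rfl⟩ := KaehlerDifferential.map_surjective κ κ[X] C a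
      exact (KaehlerDifferential.exact_mapBaseChange_map κ κ[X] C a).2 (hsurj a)
    rw [key a, key b]
  have h2 : Subsingleton (Algebra.H1Cotangent κ[X] C) := by
    refine ⟨fun a b ↦ ?_⟩
    have key (a : Algebra.H1Cotangent κ[X] C) : a = 0 := by
      have h : Algebra.H1Cotangent.δ κ κ[X] C a = 0 := by
        apply hinj
        rw [map_zero]
        exact (Algebra.H1Cotangent.exact_δ_mapBaseChange κ κ[X] C _).2 ⟨a, rfl⟩
      obtain ⟨c, rfl⟩ := (Algebra.H1Cotangent.exact_map_δ κ κ[X] C a).1 h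
      rw [Subsingleton.elim c 0, map_zero]
    rw [key a, key b]
  have : Algebra.FiniteType κ[X] C := .of_restrictScalars_finiteType κ κ[X] C
  have : Algebra.Smooth κ[X] C :=
    { formallySmooth := { subsingleton_h1Cotangent := h2, projective_kaehlerDifferential := inferInstance }
      finitePresentation := Algebra.FinitePresentation.of_finiteType.1 this }
  exact Algebra.Smooth.flat _ _

/-- On a smooth curve over a field there are no nonzero functions that are algebraic torsion. -/
lemma eq_zero_of_forall_exists_aeval_mul_eq_zero {κ C : Type*} [Field κ] [CommRing C] [Algebra κ C]
    [Algebra.Smooth κ C] [Module.Invertible C Ω[C⁄κ]] (q : C)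
    (hq : ∀ u : C, ∃ f : κ[X], f ≠ 0 ∧ aeval u f * q = 0) : q = 0 := by
  by_contra hq0
  -- Localise at a closed point of the support of q. Near it some du generates the differentials, so
  -- nonzero polynomials in u are nonzerodivisors by flatness, and q must vanish there.
  have hne : (Ideal.span {q}).annihilator ≠ ⊤ := by
    intro h
    have := (Ideal.eq_top_iff_one _).1 h
    rw [Submodule.mem_annihilator] at this
    exact hq0 (by simpa using this q (Ideal.mem_span_singleton_self q))
  obtain ⟨𝔪, h𝔪, hle⟩ := Ideal.exists_le_maximal _ hne
  obtain ⟨u, hu⟩ := KaehlerDifferential.exists_D_notMem_smul_top κ (A := C) 𝔪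
  obtain ⟨s, hs, hspan⟩ := Module.Invertible.exists_notMem_forall_smul_mem_span 𝔪 hu
  let L := Localization.Away s
  have : Algebra.Smooth C L := .of_isLocalization_Away s
  have : Algebra.Smooth κ L := .comp κ C L
  have : Algebra.FormallyEtale C L := .of_isLocalization (.powers s)
  have : Module.Invertible L Ω[L⁄κ] :=
    .congr (KaehlerDifferential.tensorKaehlerEquivOfFormallyEtale κ C L)
  have hbij : Function.Bijective
      fun c : L ↦ c • KaehlerDifferential.D κ L (algebraMap C L u) := by
    let g : L →ₗ[L] Ω[L⁄κ] := LinearMap.toSpanSingleton L _ (KaehlerDifferential.D κ L (algebraMap C L u))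
    change Function.Bijective g
    refine Module.Invertible.bijective_of_surjective ?_
    rw [← LinearMap.range_eq_top, LinearMap.range_toSpanSingleton, eq_top_iff,
      ← KaehlerDifferential.span_range_map_derivation_of_isLocalization κ C L (.powers s),
      Submodule.span_le]
    rintro _ ⟨c, rfl⟩
    obtain ⟨d, hd⟩ := Submodule.mem_span_singleton.1 (hspan (KaehlerDifferential.D κ C c))
    have h1 := congr_arg (KaehlerDifferential.map κ κ C L) hd
    rw [map_smul, map_smul, KaehlerDifferential.map_D] at h1
    obtain ⟨v, hv⟩ := isUnit_iff_exists_inv'.1 (IsLocalization.Away.algebraMap_isUnit (S := L) s)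
    refine Submodule.mem_span_singleton.2 ⟨v * algebraMap C L d, ?_⟩
    rw [mul_smul, algebraMap_smul, h1, ← algebraMap_smul L s, ← mul_smul, hv, one_smul]
    rfl
  have hflat := flat_aeval_of_basis_kaehlerDifferential (algebraMap C L u) hbij
  obtain ⟨f, hf, hfq⟩ := hq u
  algebraize [(aeval (algebraMap C L u) : κ[X] →ₐ[κ] L).toRingHom]
  have hreg : IsSMulRegular L f :=
    Module.Flat.isSMulRegular_of_isRegular (.of_ne_zero hf)
  have h0 : algebraMap C L q = 0 := by
    refine hreg.right_eq_zero_of_smul ?_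
    rw [Algebra.smul_def]
    change aeval (algebraMap C L u) f * _ = 0
    rw [aeval_algebraMap_apply, ← map_mul, hfq, map_zero]
  obtain ⟨⟨_, n, rfl⟩, hn⟩ := (IsLocalization.map_eq_zero_iff (.powers s) L q).1 h0
  refine hs (h𝔪.isPrime.mem_of_pow_mem n (hle ?_))
  rw [Submodule.mem_annihilator]
  intro x hx
  obtain ⟨y, rfl⟩ := Ideal.mem_span_singleton.1 hx
  rw [smul_eq_mul, ← mul_assoc, show s ^ n * q = 0 from hn, zero_mul]

/-- If `x` is integral over `S` and `N` is integral over `S[x]`, then `N` is integral over `S`. -/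
lemma isIntegral_of_isIntegral_aeval {S N : Type*} [CommRing S] [CommRing N] [Algebra S N] (x : N)
    (hx : IsIntegral S x) (h : (aeval x : S[X] →ₐ[S] N).toRingHom.IsIntegral) :
    Algebra.IsIntegral S N := by
  refine ⟨fun n ↦ ?_⟩
  let T := integralClosure S N
  let φ : S[X] →ₐ[S] T := aeval ⟨x, hx⟩
  have hφ : (algebraMap T N).comp φ.toRingHom = (aeval x : S[X] →ₐ[S] N).toRingHom := by
    have : (IsScalarTower.toAlgHom S T N).comp φ = aeval x := by ext; simp [φ]
    exact congr_arg AlgHom.toRingHom this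
  obtain ⟨p, hp, hpn⟩ := h n
  have : IsIntegral T n := ⟨p.map φ.toRingHom, hp.map _, by rw [eval₂_map, hφ, hpn]⟩
  exact isIntegral_trans n this

/-- The fibre case: if a smooth curve over a field is finite over the affine line, then it is
torsion free over the affine line. -/
lemma eq_zero_of_aeval_mul_eq_zero {κ C : Type*} [Field κ] [CommRing C] [Algebra κ C]
    [Algebra.Smooth κ C] [Module.Invertible C Ω[C⁄κ]] (h : C)
    (hfin : (aeval h : κ[X] →ₐ[κ] C).toRingHom.IsIntegral) {f : κ[X]} (hf : f ≠ 0) {q : C}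
    (hq : aeval h f * q = 0) : q = 0 := by
  refine eq_zero_of_forall_exists_aeval_mul_eq_zero (κ := κ) q fun u ↦ ?_
  -- This quotient is integral over κ: h becomes algebraic in it and `C` is integral over κ[h].
  -- Hence every u has a monic g with g(u) ∈ (f(h)), and g(u) kills q.
  let N := C ⧸ Ideal.span {aeval h f}
  let π : C →ₐ[κ] N := Ideal.Quotient.mkₐ κ _
  have hx : IsIntegral κ (π h) := by
    rw [← isAlgebraic_iff_isIntegral]
    refine ⟨f, hf, ?_⟩
    rw [aeval_algHom_apply]
    exact Ideal.Quotient.eq_zero_iff_mem.2 (Ideal.mem_span_singleton_self _)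
  have := isIntegral_of_isIntegral_aeval (S := κ) (π h) hx (by
    have : (aeval (π h) : κ[X] →ₐ[κ] N) = π.comp (aeval h) := by ext; simp
    rw [this]
    exact hfin.trans _ π.toRingHom
      (RingHom.isIntegral_of_surjective _ Ideal.Quotient.mk_surjective))
  obtain ⟨g, hg, hgu⟩ := this.isIntegral (π u)
  refine ⟨g, hg.ne_zero, ?_⟩
  rw [← aeval_def, aeval_algHom_apply] at hgu
  obtain ⟨c, hc⟩ := Ideal.mem_span_singleton.1 (Ideal.Quotient.eq_zero_iff_mem.1 hgu)
  rw [hc, mul_right_comm, hq, zero_mul]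

end Curves

/-! ### Flatness of cokernels, tested on fibres -/

section Slicing

/-- The cokernel of a universally injective endomorphism of a flat module is flat. -/
lemma Module.Flat.of_exact_of_lTensor_injective {P Q M : Type u} [CommRing P] [AddCommGroup Q]
    [Module P Q] [AddCommGroup M] [Module P M] [Module.Flat P Q] (h : Q →ₗ[P] Q) (π : Q →ₗ[P] M)
    (hex : Function.Exact h π) (hπ : Function.Surjective π)
    (hinj : ∀ I : Ideal P, Function.Injective (h.lTensor (P ⧸ I))) : Module.Flat P M := by
  rw [Module.Flat.iff_rTensor_injective']
  intro I
  rw [injective_iff_map_eq_zero]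
  intro x hx
  obtain ⟨x', rfl⟩ := LinearMap.lTensor_surjective I hπ x
  have hcomm {N N' N₁ N₂ : Type u} [AddCommGroup N] [Module P N] [AddCommGroup N'] [Module P N']
      [AddCommGroup N₁] [Module P N₁] [AddCommGroup N₂] [Module P N₂]
      (f : N →ₗ[P] N') (g : N₁ →ₗ[P] N₂) (z : N ⊗[P] N₁) :
      f.rTensor N₂ (g.lTensor N z) = g.lTensor N' (f.rTensor N₁ z) := by
    rw [← LinearMap.comp_apply, ← LinearMap.comp_apply, LinearMap.rTensor_comp_lTensor,
      LinearMap.lTensor_comp_rTensor]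
  rw [hcomm] at hx
  -- Diagram chase: the image of `x'` is h(y). Modulo I this is zero, so injectivity modulo I puts y
  -- in I ⊗ Q, and flatness of Q makes `x'` itself a value of h.
  obtain ⟨y, hy⟩ := (_root_.lTensor_exact P hex hπ _).1 hx
  have hex' : Function.Exact (I.subtype.rTensor Q) (I.mkQ.rTensor Q) :=
    _root_.rTensor_exact Q (LinearMap.exact_subtype_mkQ I) I.mkQ_surjective
  have hy' : I.mkQ.rTensor Q y = 0 := by
    refine hinj I ?_
    rw [← hcomm, hy, map_zero]
    exact (hex' _).2 ⟨_, rfl⟩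
  obtain ⟨z, rfl⟩ := (hex' _).1 hy'
  rw [← hcomm] at hy
  rw [← Module.Flat.rTensor_preserves_injective_linearMap I.subtype I.subtype_injective hy]
  exact (_root_.lTensor_exact I hex hπ _).2 ⟨z, rfl⟩

/-- An endomorphism of a flat module over a noetherian ring that is injective on the fibres is
universally injective. -/
lemma lTensor_injective_of_forall_residueField {P Q : Type u} [CommRing P] [IsNoetherianRing P]
    [AddCommGroup Q] [Module P Q] [Module.Flat P Q] (h : Q →ₗ[P] Q)
    (hinj : ∀ (p : Ideal P) [p.IsPrime], Function.Injective (h.lTensor p.ResidueField))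
    (M : Type u) [AddCommGroup M] [Module P M] [Module.Finite P M] :
    Function.Injective (h.lTensor M) := by
  have hcomm {N N' : Type u} [AddCommGroup N] [Module P N] [AddCommGroup N'] [Module P N']
      (f : N →ₗ[P] N') (z : N ⊗[P] Q) :
      f.rTensor Q (h.lTensor N z) = h.lTensor N' (f.rTensor Q z) := by
    rw [← LinearMap.comp_apply, ← LinearMap.comp_apply, LinearMap.rTensor_comp_lTensor,
      LinearMap.lTensor_comp_rTensor]
  have hsub {N N' : Type u} [AddCommGroup N] [Module P N] [AddCommGroup N'] [Module P N']
      (f : N →ₗ[P] N') (hf : Function.Injective f) (hN' : Function.Injective (h.lTensor N')) :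
      Function.Injective (h.lTensor N) := by
    rw [injective_iff_map_eq_zero]
    intro x hx
    refine (Module.Flat.rTensor_preserves_injective_linearMap (M := Q) f hf) ?_
    refine hN' ?_
    rw [← hcomm, hx, map_zero, map_zero]
  -- Dévissage to the modules P/𝔭, which embed into residue fields.
  refine IsNoetherianRing.induction_on_isQuotientEquivQuotientPrime P (M := M) inferInstance
    (motive := fun N _ _ _ ↦ Function.Injective (h.lTensor N)) ?_ ?_ ?_
  · intro N _ _ _ _
    exact Function.injective_of_subsingleton _
  · intro N _ _ _ p e
    refine hsub ((Algebra.linearMap (P ⧸ p.asIdeal) p.asIdeal.ResidueField).restrictScalars P ∘ₗ e.toLinearMap)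
      ?_ (hinj p.asIdeal)
    exact (Ideal.injective_algebraMap_quotient_residueField p.asIdeal).comp e.injective
  · intro N₁ _ _ _ N₂ _ _ _ N₃ _ _ _ f g hf hg hfg h₁ h₃
    rw [injective_iff_map_eq_zero]
    intro x hx
    have : g.rTensor Q x = 0 := h₃ (by rw [← hcomm, hx, map_zero, map_zero])
    obtain ⟨y, rfl⟩ := (rTensor_exact Q hfg hg _).1 this
    rw [← hcomm] at hx
    have := h₁ ((Module.Flat.rTensor_preserves_injective_linearMap (M := Q) f hf)
      (hx.trans (by simp : (0 : N₂ ⊗[P] Q) = f.rTensor Q (h.lTensor N₁ 0))))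
    rw [this, map_zero]

end Slicing

/-! ### Relative curves finite over the relative affine line -/

section RelativeCurves

open Polynomial

lemma Module.Invertible.kaehlerDifferential_of_isPushout (R S A B : Type*) [CommRing R] [CommRing S]
    [CommRing A] [CommRing B] [Algebra R S] [Algebra R A] [Algebra R B] [Algebra A B] [Algebra S B]
    [IsScalarTower R A B] [IsScalarTower R S B] [Algebra.IsPushout R S A B]
    [Module.Invertible A Ω[A⁄R]] : Module.Invertible B Ω[B⁄S] :=
  .congr (KaehlerDifferential.tensorKaehlerEquiv R S A B)

variable {P Q : Type u} [CommRing P] [CommRing Q] [Algebra P Q]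

instance (S : Type*) [CommRing S] [Algebra P S] [Module.Invertible Q Ω[Q⁄P]] :
    Module.Invertible (S ⊗[P] Q) Ω[S ⊗[P] Q⁄S] :=
  letI : Algebra Q (S ⊗[P] Q) := Algebra.TensorProduct.rightAlgebra
  .kaehlerDifferential_of_isPushout P S Q _

/-- Integral elements form a subring, so it suffices to treat s ⊗ 1, which lies in the image, and 1
⊗ q, whose integral equation is base changed. -/
lemma isIntegral_aeval_one_tmul {S : Type*} [CommRing S] [Algebra P S] {h : Q}
    (hh : (aeval h : P[X] →ₐ[P] Q).toRingHom.IsIntegral) :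
    (aeval ((1 : S) ⊗ₜ[P] h) : S[X] →ₐ[S] S ⊗[P] Q).toRingHom.IsIntegral := by
  intro x
  induction x with
  | zero => exact RingHom.isIntegralElem_zero _
  | add x y hx hy => exact hx.add _ hy
  | tmul s q =>
    have h1 : (s ⊗ₜ[P] q : S ⊗[P] Q) = (s ⊗ₜ 1) * (1 ⊗ₜ q) := by simp
    rw [h1]
    refine RingHom.IsIntegralElem.mul _ ?_ ?_
    · have : (s ⊗ₜ[P] (1 : Q)) = (aeval ((1 : S) ⊗ₜ[P] h) : S[X] →ₐ[S] S ⊗[P] Q).toRingHom (C s) := by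
        simp [Algebra.TensorProduct.algebraMap_apply]
      rw [this]
      exact RingHom.isIntegralElem_map _
    · obtain ⟨p, hp, hpq⟩ := hh q
      refine ⟨p.map (mapRingHom (algebraMap P S)), hp.map _, ?_⟩
      rw [eval₂_map]
      have hc : (aeval ((1 : S) ⊗ₜ[P] h) : S[X] →ₐ[S] S ⊗[P] Q).toRingHom.comp
          (mapRingHom (algebraMap P S)) =
          (Algebra.TensorProduct.includeRight : Q →ₐ[P] S ⊗[P] Q).toRingHom.comp
            (aeval h : P[X] →ₐ[P] Q).toRingHom := by
        ext x
        · simp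
        · simp
      rw [hc]
      have := congr_arg (Algebra.TensorProduct.includeRight : Q →ₐ[P] S ⊗[P] Q).toRingHom hpq
      rw [hom_eval₂, map_zero] at this
      exact this

variable [Algebra.Smooth P Q] [Module.Invertible Q Ω[Q⁄P]] 
  (hsurj : Function.Surjective (PrimeSpectrum.comap (algebraMap P Q))) {h : Q}
  (hfin : (aeval h : P[X] →ₐ[P] Q).toRingHom.Finite)

include hsurj hfin in
/-- A finite morphism from a relative smooth curve with nonempty fibres to the relative affine
line is surjective. -/
lemma comap_aeval_surjective :
    Function.Surjective (PrimeSpectrum.comap (aeval h : P[X] →ₐ[P] Q).toRingHom) := by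
  intro z
  let p : PrimeSpectrum P := PrimeSpectrum.comap (algebraMap P P[X]) z
  let κ := p.asIdeal.ResidueField
  let w : PrimeSpectrum (p.asIdeal.Fiber P[X]) := PrimeSpectrum.preimageEquivFiber P P[X] p ⟨z, rfl⟩
  have hw : PrimeSpectrum.comap (Algebra.TensorProduct.includeRight : P[X] →ₐ[P] κ ⊗[P] P[X]).toRingHom
      w = z :=
    congr_arg Subtype.val ((PrimeSpectrum.preimageEquivFiber P P[X] p).symm_apply_apply ⟨z, rfl⟩)
  have hint := isIntegral_aeval_one_tmul (S := κ) hfin.to_isIntegral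
  have hnt : Nontrivial (κ ⊗[P] Q) := by
    obtain ⟨y, hy⟩ := hsurj p
    have : Nonempty (PrimeSpectrum (p.asIdeal.Fiber Q)) :=
      ⟨PrimeSpectrum.preimageEquivFiber P Q p ⟨y, hy⟩⟩
    exact PrimeSpectrum.nonempty_iff_nontrivial.1 this
  -- A nonzero polynomial in the kernel would annihilate 1, contradicting torsion freeness of the
  -- nonempty fibre. Lying over then applies in the fibre.
  have hinj : Function.Injective (aeval ((1 : κ) ⊗ₜ[P] h) : κ[X] →ₐ[κ] κ ⊗[P] Q).toRingHom := by
    rw [injective_iff_map_eq_zero]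
    intro f hf
    by_contra hf0
    exact one_ne_zero (eq_zero_of_aeval_mul_eq_zero _ hint hf0 (q := 1) (by rw [mul_one]; exact hf))
  let e : κ[X] →ₐ[κ] κ ⊗[P] P[X] := aeval (1 ⊗ₜ X)
  obtain ⟨y, hy⟩ := hint.comap_surjective hinj (PrimeSpectrum.comap e.toRingHom w)
  refine ⟨PrimeSpectrum.comap (Algebra.TensorProduct.includeRight : Q →ₐ[P] κ ⊗[P] Q).toRingHom y, ?_⟩
  have h1 : (Algebra.TensorProduct.includeRight : Q →ₐ[P] κ ⊗[P] Q).toRingHom.comp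
      (aeval h : P[X] →ₐ[P] Q).toRingHom =
      (aeval ((1 : κ) ⊗ₜ[P] h) : κ[X] →ₐ[κ] κ ⊗[P] Q).toRingHom.comp (mapRingHom (algebraMap P κ)) := by
    ext x <;> simp
  have h2 : (Algebra.TensorProduct.includeRight : P[X] →ₐ[P] κ ⊗[P] P[X]).toRingHom =
      e.toRingHom.comp (mapRingHom (algebraMap P κ)) := by
    ext x
    · simpa [e] using
        (Algebra.TensorProduct.includeRight : P[X] →ₐ[P] κ ⊗[P] P[X]).commutes x
    · simp [e]
  rw [← PrimeSpectrum.comap_comp_apply, h1, PrimeSpectrum.comap_comp_apply, hy,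
    ← PrimeSpectrum.comap_comp_apply, ← h2, hw]

include hfin in
/-- The zero locus of a function on a relative smooth curve that is finite over the relative affine
line is flat over the base. -/
lemma flat_quotient_span_singleton [IsNoetherianRing P] : Module.Flat P (Q ⧸ Ideal.span {h}) := by
  have := Algebra.Smooth.flat P Q
  refine Module.Flat.of_exact_of_lTensor_injective (LinearMap.mulLeft P h)
    ((Ideal.Quotient.mkₐ P (Ideal.span {h})).toLinearMap) (fun x ↦ ?_)
    Ideal.Quotient.mk_surjective fun I ↦
      lTensor_injective_of_forall_residueField _ (fun p _ ↦ ?_) _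
  · change Ideal.Quotient.mk _ x = 0 ↔ _
    rw [Ideal.Quotient.eq_zero_iff_mem, Ideal.mem_span_singleton]
    exact ⟨fun ⟨c, hc⟩ ↦ ⟨c, hc.symm⟩, fun ⟨c, hc⟩ ↦ ⟨c, hc.symm⟩⟩
  · have hint := isIntegral_aeval_one_tmul (S := p.ResidueField) hfin.to_isIntegral
    have hmul : ∀ x, (LinearMap.mulLeft P h).lTensor p.ResidueField x =
        ((1 : p.ResidueField) ⊗ₜ[P] h) * x := by
      intro x
      induction x with
      | zero => simp
      | add x y hx hy => rw [map_add, hx, hy, mul_add]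
      | tmul a q => simp
    rw [injective_iff_map_eq_zero]
    intro x hx
    rw [hmul] at hx
    exact eq_zero_of_aeval_mul_eq_zero _ hint X_ne_zero (by rwa [aeval_X])

include hsurj hfin in
lemma isFiniteSurjective_pairHom : IsFiniteSurjective (pairHom (algebraMap P Q) h) := by
  refine ⟨(IsFinite.SpecMap_iff _).2 hfin, ⟨?_⟩⟩
  exact comap_aeval_surjective hsurj hfin

include hsurj hfin in
lemma isFiniteFlatSurjective_zeroLocusHom [IsNoetherianRing P] :
    IsFiniteFlatSurjective (zeroLocusHom (algebraMap P Q) h) := by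
  -- The zero locus is the pull-back of (pr, h) along the zero section of the affine line;
  -- finiteness and surjectivity are inherited from there.
  have hc : (zeroLocusHom (algebraMap P Q) h).comp (evalRingHom 0) =
      (Ideal.Quotient.mk (Ideal.span {h})).comp (aeval h : P[X] →ₐ[P] Q).toRingHom := by
    ext x
    · simp [zeroLocusHom]
    · simp [zeroLocusHom]
  refine ⟨(IsFinite.SpecMap_iff _).2 ?_, (Flat.SpecMap_iff).2 ?_, ⟨?_⟩⟩
  · refine RingHom.Finite.of_comp_finite (f := evalRingHom 0) ?_
    rw [CommRingCat.hom_ofHom, hc]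
    exact (RingHom.Finite.of_surjective _ Ideal.Quotient.mk_surjective).comp hfin
  · have := flat_quotient_span_singleton hfin
    rw [← RingHom.flat_algebraMap_iff] at this
    exact this
  · intro (p : PrimeSpectrum P)
    obtain ⟨y, hy⟩ := comap_aeval_surjective hsurj hfin (PrimeSpectrum.comap (evalRingHom 0) p)
    have hmem : h ∈ y.asIdeal := by
      have : (X : P[X]) ∈ (PrimeSpectrum.comap (evalRingHom 0) p).asIdeal := by
        change evalRingHom 0 X ∈ p.asIdeal
        simp
      rw [← hy] at this
      simpa using this
    obtain ⟨w, rfl⟩ : y ∈ Set.range (PrimeSpectrum.comap (Ideal.Quotient.mk (Ideal.span {h}))) := by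
      rw [range_comap_of_surjective _ _ Ideal.Quotient.mk_surjective,
        Ideal.mk_ker, PrimeSpectrum.mem_zeroLocus]
      exact (Ideal.span_singleton_le_iff_mem _).2 hmem
    refine ⟨w, ?_⟩
    change PrimeSpectrum.comap (zeroLocusHom (algebraMap P Q) h) w = p
    rw [← PrimeSpectrum.comap_comp_apply, ← hc, PrimeSpectrum.comap_comp_apply] at hy
    exact PrimeSpectrum.comap_injective_of_surjective (evalRingHom 0)
      (fun x ↦ ⟨C x, by simp⟩) hy

end RelativeCurves

/-! ### Stability of finiteness under terms of large degree -/

section Perturbation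

open Polynomial

/-- Adding a polynomial of large degree to a function keeps the morphism to the affine line
finite. -/
lemma exists_forall_isIntegral_aeval_add {P Q : Type*} [CommRing P] [CommRing Q] [Algebra P Q]
    {Φ : Q} (hΦ : (aeval Φ : P[X] →ₐ[P] Q).toRingHom.IsIntegral) (y : Q) :
    ∃ E : ℕ, ∀ p : P[X], p.Monic → E ≤ p.natDegree →
      (aeval (y + aeval Φ p) : P[X] →ₐ[P] Q).toRingHom.IsIntegral := by
  rcases subsingleton_or_nontrivial P with hP | hP
  · have : Subsingleton Q := (algebraMap P Q).codomain_trivial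
    exact ⟨0, fun p _ _ x ↦ ⟨1, monic_one, Subsingleton.elim _ _⟩⟩
  obtain ⟨G, hG, hGy⟩ := hΦ y
  -- `G` is an integral equation of y over P[Φ], and `E` bounds the degrees in Φ of its
  -- coefficients. If deg p > E, then E + i · deg p < deg G · deg p for i < deg G, so after
  -- substituting y = h − p(Φ) the top power dominates.
  let E := G.support.sup fun i ↦ (G.coeff i).natDegree
  refine ⟨E + 1, fun p hp hE ↦ ?_⟩
  set h := y + aeval Φ p with hh
  algebraize [(aeval h : P[X] →ₐ[P] Q).toRingHom]
  have : IsScalarTower P P[X] Q := .of_algebraMap_eq' (aeval h : P[X] →ₐ[P] Q).comp_algebraMap.symm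
  have hX : algebraMap P[X] Q X = h := aeval_X h
  have hpc : (p.map (C : P →+* P[X])).natDegree = p.natDegree := hp.natDegree_map _
  let l : P[X][X] := C X - p.map C
  have hl : l.natDegree = p.natDegree := by
    rw [← hpc]
    exact natDegree_sub_eq_right_of_natDegree_lt (by rw [natDegree_C, hpc]; omega)
  have hlc : l.leadingCoeff = -1 := by
    rw [leadingCoeff, hl, coeff_sub, coeff_C_of_ne_zero (by omega), coeff_map, hp.coeff_natDegree]
    simp
  have hlpow (i : ℕ) : (l ^ i).natDegree = i * p.natDegree := by
    rw [natDegree_pow', hl]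
    rw [hlc]
    exact ((isUnit_one.neg).pow i).ne_zero
  have haev : aeval Φ l = y := by
    simp [l, hX, hh, aeval_map_algebraMap, ← Polynomial.algebraMap_eq]
  -- The inner variable stands for h, the outer one for Φ, and `l` for y. The leading coefficient of
  -- `H` is a power of −1, so Φ is integral over P[h].
  let H : P[X][X] := G.sum fun i c ↦ c.map C * l ^ i
  have hH0 : aeval Φ H = 0 := by
    rw [← hGy, eval₂_eq_sum]
    simp only [H, Polynomial.sum_def, map_sum]
    refine Finset.sum_congr rfl fun i _ ↦ ?_
    rw [map_mul, map_pow, haev]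
    congr 1
    exact aeval_map_algebraMap _ _ _
  have hterm (i : ℕ) (hi : i < G.natDegree) : ((G.coeff i).map C * l ^ i).natDegree <
      G.natDegree * p.natDegree := by
    refine natDegree_mul_le.trans_lt ?_
    rw [hlpow]
    have h1 : ((G.coeff i).map (C : P →+* P[X])).natDegree ≤ E := by
      refine natDegree_map_le.trans ?_
      by_cases hi : i ∈ G.support
      · exact Finset.le_sup (f := fun i ↦ (G.coeff i).natDegree) hi
      · rw [notMem_support_iff.1 hi]; simp
    have h2 : (i + 1) * p.natDegree ≤ G.natDegree * p.natDegree := Nat.mul_le_mul_right _ hi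
    rw [add_mul] at h2
    omega
  have hHsum : H = ∑ i ∈ Finset.range (G.natDegree + 1), (G.coeff i).map C * l ^ i :=
    G.sum_over_range (by simp)
  have hHc : H.coeff (G.natDegree * p.natDegree) = (-1) ^ G.natDegree := by
    rw [hHsum, Finset.sum_range_succ, coeff_add, finsetSum_coeff, Finset.sum_eq_zero, zero_add,
      hG.coeff_natDegree, Polynomial.map_one, one_mul, ← hlpow, coeff_natDegree, leadingCoeff_pow', hlc]
    · rw [hlc]; exact ((isUnit_one.neg).pow _).ne_zero
    · intro i hi
      exact coeff_eq_zero_of_natDegree_lt (hterm i (Finset.mem_range.1 hi))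
  have hHd : H.natDegree ≤ G.natDegree * p.natDegree := by
    rw [hHsum]
    refine natDegree_sum_le_of_forall_le _ _ fun i hi ↦ ?_
    rcases (Nat.lt_succ_iff.1 (Finset.mem_range.1 hi)).lt_or_eq with h | rfl
    · exact (hterm i h).le
    · rw [hG.coeff_natDegree, Polynomial.map_one, one_mul, hlpow]
  have hΦint : IsIntegral P[X] Φ := by
    refine ⟨C ((-1) ^ G.natDegree) * H, ?_, ?_⟩
    · refine monic_of_natDegree_le_of_coeff_eq_one (G.natDegree * p.natDegree) ?_ ?_
      · exact (natDegree_C_mul_le _ _).trans hHd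
      · rw [coeff_C_mul, hHc, ← mul_pow]; simp
    · rw [← aeval_def, map_mul, hH0, mul_zero]
  have := isIntegral_of_isIntegral_aeval (S := P[X]) Φ hΦint (by
    have hc : (aeval Φ : P[X] →ₐ[P] Q).toRingHom =
        (aeval Φ : P[X][X] →ₐ[P[X]] Q).toRingHom.comp (mapRingHom C) := by
      ext x
      · simp [IsScalarTower.algebraMap_apply P P[X] Q]
      · simp
    rw [hc] at hΦ
    exact RingHom.IsIntegral.tower_top _ _ hΦ)
  exact this.isIntegral

end Perturbation

/-! ### Primes of semi-localizations -/

section SemiLocalization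

variable {A : Type u} [CommRing A] {T : Set (PrimeSpectrum A)}

lemma isUnit_algebraMap_semiLoc {a : A} (ha : ∀ p ∈ T, a ∉ p.asIdeal) :
    IsUnit (algebraMap A (SemiLoc T) a) :=
  IsLocalization.map_units (SemiLoc T) (⟨a, mem_nonvanishingAt.2 ha⟩ : nonvanishingAt T)

/-- Prime avoidance: an element of a proper ideal is not a unit, hence vanishes at some point of the
finite set T. -/
lemma exists_comap_le_of_semiLoc (hT : T.Finite) (q : Ideal (SemiLoc T)) [hq : q.IsPrime] :
    ∃ t ∈ T, q.comap (algebraMap A (SemiLoc T)) ≤ t.asIdeal := by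
  have : Nonempty (PrimeSpectrum A) := ⟨⟨q.comap (algebraMap A (SemiLoc T)), inferInstance⟩⟩
  have h : ((q.comap (algebraMap A (SemiLoc T)) : Ideal A) : Set A) ⊆
      ⋃ t ∈ T, ((t.asIdeal : Ideal A) : Set A) := by
    intro a ha
    by_contra hn
    simp only [Set.mem_iUnion, not_exists] at hn
    exact hq.ne_top (Ideal.eq_top_of_isUnit_mem _ ha (isUnit_algebraMap_semiLoc fun p hp ↦ hn p hp))
  exact (Ideal.subset_union_prime_finite hT (f := PrimeSpectrum.asIdeal) (Classical.arbitrary _) (Classical.arbitrary _)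
    fun t _ _ _ ↦ t.isPrime).1 h

lemma exists_comap_semiLoc_eq {t : PrimeSpectrum A} (ht : t ∈ T) :
    ∃ q : PrimeSpectrum (SemiLoc T), PrimeSpectrum.comap (algebraMap A (SemiLoc T)) q = t := by
  have : t ∈ Set.range (PrimeSpectrum.comap (algebraMap A (SemiLoc T))) := by
    rw [PrimeSpectrum.localization_comap_range (SemiLoc T) (nonvanishingAt T)]
    exact Set.disjoint_left.2 fun a ha hat ↦ mem_nonvanishingAt.1 ha t ht hat
  exact this

lemma exists_comap_eq_of_isMaximal_semiLoc (hT : T.Finite) (M : Ideal (SemiLoc T))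
    [hM : M.IsMaximal] : ∃ t ∈ T, M.comap (algebraMap A (SemiLoc T)) = t.asIdeal := by
  obtain ⟨t, ht, hle⟩ := exists_comap_le_of_semiLoc hT M
  obtain ⟨q, rfl⟩ := exists_comap_semiLoc_eq ht
  refine ⟨_, ht, ?_⟩
  have : M ≤ q.asIdeal := by
    rw [← IsLocalization.map_under (nonvanishingAt T) (SemiLoc T) M,
      ← IsLocalization.map_under (nonvanishingAt T) (SemiLoc T) q.asIdeal]
    exact Ideal.map_mono hle
  rw [hM.eq_of_le q.isPrime.ne_top this]
  rfl

lemma finite_setOf_isMaximal_semiLoc (hT : T.Finite) :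
    {M : PrimeSpectrum (SemiLoc T) | M.asIdeal.IsMaximal}.Finite := by
  refine Set.Finite.of_finite_image (f := PrimeSpectrum.comap (algebraMap A (SemiLoc T)))
    (hT.subset ?_) (PrimeSpectrum.localization_comap_injective (SemiLoc T) (nonvanishingAt T)).injOn
  rintro _ ⟨M, hM, rfl⟩
  have : M.asIdeal.IsMaximal := hM
  obtain ⟨t, ht, h⟩ := exists_comap_eq_of_isMaximal_semiLoc hT M.asIdeal
  exact (PrimeSpectrum.ext h : PrimeSpectrum.comap _ M = t) ▸ ht

lemma notMem_of_isUnit_algebraMap_semiLoc {a : A} (ha : IsUnit (algebraMap A (SemiLoc T) a))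
    {t : PrimeSpectrum A} (ht : t ∈ T) : a ∉ t.asIdeal := by
  obtain ⟨q, rfl⟩ := exists_comap_semiLoc_eq ht
  exact fun h ↦ q.isPrime.ne_top (Ideal.eq_top_of_isUnit_mem _ h ha)

end SemiLocalization

/-! ### The distinguished square and the points of S' over b -/

section Square

variable {R A A' : Type u} [CommRing R] [CommRing A] [CommRing A']
  [Algebra R A] [Algebra R A'] [Algebra A A'] [IsScalarTower R A A']
  {V : TopologicalSpace.Opens (PrimeSpectrum A)} {x' : PrimeSpectrum A'}

lemma isClosed_closedS : IsClosed (closedS V) := V.isOpen.isClosed_compl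

lemma mem_closedS_iff {p : PrimeSpectrum A} : p ∈ closedS V ↔ idealS V ≤ p.asIdeal := by
  rw [idealS, ← SetLike.coe_subset_coe, ← PrimeSpectrum.mem_zeroLocus, PrimeSpectrum.zeroLocus_vanishingIdeal_eq_closure,
    isClosed_closedS.closure_eq]

lemma mem_closedS'_iff {p : PrimeSpectrum A'} : p ∈ closedS' A' V ↔ idealS' A' V ≤ p.asIdeal := by
  rw [idealS', ← SetLike.coe_subset_coe, ← PrimeSpectrum.mem_zeroLocus, PrimeSpectrum.zeroLocus_vanishingIdeal_eq_closure,
    closedS', (isClosed_closedS.preimage (PrimeSpectrum.continuous_comap _) :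
      IsClosed (PrimeSpectrum.comap (algebraMap A A') ⁻¹' closedS V)).closure_eq]

lemma mem_closedS'_iff_comap {p : PrimeSpectrum A'} :
    p ∈ closedS' A' V ↔ PrimeSpectrum.comap (algebraMap A A') p ∈ closedS V := Iff.rfl

variable (hsq : IsElementaryDistinguished A' V)

include hsq in
lemma FramedExcision.IsElementaryDistinguished.exists_sub_mem (a' : A') :
    ∃ a : A, a' - algebraMap A A' a ∈ idealS' A' V := by
  obtain ⟨y, hy⟩ := hsq.2.2 (Ideal.Quotient.mk _ a')
  obtain ⟨a, rfl⟩ := Ideal.Quotient.mk_surjective y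
  refine ⟨a, ?_⟩
  rw [← Ideal.Quotient.eq, ← hy]
  rfl

include hsq in
/-- In an elementary distinguished square `S'` is the scheme theoretic preimage of `S`. -/
lemma FramedExcision.IsElementaryDistinguished.map_idealS [IsNoetherianRing A'] :
    (idealS V).map (algebraMap A A') = idealS' A' V := by
  have : Algebra.Etale A A' := hsq.1
  refine le_antisymm (Ideal.map_le_iff_le_comap.2 (idealS_le_comap A' V)) fun a ha ↦ ?_
  set K := (idealS V).map (algebraMap A A') with hK
  have hrad : idealS' A' V ≤ K.radical := by
    intro a ha
    rw [Ideal.mem_radical_iff, ← Ideal.mem_radical_iff, ← PrimeSpectrum.vanishingIdeal_zeroLocus_eq_radical,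
      PrimeSpectrum.mem_vanishingIdeal]
    intro p hp
    refine (PrimeSpectrum.mem_vanishingIdeal _ _).1 ha p ?_
    rw [mem_closedS'_iff_comap, mem_closedS_iff]
    exact Ideal.map_le_iff_le_comap.1 hp
  let N := A' ⧸ K
  let J : Ideal N := (idealS' A' V).map (Ideal.Quotient.mk K)
  have hJ : IsNilpotent J := by
    obtain ⟨n, hn⟩ := Ideal.exists_pow_le_of_le_radical_of_fg hrad (IsNoetherian.noetherian _)
    refine ⟨n, ?_⟩
    rw [← Ideal.map_pow, Ideal.zero_eq_bot, Ideal.map_eq_bot_iff_le_ker, Ideal.mk_ker]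
    exact hn
  -- Two `A`-algebra maps to A'/K are compared: the projection, and the map through the isomorphism
  -- of S' with S. They agree modulo the nilpotent ideal `J`, so they coincide because `A'` is
  -- unramified over `A`; and the second one kills the ideal of S'.
  let f₁ : A' →ₐ[A] N := Ideal.Quotient.mkₐ A K
  let e := RingEquiv.ofBijective _ hsq.2
  let σ : A ⧸ idealS V →+* N := Ideal.quotientMap K (algebraMap A A') (Ideal.map_le_iff_le_comap.1 le_rfl)
  let f₂ : A' →ₐ[A] N :=
    { (σ.comp (e.symm : A' ⧸ idealS' A' V →+* A ⧸ idealS V)).comp (Ideal.Quotient.mk _) with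
      commutes' := fun x ↦ by
        have : e (Ideal.Quotient.mk _ x) = Ideal.Quotient.mk _ (algebraMap A A' x) := rfl
        change σ (e.symm (Ideal.Quotient.mk _ (algebraMap A A' x))) = _
        rw [← this, e.symm_apply_apply]
        rfl }
  have hf₂ (x : A') (hx : x ∈ idealS' A' V) : f₂ x = 0 := by
    change σ (e.symm (Ideal.Quotient.mk _ x)) = 0
    rw [Ideal.Quotient.eq_zero_iff_mem.2 hx, map_zero, map_zero]
  have : f₁ = f₂ := by
    refine Algebra.FormallyUnramified.ext J hJ fun x ↦ ?_
    obtain ⟨y, hy⟩ := hsq.exists_sub_mem x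
    have h2 : f₂ x = f₁ (algebraMap A A' y) := by
      rw [f₁.commutes, ← f₂.commutes, ← sub_eq_zero, ← map_sub]
      exact hf₂ _ hy
    rw [h2, Ideal.Quotient.eq, ← map_sub]
    exact Ideal.mem_map_of_mem _ hy
  have h0 := hf₂ a ha
  rw [← this] at h0
  exact Ideal.Quotient.eq_zero_iff_mem.1 h0

variable (hS' : ((Ideal.Quotient.mk (idealS' A' V)).comp (algebraMap R A')).Finite)

omit [Algebra R A] [IsScalarTower R A A'] in
include hS' in
lemma finite_fibrePoints : (fibrePoints R V x').Finite := by
  let N := A' ⧸ idealS' A' V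
  have : Module.Finite R N := RingHom.finite_algebraMap.1 hS'
  have h := Algebra.QuasiFinite.finite_comap_preimage_singleton (R := R) (S := N)
    (PrimeSpectrum.comap (algebraMap R A') x')
  refine (h.image (PrimeSpectrum.comap (Ideal.Quotient.mk (idealS' A' V)))).subset ?_
  rintro p ⟨hp, hpx⟩
  have : p ∈ Set.range (PrimeSpectrum.comap (Ideal.Quotient.mk (idealS' A' V))) := by
    rw [range_comap_of_surjective _ _ Ideal.Quotient.mk_surjective, Ideal.mk_ker,
      PrimeSpectrum.mem_zeroLocus]
    exact mem_closedS'_iff.1 hp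
  obtain ⟨y, rfl⟩ := this
  exact ⟨y, hpx, rfl⟩

omit [Algebra R A] [IsScalarTower R A A'] in
include hS' in
-- S' is finite over B, so closedness passes down from x' to b and up again to every point of S'
-- over b.
lemma isMaximal_of_mem_fibrePoints (hx'max : x'.asIdeal.IsMaximal) (hx'S : x' ∈ closedS' A' V)
    {p : PrimeSpectrum A'} (hp : p ∈ fibrePoints R V x') : p.asIdeal.IsMaximal := by
  let N := A' ⧸ idealS' A' V
  have : Module.Finite R N := RingHom.finite_algebraMap.1 hS'
  have key (p : PrimeSpectrum A') (hp : p ∈ closedS' A' V) :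
      ∃ y : PrimeSpectrum N, PrimeSpectrum.comap (Ideal.Quotient.mk (idealS' A' V)) y = p := by
    have : p ∈ Set.range (PrimeSpectrum.comap (Ideal.Quotient.mk (idealS' A' V))) := by
      rw [range_comap_of_surjective _ _ Ideal.Quotient.mk_surjective, Ideal.mk_ker,
        PrimeSpectrum.mem_zeroLocus]
      exact mem_closedS'_iff.1 hp
    exact this
  obtain ⟨y, rfl⟩ := key x' hx'S
  obtain ⟨z, rfl⟩ := key p hp.1
  have hy : y.asIdeal.IsMaximal := by
    have h := Ideal.map_eq_top_or_isMaximal_of_surjective (Ideal.Quotient.mk (idealS' A' V))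
      Ideal.Quotient.mk_surjective hx'max
    rw [PrimeSpectrum.comap_asIdeal,
      Ideal.map_comap_of_surjective _ Ideal.Quotient.mk_surjective] at h
    exact h.resolve_left y.isPrime.ne_top
  have hy' : (y.asIdeal.comap (algebraMap R N)).IsMaximal :=
    Ideal.isMaximal_comap_of_isIntegral_of_isMaximal _
  have hz : z.asIdeal.comap (algebraMap R N) = y.asIdeal.comap (algebraMap R N) :=
    congr_arg PrimeSpectrum.asIdeal hp.2
  have : z.asIdeal.IsMaximal :=
    Ideal.isMaximal_of_isIntegral_of_isMaximal_comap _ (hz ▸ hy')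
  exact Ideal.comap_isMaximal_of_surjective _ Ideal.Quotient.mk_surjective

omit [Algebra R A] [IsScalarTower R A A'] in
include hsq hS' in
-- The isomorphism S' → S makes `A` surject onto the residue field of each of the points s'_i.
lemma isMaximal_of_mem_image_fibrePoints (hx'max : x'.asIdeal.IsMaximal)
    (hx'S : x' ∈ closedS' A' V) {t : PrimeSpectrum A}
    (ht : t ∈ PrimeSpectrum.comap (algebraMap A A') '' fibrePoints R V x') :
    t.asIdeal.IsMaximal := by
  obtain ⟨p, hp, rfl⟩ := ht
  have hpm := isMaximal_of_mem_fibrePoints hS' hx'max hx'S hp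
  have hsurj : Function.Surjective ((Ideal.Quotient.mk p.asIdeal).comp (algebraMap A A')) := by
    intro y
    obtain ⟨y, rfl⟩ := Ideal.Quotient.mk_surjective y
    obtain ⟨a, ha⟩ := hsq.exists_sub_mem y
    exact ⟨a, (Ideal.Quotient.eq.2 (mem_closedS'_iff.1 hp.1 ha)).symm⟩
  have : p.asIdeal.comap (algebraMap A A') =
      (⊥ : Ideal (A' ⧸ p.asIdeal)).comap ((Ideal.Quotient.mk p.asIdeal).comp (algebraMap A A')) := by
    rw [← Ideal.comap_comap, ← RingHom.ker_eq_comap_bot, Ideal.mk_ker]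
  change (p.asIdeal.comap (algebraMap A A')).IsMaximal
  rw [this]
  have : (⊥ : Ideal (A' ⧸ p.asIdeal)).IsMaximal := Ideal.bot_quotient_isMaximal_iff _ |>.2 hpm
  exact Ideal.comap_isMaximal_of_surjective _ hsurj

omit [Algebra R A] [IsScalarTower R A A'] in
lemma isUnit_algebraMap_ringW' {r : R} (hr : r ∉ (PrimeSpectrum.comap (algebraMap R A') x').asIdeal) :
    IsUnit (algebraMap R (ringW' R V x') r) := by
  rw [IsScalarTower.algebraMap_apply R A']
  refine isUnit_algebraMap_semiLoc fun p hp h ↦ hr ?_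
  rw [← hp.2]
  exact h

lemma isUnit_algebraMap_ringW {r : R} (hr : r ∉ (PrimeSpectrum.comap (algebraMap R A') x').asIdeal) :
    IsUnit (algebraMap R (ringW R V x') r) := by
  rw [IsScalarTower.algebraMap_apply R A]
  refine isUnit_algebraMap_semiLoc ?_
  rintro _ ⟨p, hp, rfl⟩ h
  refine hr ?_
  rw [← hp.2]
  change algebraMap R A' r ∈ p.asIdeal
  rw [IsScalarTower.algebraMap_apply R A]
  exact h

end Square

/-! ### The conormal module of a graph and Kähler differentials -/

section GraphIdeal

variable {R P L : Type u} [CommRing R] [CommRing P] [CommRing L] [Algebra R P] [Algebra R L]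

/-- The restriction of functions on `Spec L × Spec P` to the graph. -/
abbrev graphEval (g : P →ₐ[R] L) : L ⊗[R] P →ₐ[R] L :=
  Algebra.TensorProduct.lift (AlgHom.id R L) g (fun _ _ ↦ Commute.all _ _)

lemma sub_graphEval_mem_span (g : P →ₐ[R] L) (x : L ⊗[R] P) :
    x - graphEval g x ⊗ₜ[R] (1 : P) ∈
      Ideal.span (Set.range fun p : P ↦ (1 : L) ⊗ₜ[R] p - g p ⊗ₜ[R] (1 : P)) := by
  induction x with
  | zero => simp
  | add x y hx hy =>
    rw [map_add, TensorProduct.add_tmul, add_sub_add_comm]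
    exact add_mem hx hy
  | tmul l p =>
    have : l ⊗ₜ[R] p - graphEval g (l ⊗ₜ p) ⊗ₜ[R] (1 : P) =
        (l ⊗ₜ[R] (1 : P)) * ((1 : L) ⊗ₜ[R] p - g p ⊗ₜ[R] (1 : P)) := by
      simp [mul_sub]
    rw [this]
    exact Ideal.mul_mem_left _ _ (Ideal.subset_span ⟨p, rfl⟩)

lemma mem_graphIdeal {g : P →ₐ[R] L} {x : L ⊗[R] P} : x ∈ graphIdeal g ↔ graphEval g x = 0 := Iff.rfl

lemma sub_graphEval_mem (g : P →ₐ[R] L) (x : L ⊗[R] P) :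
    x - graphEval g x ⊗ₜ[R] (1 : P) ∈ graphIdeal g := by
  simp [mem_graphIdeal]

lemma graphIdeal_eq_span (g : P →ₐ[R] L) : graphIdeal g =
    Ideal.span (Set.range fun p : P ↦ (1 : L) ⊗ₜ[R] p - g p ⊗ₜ[R] (1 : P)) := by
  refine le_antisymm (fun x hx ↦ ?_) (Ideal.span_le.2 ?_)
  · have := sub_graphEval_mem_span g x
    rwa [mem_graphIdeal.1 hx, TensorProduct.zero_tmul, sub_zero] at this
  · rintro _ ⟨p, rfl⟩
    exact one_tmul_sub_mem_graphIdeal g p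

/-- A function acts on the conormal module of the graph through its restriction to the graph. -/
lemma smul_graphIdeal_cotangent (g : P →ₐ[R] L) (x : L ⊗[R] P) (y : (graphIdeal g).Cotangent) :
    x • y = graphEval g x • y := by
  obtain ⟨y, rfl⟩ := (graphIdeal g).toCotangent_surjective y
  have h : graphEval g x • (graphIdeal g).toCotangent y =
      (graphEval g x ⊗ₜ[R] (1 : P)) • (graphIdeal g).toCotangent y := by
    rw [← algebraMap_smul (L ⊗[R] P) (graphEval g x) ((graphIdeal g).toCotangent y)]
    rfl
  rw [h, ← sub_eq_zero, ← sub_smul, ← map_smul, Ideal.toCotangent_eq_zero, pow_two]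
  exact Ideal.mul_mem_mul (sub_graphEval_mem g x) y.2

variable [Algebra P L] [IsScalarTower R P L]

variable (R P L) in
/-- The differential of a function on `Spec L × Spec P` along the second factor, restricted to
the graph. -/
noncomputable def graphDiff : L ⊗[R] P →ₗ[L] L ⊗[P] Ω[P⁄R] :=
  ((TensorProduct.mk P L Ω[P⁄R] 1).restrictScalars R ∘ₗ
    (KaehlerDifferential.D R P).toLinearMap).liftBaseChange L

@[simp]
lemma graphDiff_tmul (l : L) (p : P) :
    graphDiff R P L (l ⊗ₜ p) = l ⊗ₜ[P] KaehlerDifferential.D R P p := by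
  simp [graphDiff, TensorProduct.smul_tmul']

/-- The Leibniz rule along the second factor. It makes `graphDiff` vanish on J², so that it can
serve as an inverse on the conormal module. -/
lemma graphDiff_mul (x y : L ⊗[R] P) : graphDiff R P L (x * y) =
    graphEval (IsScalarTower.toAlgHom R P L) x • graphDiff R P L y +
      graphEval (IsScalarTower.toAlgHom R P L) y • graphDiff R P L x := by
  induction x with
  | zero => simp
  | add x z hx hz =>
    rw [add_mul, map_add, hx, hz, map_add, map_add, add_smul, smul_add]
    abel
  | tmul l p =>
    induction y with
    | zero => simp
    | add x z hx hz =>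
      rw [mul_add, map_add, hx, hz, map_add, map_add, add_smul, smul_add]
      abel
    | tmul m q =>
      simp only [Algebra.TensorProduct.tmul_mul_tmul, graphDiff_tmul, Derivation.leibniz,
        TensorProduct.tmul_add, Algebra.TensorProduct.lift_tmul, AlgHom.id_apply,
        TensorProduct.tmul_smul, TensorProduct.smul_tmul', IsScalarTower.coe_toAlgHom',
        Algebra.smul_def, Algebra.algebraMap_self_apply]
      congr 2 <;> ring

lemma graphDiff_eq_zero_of_mem_sq {x : L ⊗[R] P}
    (hx : x ∈ graphIdeal (IsScalarTower.toAlgHom R P L) ^ 2) : graphDiff R P L x = 0 := by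
  rw [pow_two] at hx
  refine Submodule.mul_induction_on hx (fun x hx y hy ↦ ?_) fun x y hx hy ↦ ?_
  · rw [graphDiff_mul, mem_graphIdeal.1 hx, mem_graphIdeal.1 hy, zero_smul, zero_smul, add_zero]
  · rw [map_add, hx, hy, add_zero]

variable (R P L) in
/-- The map from the pull-back of the differentials to the conormal module of the graph. -/
noncomputable def tensorKaehlerToCotangent :
    L ⊗[P] Ω[P⁄R] →ₗ[L] (graphIdeal (IsScalarTower.toAlgHom R P L)).Cotangent :=
  let d : Derivation R P (graphIdeal (IsScalarTower.toAlgHom R P L)).Cotangent :=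
    .mk' { toFun := fun p ↦ (graphIdeal (IsScalarTower.toAlgHom R P L)).toCotangent
              ⟨_, one_tmul_sub_mem_graphIdeal (IsScalarTower.toAlgHom R P L) p⟩
           map_add' := fun x y ↦ by
            rw [← map_add]
            congr 1
            ext
            simp [TensorProduct.tmul_add, TensorProduct.add_tmul]
            abel
           map_smul' := fun r x ↦ by
            rw [RingHom.id_apply, ← LinearMap.map_smul_of_tower]
            congr 1
            ext
            simp [TensorProduct.tmul_smul, smul_sub, TensorProduct.smul_tmul'] }
      fun a b ↦ by
        change Ideal.toCotangent _ _ = a • Ideal.toCotangent _ _ +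
          b • Ideal.toCotangent _ _
        rw [← LinearMap.map_smul_of_tower, ← LinearMap.map_smul_of_tower, ← map_add,
          Ideal.toCotangent_eq, pow_two]
        -- The defect of the Leibniz rule is a product of two elements of the graph ideal.
        have : (1 : L) ⊗ₜ[R] (a * b) - algebraMap P L (a * b) ⊗ₜ[R] (1 : P) -
            (a • ((1 : L) ⊗ₜ[R] b - algebraMap P L b ⊗ₜ[R] (1 : P)) +
            b • ((1 : L) ⊗ₜ[R] a - algebraMap P L a ⊗ₜ[R] (1 : P))) =
            ((1 : L) ⊗ₜ[R] a - algebraMap P L a ⊗ₜ[R] (1 : P)) *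
              ((1 : L) ⊗ₜ[R] b - algebraMap P L b ⊗ₜ[R] (1 : P)) := by
          have hs (c : P) (l : L) (p : P) : c • (l ⊗ₜ[R] p) = (algebraMap P L c * l) ⊗ₜ[R] p := by
            rw [TensorProduct.smul_tmul', Algebra.smul_def]
          simp only [mul_sub, sub_mul, smul_sub, hs, Algebra.TensorProduct.tmul_mul_tmul, mul_one,
            one_mul, map_mul]
          rw [mul_comm (algebraMap P L b) (algebraMap P L a)]
          abel
        change (1 : L) ⊗ₜ[R] (a * b) - algebraMap P L (a * b) ⊗ₜ[R] (1 : P) -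
            (a • ((1 : L) ⊗ₜ[R] b - algebraMap P L b ⊗ₜ[R] (1 : P)) +
            b • ((1 : L) ⊗ₜ[R] a - algebraMap P L a ⊗ₜ[R] (1 : P))) ∈ _
        rw [this]
        exact Ideal.mul_mem_mul (one_tmul_sub_mem_graphIdeal _ a) (one_tmul_sub_mem_graphIdeal _ b)
  d.liftKaehlerDifferential.liftBaseChange L

@[simp]
lemma tensorKaehlerToCotangent_tmul_D (l : L) (p : P) :
    tensorKaehlerToCotangent R P L (l ⊗ₜ KaehlerDifferential.D R P p) =
      l • (graphIdeal (IsScalarTower.toAlgHom R P L)).toCotangent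
        ⟨_, one_tmul_sub_mem_graphIdeal (IsScalarTower.toAlgHom R P L) p⟩ := by
  unfold tensorKaehlerToCotangent
  erw [LinearMap.liftBaseChange_tmul, Derivation.liftKaehlerDifferential_comp_D]
  rfl

omit [Algebra R L] [IsScalarTower R P L] in
lemma tensor_kaehler_induction {motive : L ⊗[P] Ω[P⁄R] → Prop} (x : L ⊗[P] Ω[P⁄R])
    (zero : motive 0) (add : ∀ x y, motive x → motive y → motive (x + y))
    (tmul_D : ∀ (l : L) (p : P), motive (l ⊗ₜ KaehlerDifferential.D R P p)) : motive x := by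
  induction x with
  | zero => exact zero
  | add x y hx hy => exact add x y hx hy
  | tmul l ω =>
    have hω : ω ∈ Submodule.span P (Set.range (KaehlerDifferential.D R P)) := by
      rw [KaehlerDifferential.span_range_derivation]; trivial
    induction hω using Submodule.span_induction generalizing l with
    | mem x hx => obtain ⟨p, rfl⟩ := hx; exact tmul_D l p
    | zero => rwa [TensorProduct.tmul_zero]
    | add x y _ _ hx hy => rw [TensorProduct.tmul_add]; exact add _ _ (hx l) (hy l)
    | smul a x _ hx => rw [← TensorProduct.smul_tmul]; exact hx (a • l)

/-- One element j witnesses both directions: its differential is x and its class is the image of x.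
Injectivity follows, since j ∈ J² forces the differential of j to vanish. -/
lemma exists_toCotangent_eq_tensorKaehlerToCotangent (x : L ⊗[P] Ω[P⁄R]) :
    ∃ j : graphIdeal (IsScalarTower.toAlgHom R P L), graphDiff R P L j = x ∧
      tensorKaehlerToCotangent R P L x = (graphIdeal (IsScalarTower.toAlgHom R P L)).toCotangent j := by
  induction x using tensor_kaehler_induction with
  | zero => exact ⟨0, by simp⟩
  | add x y hx hy =>
    obtain ⟨i, rfl, hi⟩ := hx
    obtain ⟨j, rfl, hj⟩ := hy
    exact ⟨i + j, by simp, by rw [map_add, map_add, hi, hj]⟩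
  | tmul_D l p =>
    refine ⟨l • ⟨_, one_tmul_sub_mem_graphIdeal (IsScalarTower.toAlgHom R P L) p⟩, ?_, ?_⟩
    · change graphDiff R P L (l • ((1 : L) ⊗ₜ[R] p - algebraMap P L p ⊗ₜ[R] (1 : P))) = _
      simp [TensorProduct.smul_tmul']
    · rw [LinearMap.map_smul_of_tower, tensorKaehlerToCotangent_tmul_D]

variable (R P L) in
lemma tensorKaehlerToCotangent_bijective : Function.Bijective (tensorKaehlerToCotangent R P L) := by
  constructor
  · rw [injective_iff_map_eq_zero]
    intro x hx
    obtain ⟨j, rfl, hj⟩ := exists_toCotangent_eq_tensorKaehlerToCotangent x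
    rw [hj, Ideal.toCotangent_eq_zero] at hx
    exact graphDiff_eq_zero_of_mem_sq hx
  · intro y
    obtain ⟨⟨j, hj⟩, rfl⟩ := Ideal.toCotangent_surjective _ y
    have hj' := hj
    rw [graphIdeal_eq_span] at hj'
    suffices h : ∀ j (hj : j ∈ graphIdeal (IsScalarTower.toAlgHom R P L)),
        j ∈ Ideal.span (Set.range fun p : P ↦ (1 : L) ⊗ₜ[R] p - algebraMap P L p ⊗ₜ[R] (1 : P)) →
        Ideal.toCotangent _ ⟨j, hj⟩ ∈ LinearMap.range (tensorKaehlerToCotangent R P L) from h j hj hj'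
    intro j hj hj'
    induction hj' using Submodule.span_induction with
    | mem x hx =>
      obtain ⟨p, rfl⟩ := hx
      exact ⟨1 ⊗ₜ KaehlerDifferential.D R P p, by simp⟩
    | zero => convert! Submodule.zero_mem _
    | add x y hxs hys hx hy =>
      have hmem {z} (hz : z ∈ Ideal.span (Set.range fun p : P ↦
          (1 : L) ⊗ₜ[R] p - algebraMap P L p ⊗ₜ[R] (1 : P))) :
          z ∈ graphIdeal (IsScalarTower.toAlgHom R P L) := by
        rw [graphIdeal_eq_span]; exact hz
      exact add_mem (hx (hmem hxs)) (hy (hmem hys))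
    | smul a x hxs hx =>
      have hmem : x ∈ graphIdeal (IsScalarTower.toAlgHom R P L) := by
        rw [graphIdeal_eq_span]; exact hxs
      have : Ideal.toCotangent _ ⟨a • x, hj⟩ = a • Ideal.toCotangent _ ⟨x, hmem⟩ := rfl
      rw [this, smul_graphIdeal_cotangent]
      exact Submodule.smul_mem _ _ (hx hmem)

variable (R P L) in
/-- The conormal module of the graph of `Spec L ⟶ Spec P` is the pull-back of the module of
differentials. -/
noncomputable def tensorKaehlerEquivCotangent :
    L ⊗[P] Ω[P⁄R] ≃ₗ[L] (graphIdeal (IsScalarTower.toAlgHom R P L)).Cotangent :=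
  .ofBijective _ (tensorKaehlerToCotangent_bijective R P L)

lemma tensorKaehlerEquivCotangent_graphDiff (j : graphIdeal (IsScalarTower.toAlgHom R P L)) :
    tensorKaehlerEquivCotangent R P L (graphDiff R P L j) = Ideal.toCotangent _ j := by
  obtain ⟨x, hx⟩ := (tensorKaehlerEquivCotangent R P L).surjective (Ideal.toCotangent _ j)
  obtain ⟨i, rfl, hi⟩ := exists_toCotangent_eq_tensorKaehlerToCotangent x
  rw [← hx]
  congr 1
  have : Ideal.toCotangent _ i = Ideal.toCotangent _ j := hi.symm.trans hx
  rw [← sub_eq_zero, ← map_sub]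
  exact graphDiff_eq_zero_of_mem_sq ((Ideal.toCotangent_eq _).1 this.symm)

end GraphIdeal

/-! ### Generators of the graph ideal modulo its square -/

section GraphGenerators

variable {R P L : Type u} [CommRing R] [CommRing P] [CommRing L] [Algebra R P] [Algebra R L]
  [Algebra P L] [IsScalarTower R P L]

/-- If `du` generates the pull-back of the differentials, then `1 ⊗ u - u ⊗ 1` generates the ideal
of the graph modulo its square. -/
lemma graphIdeal_le_span_sup_sq {u : P}
    (hu : ∀ x : L ⊗[P] Ω[P⁄R], ∃ l : L, x = l ⊗ₜ KaehlerDifferential.D R P u) :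
    graphIdeal (IsScalarTower.toAlgHom R P L) ≤
      Ideal.span {(1 : L) ⊗ₜ[R] u - algebraMap P L u ⊗ₜ[R] (1 : P)} ⊔
        graphIdeal (IsScalarTower.toAlgHom R P L) ^ 2 := by
  intro j hj
  obtain ⟨l, hl⟩ := hu (graphDiff R P L j)
  have h1 := tensorKaehlerEquivCotangent_graphDiff (⟨j, hj⟩ : graphIdeal (IsScalarTower.toAlgHom R P L))
  rw [hl] at h1
  have h2 := (tensorKaehlerToCotangent_tmul_D (R := R) l u).symm.trans h1
  rw [← LinearMap.map_smul_of_tower] at h2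
  have h3 := (Ideal.toCotangent_eq _).1 h2.symm
  refine Submodule.mem_sup.2 ⟨l • ((1 : L) ⊗ₜ[R] u - algebraMap P L u ⊗ₜ[R] (1 : P)), ?_, _, h3, ?_⟩
  · rw [Algebra.smul_def]
    exact Ideal.mul_mem_left _ _ (Ideal.mem_span_singleton_self _)
  · exact add_sub_cancel _ _

end GraphGenerators

/-! ### Controlling zeros at finitely many closed points -/

section ClosedFibre

/-- A correction in `K²` that makes a function invertible at finitely many closed points outside
the zero locus of `K`. -/
lemma exists_mem_sq_forall_add_notMem {Q : Type*} [CommRing Q] (K : Ideal Q)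
    {T : Set (PrimeSpectrum Q)} (hT : T.Finite) (hmax : ∀ M ∈ T, M.asIdeal.IsMaximal)
    (hK : ∀ M ∈ T, ¬ K ≤ M.asIdeal) (f : Q) :
    ∃ ε ∈ K ^ 2, ∀ M ∈ T, f + ε ∉ M.asIdeal := by
  have hcop : IsCoprime (K ^ 2) (⨅ M ∈ hT.toFinset, M.asIdeal) := by
    rw [Ideal.isCoprime_iff_sup_eq]
    refine Ideal.sup_iInf_eq_top fun M hM ↦ ?_
    have hM' := hT.mem_toFinset.1 hM
    by_contra h
    obtain ⟨N, hN, hle⟩ := Ideal.exists_le_maximal _ h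
    have h1 : M.asIdeal = N := (hmax M hM').eq_of_le hN.ne_top (le_sup_right.trans hle)
    exact hK M hM' (h1 ▸ hN.isPrime.le_of_pow_le (le_sup_left.trans hle))
  obtain ⟨α, hα, β, hβ, hαβ⟩ := Ideal.isCoprime_iff_exists.1 hcop
  -- Since α + β = 1 with β in every M of T, the corrected function f + α(1 − f) is congruent to 1
  -- at each of these points.
  refine ⟨α * (1 - f), Ideal.mul_mem_right _ _ hα, fun M hM h ↦ ?_⟩
  have hβM : β ∈ M.asIdeal := by
    have := (Submodule.mem_iInf _).1 ((Submodule.mem_iInf _).1 hβ M)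
    exact this (hT.mem_toFinset.2 hM)
  refine (hmax M hM).ne_top ((Ideal.eq_top_iff_one _).2 ?_)
  have : (1 : Q) = (f + α * (1 - f)) + β * (1 - f) := by
    linear_combination (f - 1) * hαβ
  rw [this]
  exact add_mem h (Ideal.mul_mem_right _ _ hβM)

/-- Suppose that `F` generates `K` modulo `K²` and `S ≤ K`, and that `F` vanishes at no closed point
of the zero locus of `S` outside the zero locus of `K`. Then the zero locus of `F` and `S` is the
zero locus of `K`. -/
lemma le_of_mem_of_le_span_sup_sq {Q : Type*} [CommRing Q] {K S : Ideal Q} (hKfg : K.FG) {F : Q}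
    (hgen : K ≤ Ideal.span {F} ⊔ K ^ 2 ⊔ S)
    (hF : ∀ M : Ideal Q, M.IsMaximal → S ≤ M → F ∈ M → K ≤ M)
    {z : Ideal Q} [hz : z.IsPrime] (hSz : S ≤ z) (hFz : F ∈ z) : K ≤ z := by
  obtain ⟨M, hM, hzM⟩ := Ideal.exists_le_maximal z hz.ne_top
  have hKM := hF M hM (hSz.trans hzM) (hzM hFz)
  have hle : K ≤ (Ideal.span {F} ⊔ S) ⊔ K • K := by
    rw [smul_eq_mul, ← pow_two, sup_right_comm]
    exact hgen
  -- Nakayama: r ≡ 1 modulo K and rK ⊆ (F) + S. As z specializes to a closed point M of the zero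
  -- locus of K, the element r is nonzero at z.
  obtain ⟨r, hr, hr'⟩ := Submodule.exists_sub_one_mem_and_smul_le_of_fg_of_le_sup hKfg le_rfl hle
  have hrM : r ∉ M := fun h ↦ hM.ne_top ((Ideal.eq_top_iff_one _).2 (by
    simpa using M.sub_mem h (hKM hr)))
  have hrz : r ∉ z := fun h ↦ hrM (hzM h)
  intro x hx
  have h1 : r * x ∈ Ideal.span {F} ⊔ S := hr' (Submodule.smul_mem_pointwise_smul x r K hx)
  have h2 : Ideal.span {F} ⊔ S ≤ z := sup_le ((Ideal.span_singleton_le_iff_mem _).2 hFz) hSz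
  exact (hz.mem_or_mem (h2 h1)).resolve_left hrz

end ClosedFibre

/-! ### The closed subscheme Spec P × S' -/

section Vertical

variable {R A' P : Type u} [CommRing R] [CommRing A'] [CommRing P] [Algebra R A'] [Algebra R P]

variable (R P) in
/-- The ideal of `Spec P × Z'` in `Spec P × Spec A'`, for a closed subscheme `Z'` of `Spec A'`. -/
abbrev vertIdeal (I' : Ideal A') : Ideal (P ⊗[R] A') :=
  I'.map (Algebra.TensorProduct.includeRight : A' →ₐ[R] P ⊗[R] A')

lemma finite_quotient_vertIdeal {I' : Ideal A'}
    (hfin : ((Ideal.Quotient.mk I').comp (algebraMap R A')).Finite) :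
    Module.Finite P ((P ⊗[R] A') ⧸ vertIdeal R P I') := by
  have : Module.Finite R (A' ⧸ I') := RingHom.finite_algebraMap.1 hfin
  let f : P ⊗[R] (A' ⧸ I') →ₐ[P] (P ⊗[R] A') ⧸ vertIdeal R P I' :=
    Algebra.TensorProduct.lift (Algebra.ofId _ _)
      (Ideal.Quotient.liftₐ I' ((Ideal.Quotient.mkₐ R (vertIdeal R P I')).comp
        Algebra.TensorProduct.includeRight) fun a ha ↦
          Ideal.Quotient.eq_zero_iff_mem.2 (Ideal.mem_map_of_mem _ ha)) (fun _ _ ↦ Commute.all _ _)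
  refine Module.Finite.of_surjective f.toLinearMap fun x ↦ ?_
  obtain ⟨x, rfl⟩ := Ideal.Quotient.mk_surjective x
  induction x with
  | zero => exact ⟨0, by simp⟩
  | add x y hx hy =>
    obtain ⟨a, ha⟩ := hx
    obtain ⟨b, hb⟩ := hy
    exact ⟨a + b, by rw [map_add, ha, hb, map_add]⟩
  | tmul p a =>
    refine ⟨p ⊗ₜ Ideal.Quotient.mk I' a, ?_⟩
    change Ideal.Quotient.mk (vertIdeal R P I') (p ⊗ₜ[R] (1 : A')) *
      Ideal.Quotient.mk (vertIdeal R P I') ((1 : P) ⊗ₜ[R] a) = _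
    rw [← map_mul]
    simp

/-- Finiteness over P: closed points lie over the finitely many closed points of Spec P, and the
fibres are finite. -/
lemma finite_setOf_isMaximal_vertIdeal_le {I' : Ideal A'}
    (hfin : ((Ideal.Quotient.mk I').comp (algebraMap R A')).Finite)
    (hP : {M : PrimeSpectrum P | M.asIdeal.IsMaximal}.Finite) :
    {M : PrimeSpectrum (P ⊗[R] A') | M.asIdeal.IsMaximal ∧ vertIdeal R P I' ≤ M.asIdeal}.Finite := by
  let N := (P ⊗[R] A') ⧸ vertIdeal R P I'
  have : Module.Finite P N := finite_quotient_vertIdeal hfin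
  have h := Algebra.QuasiFinite.finite_comap_preimage (R := P) (S := N) hP
  refine (h.image (PrimeSpectrum.comap (Ideal.Quotient.mk (vertIdeal R P I')))).subset ?_
  rintro M ⟨hM, hle⟩
  have : M ∈ Set.range (PrimeSpectrum.comap (Ideal.Quotient.mk (vertIdeal R P I'))) := by
    rw [range_comap_of_surjective _ _ Ideal.Quotient.mk_surjective, Ideal.mk_ker,
      PrimeSpectrum.mem_zeroLocus]
    exact hle
  obtain ⟨y, rfl⟩ := this
  have hy : y.asIdeal.IsMaximal := by
    have h := Ideal.map_eq_top_or_isMaximal_of_surjective (Ideal.Quotient.mk (vertIdeal R P I'))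
      Ideal.Quotient.mk_surjective hM
    rw [PrimeSpectrum.comap_asIdeal,
      Ideal.map_comap_of_surjective _ Ideal.Quotient.mk_surjective] at h
    exact h.resolve_left y.isPrime.ne_top
  exact ⟨y, (Ideal.isMaximal_comap_of_isIntegral_of_isMaximal y.asIdeal :
    (y.asIdeal.comap (algebraMap P N)).IsMaximal), rfl⟩

end Vertical

/-! ### The transposed graph of S' and its pull-back to W' -/

section Diagonal

variable {R A A' P P' : Type u} [CommRing R] [CommRing A] [CommRing A'] [CommRing P] [CommRing P']
  [Algebra R A] [Algebra R A'] [Algebra A A'] [IsScalarTower R A A']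
  [Algebra R P] [Algebra A P] [IsScalarTower R A P]
  [Algebra R P'] [Algebra A' P'] [IsScalarTower R A' P']

variable (R A P) in
/-- The ideal of the graph of `Z' ⟶ Spec A` over `Spec P`, transposed to a closed subscheme of
`Spec P × Spec A'`, for a closed subscheme `Z'` of `Spec A'`. -/
abbrev transposeIdeal (I' : Ideal A') : Ideal (P ⊗[R] A') :=
  vertIdeal R P I' ⊔ Ideal.span (Set.range fun a : A ↦
    (1 : P) ⊗ₜ[R] algebraMap A A' a - algebraMap A P a ⊗ₜ[R] (1 : A'))

omit [Algebra R A] [IsScalarTower R A A'] [IsScalarTower R A P] in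
lemma one_tmul_sub_mem_transposeIdeal (I' : Ideal A') (a : A) :
    (1 : P) ⊗ₜ[R] algebraMap A A' a - algebraMap A P a ⊗ₜ[R] (1 : A') ∈ transposeIdeal R A P I' :=
  Ideal.mem_sup_right (Ideal.subset_span ⟨a, rfl⟩)

omit [Algebra R A] [IsScalarTower R A A'] [IsScalarTower R A P] in
lemma tmul_one_mem_transposeIdeal {I' : Ideal A'} {a : A} (ha : algebraMap A A' a ∈ I') :
    algebraMap A P a ⊗ₜ[R] (1 : A') ∈ transposeIdeal R A P I' := by
  have h1 : (1 : P) ⊗ₜ[R] algebraMap A A' a ∈ transposeIdeal R A P I' :=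
    Ideal.mem_sup_left (Ideal.mem_map_of_mem _ ha)
  simpa using sub_mem h1 (one_tmul_sub_mem_transposeIdeal I' a)

/-- Apart from the functions vanishing on the subscheme of `I'`, the ideal is generated by the
pull-back along id × Π of the graph ideal of W → X, for which u gives a generator modulo the square.
-/
lemma transposeIdeal_le {I' : Ideal A'} {u : A}
    (hu : ∀ x : P ⊗[A] Ω[A⁄R], ∃ l : P, x = l ⊗ₜ KaehlerDifferential.D R A u) :
    transposeIdeal R A P I' ≤
      Ideal.span {(1 : P) ⊗ₜ[R] algebraMap A A' u - algebraMap A P u ⊗ₜ[R] (1 : A')} ⊔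
        transposeIdeal R A P I' ^ 2 ⊔ vertIdeal R P I' := by
  refine sup_le le_sup_right ((Ideal.span_le.2 ?_).trans le_sup_left)
  rintro _ ⟨a, rfl⟩
  let f : P ⊗[R] A →ₐ[P] P ⊗[R] A' :=
    Algebra.TensorProduct.map (AlgHom.id P P) (IsScalarTower.toAlgHom R A A')
  have h := Ideal.mem_map_of_mem f
    (graphIdeal_le_span_sup_sq hu (one_tmul_sub_mem_graphIdeal (IsScalarTower.toAlgHom R A P) a))
  have hle : (graphIdeal (IsScalarTower.toAlgHom R A P)).map f ≤ transposeIdeal R A P I' := by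
    rw [graphIdeal_eq_span, Ideal.map_span, Ideal.span_le]
    rintro _ ⟨_, ⟨b, rfl⟩, rfl⟩
    have : f ((1 : P) ⊗ₜ[R] b - IsScalarTower.toAlgHom R A P b ⊗ₜ[R] (1 : A)) =
      (1 : P) ⊗ₜ[R] algebraMap A A' b - algebraMap A P b ⊗ₜ[R] (1 : A') := by simp [f]
    rw [SetLike.mem_coe, this]
    exact one_tmul_sub_mem_transposeIdeal I' b
  rw [Ideal.map_sup, Ideal.map_pow, Ideal.map_span, Set.image_singleton] at h
  have h' := sup_le_sup_left (Ideal.pow_right_mono hle 2) _ h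
  simpa [f] using h'

variable (π : P →ₐ[R] P')
  (hπ : ∀ a, π (algebraMap A P a) = algebraMap A' P' (algebraMap A A' a))

include hπ in
omit [Algebra R A] [IsScalarTower R A A'] [IsScalarTower R A P] in
lemma map_transposeIdeal_le (I' : Ideal A') :
    (transposeIdeal R A P I').map (Algebra.TensorProduct.map π (AlgHom.id R A')) ≤
      graphIdeal (IsScalarTower.toAlgHom R A' P') ⊔ vertIdeal R P' I' := by
  rw [Ideal.map_sup, Ideal.map_span]
  refine sup_le ?_ (Ideal.span_le.2 ?_)
  · refine le_sup_of_le_right (Ideal.map_le_iff_le_comap.2 (Ideal.map_le_iff_le_comap.2 fun a ha ↦ ?_))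
    rw [Ideal.mem_comap, Ideal.mem_comap]
    convert! Ideal.mem_map_of_mem (Algebra.TensorProduct.includeRight : A' →ₐ[R] P' ⊗[R] A') ha
    simp
  · rintro _ ⟨_, ⟨a, rfl⟩, rfl⟩
    refine Ideal.mem_sup_left ?_
    convert! one_tmul_sub_mem_graphIdeal (IsScalarTower.toAlgHom R A' P') (algebraMap A A' a)
    simp [hπ]

include hπ in
omit [Algebra R A] [IsScalarTower R A A'] [IsScalarTower R A P] in
-- Write a' = a + i with a from `A` and i ∈ I'. Then 1 ⊗ a' − a' ⊗ 1 is (1 ⊗ a − a ⊗ 1) + 1 ⊗ i − i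
-- ⊗ 1. The last term is covered because I' is generated by I, and a ⊗ 1 vanishes on the transposed
-- graph for a ∈ I.
lemma graphIdeal_le_map_transposeIdeal {I : Ideal A} {I' : Ideal A'}
    (hI : I.map (algebraMap A A') = I') (hsurj : ∀ a' : A', ∃ a : A, a' - algebraMap A A' a ∈ I') :
    graphIdeal (IsScalarTower.toAlgHom R A' P') ≤
      (transposeIdeal R A P I').map (Algebra.TensorProduct.map π (AlgHom.id R A')) := by
  set f := Algebra.TensorProduct.map π (AlgHom.id R A')
  have h1 (a : A) : (1 : P') ⊗ₜ[R] algebraMap A A' a -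
      algebraMap A' P' (algebraMap A A' a) ⊗ₜ[R] (1 : A') ∈ (transposeIdeal R A P I').map f := by
    convert! Ideal.mem_map_of_mem f (one_tmul_sub_mem_transposeIdeal (R := R) (P := P) I' a)
    simp [f, hπ]
  have h2 (i : A') (hi : i ∈ I') : (1 : P') ⊗ₜ[R] i ∈ (transposeIdeal R A P I').map f := by
    have : (1 : P) ⊗ₜ[R] i ∈ transposeIdeal R A P I' :=
      Ideal.mem_sup_left (Ideal.mem_map_of_mem _ hi)
    convert! Ideal.mem_map_of_mem f this
    simp [f]
  have h3 (i : A') (hi : i ∈ I') :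
      algebraMap A' P' i ⊗ₜ[R] (1 : A') ∈ (transposeIdeal R A P I').map f := by
    have hle : I' ≤ ((transposeIdeal R A P I').map f).comap
        ((algebraMap P' (P' ⊗[R] A')).comp (algebraMap A' P')) := by
      refine hI.ge.trans (Ideal.map_le_iff_le_comap.2 fun a ha ↦ ?_)
      have ha' : algebraMap A A' a ∈ I' := hI ▸ Ideal.mem_map_of_mem _ ha
      convert! Ideal.mem_map_of_mem f (tmul_one_mem_transposeIdeal (R := R) (P := P) ha')
      simp [f, hπ]
    exact hle hi
  rw [graphIdeal_eq_span, Ideal.span_le]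
  rintro _ ⟨a', rfl⟩
  obtain ⟨a, ha⟩ := hsurj a'
  have := sub_mem (add_mem (h1 a) (h2 _ ha)) (h3 _ ha)
  convert! this using 1
  simp only [IsScalarTower.coe_toAlgHom', TensorProduct.tmul_sub, map_sub, TensorProduct.sub_tmul]
  abel

end Diagonal

/-! ### Surjectivity after base change, and adjoining the variable θ -/

section BaseChange

open Polynomial

/-- A point of `Spec S` lies in the image of `Spec (S ⊗ A)` if its image in `Spec R` lies in the image
of `Spec A`. -/
lemma exists_comap_algebraMap_tensorProduct_eq {R S A : Type*} [CommRing R] [CommRing S] [CommRing A]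
    [Algebra R S] [Algebra R A] (p : PrimeSpectrum S) (y : PrimeSpectrum A)
    (hy : PrimeSpectrum.comap (algebraMap R A) y = PrimeSpectrum.comap (algebraMap R S) p) :
    ∃ z : PrimeSpectrum (S ⊗[R] A), PrimeSpectrum.comap (algebraMap S (S ⊗[R] A)) z = p := by
  let p₀ : PrimeSpectrum R := PrimeSpectrum.comap (algebraMap R S) p
  have h1 : Nontrivial (p₀.asIdeal.Fiber A) := by
    have : Nonempty (PrimeSpectrum (p₀.asIdeal.Fiber A)) :=
      ⟨PrimeSpectrum.preimageEquivFiber R A p₀ ⟨y, hy⟩⟩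
    exact PrimeSpectrum.nonempty_iff_nontrivial.1 this
  let κ₀ := p₀.asIdeal.ResidueField
  let κ := p.asIdeal.ResidueField
  -- The fibre of S ⊗ A over p is a field extension of the fibre of A over the image of p, and hence
  -- is nonzero.
  let f : κ₀ →ₐ[R] κ := Ideal.ResidueField.mapₐ p₀.asIdeal p.asIdeal (Algebra.ofId R S) rfl
  let : Algebra κ₀ κ := f.toRingHom.toAlgebra
  have : IsScalarTower R κ₀ κ := .of_algebraMap_eq' f.comp_algebraMap.symm
  have h2 : Nontrivial (κ ⊗[κ₀] (κ₀ ⊗[R] A)) := inferInstance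
  have h3 : Nontrivial (κ ⊗[R] A) :=
    (TensorProduct.AlgebraTensorModule.cancelBaseChange R κ₀ κ₀ κ A).symm.toEquiv.nontrivial
  have h4 : Nontrivial (κ ⊗[S] (S ⊗[R] A)) :=
    (TensorProduct.AlgebraTensorModule.cancelBaseChange R S S κ A).toEquiv.nontrivial
  obtain ⟨z⟩ := PrimeSpectrum.nonempty_iff_nontrivial.2 h4
  exact ⟨_, ((PrimeSpectrum.preimageEquivFiber S (S ⊗[R] A) p).symm z).2⟩

/-- Let `A` be flat over `R` with a prime over `b`. If all primes of `S` lie over generizations of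
`b`, then `Spec (S ⊗ A)` surjects onto `Spec S`. -/
lemma comap_algebraMap_tensorProduct_surjective {R S A : Type*} [CommRing R] [CommRing S]
    [CommRing A] [Algebra R S] [Algebra R A] [Module.Flat R A] (x : PrimeSpectrum A)
    (hS : ∀ r ∉ (PrimeSpectrum.comap (algebraMap R A) x).asIdeal, IsUnit (algebraMap R S r)) :
    Function.Surjective (PrimeSpectrum.comap (algebraMap S (S ⊗[R] A))) := by
  intro p
  have hle : p.asIdeal.comap (algebraMap R S) ≤ x.asIdeal.comap (algebraMap R A) := by
    intro r hr
    by_contra h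
    exact p.isPrime.ne_top (Ideal.eq_top_of_isUnit_mem _ hr (hS r h))
  have : x.asIdeal.LiesOver (x.asIdeal.comap (algebraMap R A)) := ⟨rfl⟩
  -- Going down for the flat algebra A.
  obtain ⟨y, -, hy, hlo⟩ := Ideal.exists_ideal_le_liesOver_of_le (S := A)
    (p := p.asIdeal.comap (algebraMap R S)) x.asIdeal hle
  exact exists_comap_algebraMap_tensorProduct_eq p ⟨y, hy⟩ (PrimeSpectrum.ext hlo.over.symm)

attribute [local instance] Polynomial.algebra

variable {P Q : Type u} [CommRing P] [CommRing Q] [Algebra P Q]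

lemma Polynomial.smooth_of_smooth [Algebra.Smooth P Q] : Algebra.Smooth P[X] Q[X] :=
  .of_equiv (Algebra.IsPushout.equiv P P[X] Q Q[X])

lemma Polynomial.invertible_kaehlerDifferential [Module.Invertible Q Ω[Q⁄P]] :
    Module.Invertible Q[X] Ω[Q[X]⁄P[X]] :=
  .kaehlerDifferential_of_isPushout P P[X] Q Q[X]

lemma Polynomial.comap_algebraMap_surjective
    (hsurj : Function.Surjective (PrimeSpectrum.comap (algebraMap P Q))) :
    Function.Surjective (PrimeSpectrum.comap (algebraMap P[X] Q[X])) := by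
  intro p
  obtain ⟨y, hy⟩ := hsurj (PrimeSpectrum.comap (algebraMap P P[X]) p)
  obtain ⟨z, hz⟩ := exists_comap_algebraMap_tensorProduct_eq p y hy
  let e := Algebra.IsPushout.equiv P P[X] Q Q[X]
  refine ⟨PrimeSpectrum.comap e.symm.toAlgHom.toRingHom z, ?_⟩
  rw [← hz, ← PrimeSpectrum.comap_comp_apply]
  congr 1
  exact e.symm.toAlgHom.comp_algebraMap

lemma Polynomial.isIntegral_pairHom_C {h : Q}
    (hh : (aeval h : P[X] →ₐ[P] Q).toRingHom.IsIntegral) :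
    (pairHom (mapRingHom (algebraMap P Q)) (C h)).IsIntegral := by
  have hc : (pairHom (mapRingHom (algebraMap P Q)) (C h)).comp (mapRingHom C) =
      (C : Q →+* Q[X]).comp (aeval h : P[X] →ₐ[P] Q).toRingHom := by
    ext x
    · simp [pairHom]
    · simp [pairHom]
  intro x
  induction x using Polynomial.induction_on' with
  | add x y hx hy => exact hx.add _ hy
  | monomial n q =>
    rw [← C_mul_X_pow_eq_monomial]
    refine RingHom.IsIntegralElem.mul _ ?_ ?_
    · obtain ⟨p, hp, hpq⟩ := hh q
      refine ⟨p.map (mapRingHom C), hp.map _, ?_⟩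
      rw [eval₂_map, hc, ← hom_eval₂, hpq, map_zero]
    · have : (X ^ n : Q[X]) = pairHom (mapRingHom (algebraMap P Q)) (C h) (C (X ^ n)) := by
        simp only [pairHom, coe_eval₂RingHom, eval₂_C, coe_mapRingHom, Polynomial.map_pow, map_X]
      rw [this]
      exact RingHom.isIntegralElem_map _

end BaseChange

/-! ### Generating the pull-back of the differentials -/

section Generator

/-- If `du` generates the differentials near the images of all closed points of `Spec L`, then it
generates the pull-back of the differentials to `Spec L`. -/
lemma KaehlerDifferential.exists_eq_tmul_D {R A L : Type*} [CommRing R] [CommRing A] [CommRing L]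
    [Algebra R A] [Algebra A L] {u : A}
    (hu : ∀ M : Ideal L, M.IsMaximal → ∃ s : A, algebraMap A L s ∉ M ∧
      ∀ x : Ω[A⁄R], s • x ∈ Submodule.span A {KaehlerDifferential.D R A u})
    (x : L ⊗[A] Ω[A⁄R]) : ∃ l : L, x = l ⊗ₜ KaehlerDifferential.D R A u := by
  let N : Submodule L (L ⊗[A] Ω[A⁄R]) := Submodule.span L {1 ⊗ₜ KaehlerDifferential.D R A u}
  have hN : N.colon Set.univ = ⊤ := by
    by_contra h
    obtain ⟨M, hM, hle⟩ := Ideal.exists_le_maximal _ h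
    obtain ⟨s, hs, hs'⟩ := hu M hM
    refine hs (hle (Submodule.mem_colon.2 fun y _ ↦ ?_))
    induction y with
    | zero => simp
    | add y z hy hz => rw [smul_add]; exact add_mem (hy trivial) (hz trivial)
    | tmul l y =>
      obtain ⟨a, ha⟩ := Submodule.mem_span_singleton.1 (hs' y)
      rw [algebraMap_smul, ← TensorProduct.tmul_smul, ← ha, TensorProduct.tmul_smul,
        TensorProduct.smul_tmul']
      refine Submodule.mem_span_singleton.2 ⟨a • l, ?_⟩
      rw [TensorProduct.smul_tmul', smul_eq_mul, mul_one]
  have h1 : (1 : L) ∈ N.colon Set.univ := hN ▸ Submodule.mem_top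
  have := Submodule.mem_colon.1 h1 x trivial
  rw [one_smul] at this
  obtain ⟨l, hl⟩ := Submodule.mem_span_singleton.1 this
  exact ⟨l, by rw [← hl, TensorProduct.smul_tmul', smul_eq_mul, mul_one]⟩

lemma KaehlerDifferential.smul_mem_span_of_formallyEtale {R A A' : Type*} [CommRing R] [CommRing A]
    [CommRing A'] [Algebra R A] [Algebra R A'] [Algebra A A'] [IsScalarTower R A A']
    [Algebra.FormallyEtale A A'] {u s : A}
    (hs : ∀ x : Ω[A⁄R], s • x ∈ Submodule.span A {KaehlerDifferential.D R A u}) (x : Ω[A'⁄R]) :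
    algebraMap A A' s • x ∈ Submodule.span A' {KaehlerDifferential.D R A' (algebraMap A A' u)} := by
  obtain ⟨y, rfl⟩ := (KaehlerDifferential.tensorKaehlerEquivOfFormallyEtale R A A').surjective x
  induction y with
  | zero => simp
  | add y z hy hz => rw [map_add, smul_add]; exact add_mem hy hz
  | tmul l y =>
    obtain ⟨a, ha⟩ := Submodule.mem_span_singleton.1 (hs y)
    rw [← map_smul, algebraMap_smul, ← TensorProduct.tmul_smul, ← ha, TensorProduct.tmul_smul,
      TensorProduct.smul_tmul']
    refine Submodule.mem_span_singleton.2 ⟨a • l, ?_⟩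
    simp

end Generator

/-! ### Lifting units along S' -/

section UnitLift

variable {R A A' : Type u} [CommRing R] [CommRing A] [CommRing A']
  [Algebra R A] [Algebra R A'] [Algebra A A'] [IsScalarTower R A A']
  {V : TopologicalSpace.Opens (PrimeSpectrum A)} {x' : PrimeSpectrum A'}

lemma semiLocMap_algebraMap (T' : Set (PrimeSpectrum A')) (a : A) :
    semiLocMap R T' (algebraMap A (SemiLoc (PrimeSpectrum.comap (algebraMap A A') '' T')) a) = algebraMap A' (SemiLoc T') (algebraMap A A' a) :=
  IsLocalization.lift_eq _ _

/-- Units of `k[W']` lift to units of `k[W]` modulo the ideal of `S'`. -/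
lemma exists_isUnit_sub_semiLocMap_mem (hsq : IsElementaryDistinguished A' V)
    {w : ringW' R V x'} (hw : IsUnit w) : ∃ w₀ : ringW R V x', IsUnit w₀ ∧
      w - semiLocMap R (fibrePoints R V x') w₀ ∈
        (idealS' A' V).map (algebraMap A' (ringW' R V x')) := by
  obtain ⟨a', s', rfl⟩ := IsLocalization.exists_mk'_eq (nonvanishingAt (fibrePoints R V x')) w
  obtain ⟨a, ha⟩ := hsq.exists_sub_mem a'
  obtain ⟨s, hs⟩ := hsq.exists_sub_mem s'
  -- At the points of S' the functions c' and c take the same values, so c vanishes at none of the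
  -- points s_i.
  have hmem {c' : A'} {c : A} (hc : c' - algebraMap A A' c ∈ idealS' A' V)
      (hc' : IsUnit (algebraMap A' (ringW' R V x') c')) :
      IsUnit (algebraMap A (ringW R V x') c) := by
    refine isUnit_algebraMap_semiLoc ?_
    rintro _ ⟨p, hp, rfl⟩ h
    refine notMem_of_isUnit_algebraMap_semiLoc hc' hp ?_
    have := add_mem (mem_closedS'_iff.1 hp.1 hc) h
    simpa using this
  have hus' : IsUnit (algebraMap A' (ringW' R V x') s') := IsLocalization.map_units _ s'
  have hspec := IsLocalization.mk'_spec (ringW' R V x') a' s'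
  have hua' : IsUnit (algebraMap A' (ringW' R V x') a') := hspec ▸ hw.mul hus'
  obtain ⟨σ, hσ⟩ := hmem hs hus'
  have hua := hmem ha hua'
  refine ⟨algebraMap A _ a * ↑σ⁻¹, hua.mul (Units.isUnit _), ?_⟩
  set w := IsLocalization.mk' (ringW' R V x') a' s'
  set f : ringW R V x' →ₐ[R] ringW' R V x' := semiLocMap R (fibrePoints R V x')
  have hσ' : f (σ : ringW R V x') * f ((σ⁻¹ : (ringW R V x')ˣ) : ringW R V x') = 1 := by
    rw [← map_mul, Units.mul_inv, map_one]
  have h1 := Ideal.mem_map_of_mem (algebraMap A' (ringW' R V x')) ha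
  have h2 := Ideal.mem_map_of_mem (algebraMap A' (ringW' R V x')) hs
  rw [map_sub, ← semiLocMap_algebraMap (R := R) (fibrePoints R V x')] at h1 h2
  rw [← hσ] at h2
  rw [map_mul]
  convert! Ideal.mul_mem_right (f ((σ⁻¹ : (ringW R V x')ˣ) : ringW R V x')) _
    (sub_mem h1 (Ideal.mul_mem_left _ w h2)) using 1
  linear_combination (-w) * hσ' + f ((σ⁻¹ : (ringW R V x')ˣ) : ringW R V x') * hspec

end UnitLift

/-! ### Local equations over W × S' and over W' × S' -/

section Deformation

lemma Ideal.sup_sq_le {Q : Type*} [CommRing Q] (J S : Ideal Q) : (J ⊔ S) ^ 2 ≤ J ^ 2 ⊔ S := by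
  rw [pow_two, Ideal.sup_mul, Ideal.mul_sup, ← pow_two]
  refine sup_le (sup_le le_sup_left (le_sup_of_le_right ?_)) (le_sup_of_le_right ?_)
  · exact Ideal.mul_le_right
  · exact Ideal.mul_le_left

variable {R A A' P P' : Type u} [CommRing R] [CommRing A] [CommRing A'] [CommRing P] [CommRing P']
  [Algebra R A] [Algebra R A'] [Algebra A A'] [IsScalarTower R A A']
  [Algebra R P] [Algebra A P] [IsScalarTower R A P]
  [Algebra R P'] [Algebra A' P'] [IsScalarTower R A' P']

/-- A local equation, modulo `S'`, of the transposed graph of `S' ⟶ X`, with no other zeros over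
`S'`. -/
lemma exists_forall_transposeIdeal_le [IsNoetherianRing (P ⊗[R] A')] {I' : Ideal A'}
    (hfin : ((Ideal.Quotient.mk I').comp (algebraMap R A')).Finite)
    (hP : {M : PrimeSpectrum P | M.asIdeal.IsMaximal}.Finite) {u : A}
    (hu : ∀ x : P ⊗[A] Ω[A⁄R], ∃ l : P, x = l ⊗ₜ KaehlerDifferential.D R A u)
    {w₀ : P} (hw₀ : IsUnit w₀) :
    ∃ ε ∈ transposeIdeal R A P I' ^ 2, ∀ F : P ⊗[R] A',
      F - (w₀ ⊗ₜ[R] (1 : A') * ((1 : P) ⊗ₜ[R] algebraMap A A' u - algebraMap A P u ⊗ₜ[R] (1 : A')) +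
        ε) ∈ vertIdeal R P I' →
      ∀ z : Ideal (P ⊗[R] A'), z.IsPrime → vertIdeal R P I' ≤ z → F ∈ z →
        transposeIdeal R A P I' ≤ z := by
  set K := transposeIdeal R A P I'
  set δ := (1 : P) ⊗ₜ[R] algebraMap A A' u - algebraMap A P u ⊗ₜ[R] (1 : A')
  -- The points to avoid are the closed points of W × S' off the transposed graph.
  obtain ⟨ε, hε, hε'⟩ := exists_mem_sq_forall_add_notMem K
    (T := {M | (M.asIdeal.IsMaximal ∧ vertIdeal R P I' ≤ M.asIdeal) ∧ ¬ K ≤ M.asIdeal})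
    ((finite_setOf_isMaximal_vertIdeal_le hfin hP).subset fun M hM ↦ hM.1)
    (fun M hM ↦ hM.1.1) (fun M hM ↦ hM.2) (w₀ ⊗ₜ[R] (1 : A') * δ)
  refine ⟨ε, hε, fun F hF z hz hSz hFz ↦ ?_⟩
  refine le_of_mem_of_le_span_sup_sq (IsNoetherian.noetherian K) (F := F)
    (S := vertIdeal R P I') ?_ ?_ hSz hFz
  · have h1 : K ≤ Ideal.span {δ} ⊔ K ^ 2 ⊔ vertIdeal R P I' := transposeIdeal_le hu
    refine h1.trans (sup_le (sup_le ?_ (le_sup_right.trans le_sup_left)) le_sup_right)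
    rw [Ideal.span_singleton_le_iff_mem]
    obtain ⟨v, rfl⟩ := hw₀
    -- F agrees with w₀δ modulo K² and S', and w₀ is a unit, so F may replace δ as a generator.
    have h2 : δ = ((v⁻¹ : Pˣ) : P) ⊗ₜ[R] (1 : A') * (F - ε -
        (F - ((v : P) ⊗ₜ[R] (1 : A') * δ + ε))) := by
      have : F - ε - (F - ((v : P) ⊗ₜ[R] (1 : A') * δ + ε)) = (v : P) ⊗ₜ[R] (1 : A') * δ := by ring
      rw [this, ← mul_assoc, Algebra.TensorProduct.tmul_mul_tmul, Units.inv_mul, one_mul]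
      exact (one_mul δ).symm
    rw [h2]
    refine Ideal.mul_mem_left _ _ (sub_mem (Ideal.mem_sup_left (sub_mem
      (Ideal.mem_sup_left (Ideal.mem_span_singleton_self F)) (Ideal.mem_sup_right hε)))
      (Ideal.mem_sup_right hF))
  · intro M hM hSM hFM
    by_contra hKM
    refine hε' ⟨M, hM.isPrime⟩ ⟨⟨hM, hSM⟩, hKM⟩ ?_
    simpa using sub_mem hFM (hSM hF)

variable (π : P →ₐ[R] P')
  (hπ : ∀ a, π (algebraMap A P a) = algebraMap A' P' (algebraMap A A' a))

omit [Algebra R A] [IsScalarTower R A A'] [IsScalarTower R A P] in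
include hπ in
-- The transposed graph ideal pulls back into J + S, and (J + S)² ⊆ J² + S, so ε becomes an element
-- of J² modulo S. The difference of w and π(w₀) lies in J + S as well, and its product with δ' ∈ J
-- is absorbed in the same way.
lemma exists_mem_sq_sub_mem_vertIdeal {I' : Ideal A'} {u : A} {w₀ : P} {w : P'}
    (hw : w - π w₀ ∈ I'.map (algebraMap A' P')) {ε : P ⊗[R] A'}
    (hε : ε ∈ transposeIdeal R A P I' ^ 2) :
    ∃ ε₀ ∈ graphIdeal (IsScalarTower.toAlgHom R A' P') ^ 2,
      Algebra.TensorProduct.map π (AlgHom.id R A') (w₀ ⊗ₜ[R] (1 : A') *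
        ((1 : P) ⊗ₜ[R] algebraMap A A' u - algebraMap A P u ⊗ₜ[R] (1 : A')) + ε) -
      (w ⊗ₜ[R] (1 : A') * ((1 : P') ⊗ₜ[R] algebraMap A A' u -
        algebraMap A' P' (algebraMap A A' u) ⊗ₜ[R] (1 : A')) + ε₀) ∈ vertIdeal R P' I' := by
  set f := Algebra.TensorProduct.map π (AlgHom.id R A')
  set J := graphIdeal (IsScalarTower.toAlgHom R A' P')
  set S := vertIdeal R P' I'
  set δ := (1 : P) ⊗ₜ[R] algebraMap A A' u - algebraMap A P u ⊗ₜ[R] (1 : A')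
  set δ' := (1 : P') ⊗ₜ[R] algebraMap A A' u - algebraMap A' P' (algebraMap A A' u) ⊗ₜ[R] (1 : A')
  have hδ' : δ' ∈ J := one_tmul_sub_mem_graphIdeal (IsScalarTower.toAlgHom R A' P') _
  have hfδ : f δ = δ' := by simp [f, δ, δ', hπ]
  have h1 : f ε ∈ J ^ 2 ⊔ S := by
    have h2 := Ideal.mem_map_of_mem f hε
    rw [Ideal.map_pow] at h2
    have h3 := Ideal.pow_right_mono (map_transposeIdeal_le π hπ I') 2 h2
    exact Ideal.sup_sq_le J S h3
  have h4 : (π w₀ - w) ⊗ₜ[R] (1 : A') * δ' ∈ J ^ 2 ⊔ S := by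
    have hle : I'.map (algebraMap A' P') ≤ (J ⊔ S).comap (algebraMap P' (P' ⊗[R] A')) := by
      refine Ideal.map_le_iff_le_comap.2 fun i hi ↦ ?_
      have h5 : (1 : P') ⊗ₜ[R] i ∈ S :=
        Ideal.mem_map_of_mem (Algebra.TensorProduct.includeRight : A' →ₐ[R] P' ⊗[R] A') hi
      have h6 := one_tmul_sub_mem_graphIdeal (IsScalarTower.toAlgHom R A' P') i
      have := sub_mem (Ideal.mem_sup_right (S := J) h5) (Ideal.mem_sup_left (T := S) h6)
      rw [sub_sub_cancel] at this
      exact this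
    have h7 : (π w₀ - w) ⊗ₜ[R] (1 : A') ∈ J ⊔ S := by
      have := neg_mem hw
      rw [neg_sub] at this
      exact hle this
    exact Ideal.sup_sq_le J S (pow_two (J ⊔ S) ▸ Ideal.mul_mem_mul h7 (Ideal.mem_sup_left hδ'))
  obtain ⟨ε₀, hε₀, s, hs, h⟩ := Submodule.mem_sup.1 (add_mem h4 h1)
  refine ⟨ε₀, hε₀, ?_⟩
  have hf : f (w₀ ⊗ₜ[R] (1 : A') * δ + ε) = π w₀ ⊗ₜ[R] (1 : A') * δ' + f ε := by
    rw [map_add, map_mul, hfδ]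
    simp [f]
  rw [TensorProduct.sub_tmul, sub_mul] at h
  rw [hf]
  convert! hs using 1
  linear_combination -h

omit [Algebra R A] [IsScalarTower R A A'] [IsScalarTower R A P] in
include hπ in
/-- Zeros over `S'` of functions on `Spec P' × X'` that agree over `S'` with functions whose zeros
over `S'` form the transposed graph. -/
lemma graphIdeal_le_of_mem {I : Ideal A} {I' : Ideal A'}
    (hI : I.map (algebraMap A A') = I') (hsurj : ∀ a' : A', ∃ a : A, a' - algebraMap A A' a ∈ I')
    {F : P ⊗[R] A'} (hF : ∀ z : Ideal (P ⊗[R] A'), z.IsPrime → vertIdeal R P I' ≤ z → F ∈ z →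
      transposeIdeal R A P I' ≤ z) {z : Ideal (P' ⊗[R] A')} (hz : z.IsPrime)
    (hSz : vertIdeal R P' I' ≤ z) (hFz : Algebra.TensorProduct.map π (AlgHom.id R A') F ∈ z) :
    graphIdeal (IsScalarTower.toAlgHom R A' P') ≤ z := by
  refine (graphIdeal_le_map_transposeIdeal π hπ hI hsurj).trans (Ideal.map_le_iff_le_comap.2
    (hF _ (hz.comap _) ?_ hFz))
  refine Ideal.map_le_iff_le_comap.2 fun i hi ↦ ?_
  rw [Ideal.mem_comap, Ideal.mem_comap]
  convert! hSz (Ideal.mem_map_of_mem (Algebra.TensorProduct.includeRight : A' →ₐ[R] P' ⊗[R] A') hi)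
  simp

end Deformation

/-! ### Splitting the diagonal off a zero locus -/

section Diagonal

/-- If `h` generates the ideal `J` modulo `J²`, then `J` is a component of the zero locus of `h`. -/
lemma Ideal.exists_span_singleton_eq_inf {Q : Type*} [CommRing Q] {J : Ideal Q} (hJ : J.FG) {h : Q}
    (hh : h ∈ J) (hle : J ≤ Ideal.span {h} ⊔ J ^ 2) :
    ∃ G : Ideal Q, Ideal.span {h} = J ⊓ G ∧ J ⊔ G = ⊤ ∧ h ∈ G := by
  have hle' : J ≤ Ideal.span {h} ⊔ J • J := by rwa [smul_eq_mul, ← pow_two]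
  obtain ⟨r, hr, hr'⟩ := Submodule.exists_sub_one_mem_and_smul_le_of_fg_of_le_sup hJ le_rfl hle'
  -- The residual part is the colon ideal; Nakayama provides r ≡ 1 modulo J in it, so it is
  -- comaximal with J.
  let G : Ideal Q := (Ideal.span {h}).colon J
  have hG {x : Q} : x ∈ G ↔ ∀ j ∈ J, x * j ∈ Ideal.span {h} := by
    simp [G, Submodule.mem_colon]
  have hrG : r ∈ G := hG.2 fun j hj ↦ hr' (Submodule.smul_mem_pointwise_smul j r J hj)
  have hhG : h ∈ G := hG.2 fun j _ ↦ Ideal.mul_mem_right _ _ (Ideal.mem_span_singleton_self h)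
  refine ⟨G, le_antisymm ?_ ?_, ?_, hhG⟩
  · rw [Ideal.span_singleton_le_iff_mem]
    exact ⟨hh, hhG⟩
  · rintro x ⟨hxJ, hxG⟩
    have h1 : x = r * x - x * (r - 1) := by ring
    rw [h1]
    exact sub_mem (hG.1 hrG x hxJ) (hG.1 hxG _ hr)
  · rw [Ideal.eq_top_iff_one]
    have h1 : (1 : Q) = -(r - 1) + r := by ring
    rw [h1]
    exact add_mem (Ideal.mem_sup_left (neg_mem hr)) (Ideal.mem_sup_right hrG)

variable {R P L : Type u} [CommRing R] [CommRing P] [CommRing L] [Algebra R P] [Algebra R L]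
  [Algebra P L] [IsScalarTower R P L]

lemma graphIdeal_le_span_sup_sq_of_sub_mem {u : P}
    (hu : ∀ x : L ⊗[P] Ω[P⁄R], ∃ l : L, x = l ⊗ₜ KaehlerDifferential.D R P u) {w : L}
    (hw : IsUnit w) {h : L ⊗[R] P}
    (hh : h - w ⊗ₜ[R] (1 : P) * ((1 : L) ⊗ₜ[R] u - algebraMap P L u ⊗ₜ[R] (1 : P)) ∈
      graphIdeal (IsScalarTower.toAlgHom R P L) ^ 2) :
    graphIdeal (IsScalarTower.toAlgHom R P L) ≤
      Ideal.span {h} ⊔ graphIdeal (IsScalarTower.toAlgHom R P L) ^ 2 := by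
  refine (graphIdeal_le_span_sup_sq hu).trans (sup_le ?_ le_sup_right)
  rw [Ideal.span_singleton_le_iff_mem]
  obtain ⟨v, rfl⟩ := hw
  set δ := (1 : L) ⊗ₜ[R] u - algebraMap P L u ⊗ₜ[R] (1 : P)
  have h2 : δ = ((v⁻¹ : Lˣ) : L) ⊗ₜ[R] (1 : P) * (h - (h - (v : L) ⊗ₜ[R] (1 : P) * δ)) := by
    rw [sub_sub_cancel, ← mul_assoc, Algebra.TensorProduct.tmul_mul_tmul, Units.inv_mul, one_mul]
    exact (one_mul δ).symm
  rw [h2]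
  exact Ideal.mul_mem_left _ _ (sub_mem (Ideal.mem_sup_left (Ideal.mem_span_singleton_self h))
    (Ideal.mem_sup_right hh))

/-- Under the identification of the pulled-back differentials with J/J², the class of h is w ⊗ du.
It generates, and a surjection between invertible modules is bijective. -/
lemma bijective_smul_toCotangent [Module.Invertible L (L ⊗[P] Ω[P⁄R])] {u : P}
    (hu : ∀ x : L ⊗[P] Ω[P⁄R], ∃ l : L, x = l ⊗ₜ KaehlerDifferential.D R P u) {w : L}
    (hw : IsUnit w) {h : L ⊗[R] P} (hJ : h ∈ graphIdeal (IsScalarTower.toAlgHom R P L))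
    (hh : h - w ⊗ₜ[R] (1 : P) * ((1 : L) ⊗ₜ[R] u - algebraMap P L u ⊗ₜ[R] (1 : P)) ∈
      graphIdeal (IsScalarTower.toAlgHom R P L) ^ 2) :
    Function.Bijective fun l : L ↦
      l • (graphIdeal (IsScalarTower.toAlgHom R P L)).toCotangent ⟨h, hJ⟩ := by
  let e := tensorKaehlerEquivCotangent R P L
  have h1 : e (w ⊗ₜ KaehlerDifferential.D R P u) =
      (graphIdeal (IsScalarTower.toAlgHom R P L)).toCotangent ⟨h, hJ⟩ := by
    have h2 : e (w ⊗ₜ KaehlerDifferential.D R P u) = _ := tensorKaehlerToCotangent_tmul_D w u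
    rw [h2, ← LinearMap.map_smul_of_tower, eq_comm, Ideal.toCotangent_eq]
    convert! hh using 2
    exact Algebra.smul_def _ _
  have h3 : Function.Bijective (LinearMap.toSpanSingleton L (L ⊗[P] Ω[P⁄R])
      (w ⊗ₜ KaehlerDifferential.D R P u)) := by
    refine Module.Invertible.bijective_of_surjective fun x ↦ ?_
    obtain ⟨l, rfl⟩ := hu x
    obtain ⟨v, rfl⟩ := hw
    refine ⟨l * ((v⁻¹ : Lˣ) : L), ?_⟩
    rw [LinearMap.toSpanSingleton_apply, TensorProduct.smul_tmul', smul_eq_mul, mul_assoc,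
      Units.inv_mul, mul_one]
  have : (fun l : L ↦ l • (graphIdeal (IsScalarTower.toAlgHom R P L)).toCotangent ⟨h, hJ⟩) =
      e ∘ LinearMap.toSpanSingleton L (L ⊗[P] Ω[P⁄R]) (w ⊗ₜ KaehlerDifferential.D R P u) := by
    ext l
    simp [← h1]
  rw [this]
  exact e.bijective.comp h3

end Diagonal

/-! ### Finite maps given by polynomials in Φ -/

section FiniteFamilies

open Polynomial

variable {P Q : Type u} [CommRing P] [CommRing Q] [Algebra P Q] [IsNoetherianRing P]
  [Algebra.Smooth P Q] [Module.Invertible Q Ω[Q⁄P]]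
  (hsurj : Function.Surjective (PrimeSpectrum.comap (algebraMap P Q))) {Φ : Q}
  (hΦ : (aeval Φ : P[X] →ₐ[P] Q).toRingHom.IsIntegral)

include hsurj hΦ in
lemma exists_forall_isFiniteSurjective_pairHom (y : Q) :
    ∃ E : ℕ, ∀ p : P[X], p.Monic → E ≤ p.natDegree →
      IsFiniteSurjective (pairHom (algebraMap P Q) (y + eval₂ (algebraMap P Q) Φ p)) ∧
      IsFiniteFlatSurjective (zeroLocusHom (algebraMap P Q) (y + eval₂ (algebraMap P Q) Φ p)) := by
  obtain ⟨E, hE⟩ := exists_forall_isIntegral_aeval_add hΦ y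
  refine ⟨E, fun p hp hEp ↦ ?_⟩
  have hfin : (aeval (y + aeval Φ p) : P[X] →ₐ[P] Q).toRingHom.Finite := by
    refine (hE p hp hEp).to_finite (RingHom.FiniteType.of_comp_finiteType (f := C) ?_)
    have : (aeval (y + aeval Φ p) : P[X] →ₐ[P] Q).toRingHom.comp C = algebraMap P Q := by
      ext; simp
    rw [this, RingHom.finiteType_algebraMap]
    infer_instance
  exact ⟨isFiniteSurjective_pairHom hsurj hfin, isFiniteFlatSurjective_zeroLocusHom hsurj hfin⟩

include hsurj hΦ in
-- The same statement over the base `P[X]`, so that the coefficients of p may depend on θ.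
lemma Polynomial.exists_forall_isFiniteSurjective_pairHom (y : Q[X]) :
    ∃ E : ℕ, ∀ p : P[X][X], p.Monic → E ≤ p.natDegree →
      IsFiniteSurjective (pairHom (mapRingHom (algebraMap P Q))
        (y + eval₂ (mapRingHom (algebraMap P Q)) (C Φ) p)) ∧
      IsFiniteFlatSurjective (zeroLocusHom (mapRingHom (algebraMap P Q))
        (y + eval₂ (mapRingHom (algebraMap P Q)) (C Φ) p)) := by
  let := Polynomial.algebra P Q
  have := Polynomial.smooth_of_smooth (P := P) (Q := Q)
  have := Polynomial.invertible_kaehlerDifferential (P := P) (Q := Q)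
  exact _root_.exists_forall_isFiniteSurjective_pairHom
    (Polynomial.comap_algebraMap_surjective hsurj) (Polynomial.isIntegral_pairHom_C hΦ) y

end FiniteFamilies

/-! ### Construction of F and h_θ -/

section GoodPairs

open Polynomial

variable {R A A' : Type u} [CommRing R] [CommRing A] [CommRing A']
  [Algebra R A] [Algebra R A'] [Algebra A A'] [IsScalarTower R A A']
  {V : TopologicalSpace.Opens (PrimeSpectrum A)} {x' : PrimeSpectrum A'}

/-- One u chosen on X serves for both semi-localizations: étaleness carries a local generator du on
X to one on X'. -/
lemma KaehlerDifferential.exists_generator_semiLoc [Module.Invertible A Ω[A⁄R]]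
    [Algebra.FormallyEtale A A'] {T' : Set (PrimeSpectrum A')} (hT' : T'.Finite)
    (hmax : ∀ t ∈ PrimeSpectrum.comap (algebraMap A A') '' T', t.asIdeal.IsMaximal) :
    ∃ u : A, (∀ x : SemiLoc (PrimeSpectrum.comap (algebraMap A A') '' T') ⊗[A] Ω[A⁄R],
      ∃ l, x = l ⊗ₜ KaehlerDifferential.D R A u) ∧
      ∀ x : SemiLoc T' ⊗[A'] Ω[A'⁄R],
        ∃ l, x = l ⊗ₜ KaehlerDifferential.D R A' (algebraMap A A' u) := by
  have hT := hT'.image (PrimeSpectrum.comap (algebraMap A A'))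
  obtain ⟨u, hu⟩ := KaehlerDifferential.exists_forall_D_notMem_smul_top R hT hmax
  have key (t) (ht : t ∈ PrimeSpectrum.comap (algebraMap A A') '' T') :=
    have := hmax t ht
    Module.Invertible.exists_notMem_forall_smul_mem_span t.asIdeal (hu t ht)
  refine ⟨u, KaehlerDifferential.exists_eq_tmul_D fun M hM ↦ ?_,
    KaehlerDifferential.exists_eq_tmul_D fun M hM ↦ ?_⟩
  · obtain ⟨t, ht, hle⟩ := exists_comap_le_of_semiLoc hT M
    obtain ⟨s, hs, hs'⟩ := key t ht
    exact ⟨s, fun h ↦ hs (hle h), hs'⟩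
  · obtain ⟨t, ht, hle⟩ := exists_comap_le_of_semiLoc hT' M
    obtain ⟨s, hs, hs'⟩ := key _ ⟨t, ht, rfl⟩
    exact ⟨algebraMap A A' s, fun h ↦ hs (hle h),
      KaehlerDifferential.smul_mem_span_of_formallyEtale hs'⟩

/-- With a = φ and b = θ, the quadratic factor is (X − φ)² at θ = 0, vanishing doubly on the
diagonal, and X² at θ = 1, not involving φ. It remains monic for every θ. -/
lemma monic_interpolation {S : Type*} [CommRing S] [Nontrivial S] (p : S[X]) (hp : p.Monic) (c : ℕ)
    (a b : S) :
    (p * X ^ c * (C (1 - b) * (X - C a) ^ 2 + C b * X ^ 2)).Monic ∧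
      c ≤ (p * X ^ c * (C (1 - b) * (X - C a) ^ 2 + C b * X ^ 2)).natDegree := by
  have h1 : C (1 - b) * (X - C a) ^ 2 + C b * X ^ 2 =
      X ^ 2 + (C (-2 * (1 - b) * a) * X + C ((1 - b) * a ^ 2)) := by
    simp only [map_mul, map_sub, map_one, map_neg, map_pow, map_ofNat]
    ring
  have h2 : (C (1 - b) * (X - C a) ^ 2 + C b * X ^ 2).Monic := by
    rw [h1]
    exact monic_X_pow_add (degree_linear_lt.trans_le (by norm_num))
  have h3 := hp.mul (monic_X_pow (R := S) c)
  refine ⟨h3.mul h2, ?_⟩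
  rw [h3.natDegree_mul h2, hp.natDegree_mul (monic_X_pow c), natDegree_X_pow]
  omega

lemma eval₂_interpolation {S T : Type*} [CommRing S] [CommRing T] (f : S →+* T) (x : T) (p : S[X])
    (c : ℕ) (a b : S) :
    eval₂ f x (p * X ^ c * (C (1 - b) * (X - C a) ^ 2 + C b * X ^ 2)) =
      eval₂ f x p * x ^ c * ((1 - f b) * (x - f a) ^ 2 + f b * x ^ 2) := by
  simp [eval₂_pow]

/-- The main construction: the class of `h_0` in `J/J²` can be prescribed up to a common
generator. -/
theorem exists_isGoodPair [IsNoetherianRing A] [Algebra.Smooth R A] [Module.Invertible A Ω[A⁄R]]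
    (hsq : IsElementaryDistinguished A' V) (hx'max : x'.asIdeal.IsMaximal)
    (hx'S : x' ∈ closedS' A' V)
    (hS' : ((Ideal.Quotient.mk (idealS' A' V)).comp (algebraMap R A')).Finite) {Φ : A'}
    (hΦ : (aeval ((1 : ringW R V x') ⊗ₜ[R] Φ) :
      (ringW R V x')[X] →ₐ[ringW R V x'] ringW R V x' ⊗[R] A').toRingHom.IsIntegral)
    (hΦ' : (aeval ((1 : ringW' R V x') ⊗ₜ[R] Φ) :
      (ringW' R V x')[X] →ₐ[ringW' R V x'] ringW' R V x' ⊗[R] A').toRingHom.IsIntegral) :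
    ∃ u : A', (∀ x : ringW' R V x' ⊗[A'] Ω[A'⁄R], ∃ l, x = l ⊗ₜ KaehlerDifferential.D R A' u) ∧
      ∀ w : ringW' R V x', IsUnit w →
      ∃ (F : ringW R V x' ⊗[R] A') (h : (ringW' R V x' ⊗[R] A')[X]), IsGoodPair R V x' F h ∧
        h.eval 0 - w ⊗ₜ[R] (1 : A') * ((1 : ringW' R V x') ⊗ₜ[R] u -
          algebraMap A' (ringW' R V x') u ⊗ₜ[R] (1 : A')) ∈ idealJ R V x' ^ 2 := by
  have : Algebra.Etale A A' := hsq.1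
  have : Algebra.Smooth R A' := .comp R A A'
  have : IsNoetherianRing A' := Algebra.FiniteType.isNoetherianRing A A'
  have hmax := fun t ↦ isMaximal_of_mem_image_fibrePoints hsq hS' hx'max hx'S (t := t)
  have hT' : (fibrePoints R V x').Finite := finite_fibrePoints hS'
  have hI := hsq.map_idealS
  have hIs := hsq.exists_sub_mem
  have : Module.Invertible A' Ω[A'⁄R] :=
    .congr (KaehlerDifferential.tensorKaehlerEquivOfFormallyEtale R A A')
  obtain ⟨u, hu, hu'⟩ := KaehlerDifferential.exists_generator_semiLoc (R := R) hT' hmax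
  refine ⟨algebraMap A A' u, hu', fun w hw ↦ ?_⟩
  have hPfin := finite_setOf_isMaximal_semiLoc
    (hT'.image (PrimeSpectrum.comap (algebraMap A A')))
  have : IsNoetherianRing (ringW R V x') := IsLocalization.isNoetherianRing
    (nonvanishingAt (PrimeSpectrum.comap (algebraMap A A') '' fibrePoints R V x')) _ ‹_›
  have : IsNoetherianRing (ringW' R V x') :=
    IsLocalization.isNoetherianRing (nonvanishingAt (fibrePoints R V x')) _ ‹_›
  have : IsNoetherianRing (ringW R V x' ⊗[R] A') :=
    Algebra.FiniteType.isNoetherianRing (ringW R V x') _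
  have : IsNoetherianRing (ringW' R V x' ⊗[R] A') :=
    Algebra.FiniteType.isNoetherianRing (ringW' R V x') _
  have : Nontrivial (ringW' R V x') := by
    obtain ⟨q, -⟩ := exists_comap_semiLoc_eq (T := fibrePoints R V x') (t := x') ⟨hx'S, rfl⟩
    exact PrimeSpectrum.nonempty_iff_nontrivial.1 ⟨q⟩
  have hflat : Module.Flat R A' := Algebra.Smooth.flat R A'
  have hsurj := comap_algebraMap_tensorProduct_surjective (S := ringW R V x') x'
    fun r ↦ isUnit_algebraMap_ringW
  have hsurj' := comap_algebraMap_tensorProduct_surjective (S := ringW' R V x') x'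
    fun r ↦ isUnit_algebraMap_ringW'
  obtain ⟨w₀, hw₀, hww₀⟩ := exists_isUnit_sub_semiLocMap_mem (R := R) (x' := x') hsq hw
  obtain ⟨ε, hε, hε'⟩ := exists_forall_transposeIdeal_le (R := R) (P := ringW R V x') hS' hPfin hu hw₀
  have hπ := semiLocMap_algebraMap (R := R) (A := A) (fibrePoints R V x')
  obtain ⟨ε₀, hε₀, hε₀'⟩ := exists_mem_sq_sub_mem_vertIdeal (R := R) (P := ringW R V x')
    (P' := ringW' R V x') (semiLocMap R (fibrePoints R V x')) hπ (u := u) hww₀ hε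
  set f := pullbackToW' R V x'
  set J := idealJ R V x'
  set δ := (1 : ringW R V x') ⊗ₜ[R] algebraMap A A' u - algebraMap A (ringW R V x') u ⊗ₜ[R] (1 : A')
  set δ' := (1 : ringW' R V x') ⊗ₜ[R] algebraMap A A' u -
    algebraMap A' (ringW' R V x') (algebraMap A A' u) ⊗ₜ[R] (1 : A')
  set yF := w₀ ⊗ₜ[R] (1 : A') * δ + ε
  set y₀ := w ⊗ₜ[R] (1 : A') * δ' + ε₀
  -- As S' is finite over B, some monic polynomial in Φ over `R` vanishes on S'. Adding its
  -- multiples changes nothing over S'.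
  obtain ⟨pS, hpS, hpS0⟩ := hS'.to_isIntegral (Ideal.Quotient.mk _ Φ)
  set s := aeval Φ pS
  have hs : s ∈ idealS' A' V := by
    rw [← Ideal.Quotient.eq_zero_iff_mem, ← hpS0, ← hom_eval₂]
    rfl
  set φ := algebraMap A' (ringW' R V x') Φ
  obtain ⟨E₁, hE₁⟩ := exists_forall_isFiniteSurjective_pairHom hsurj hΦ yF
  obtain ⟨E₂, hE₂⟩ := Polynomial.exists_forall_isFiniteSurjective_pairHom hsurj' hΦ'
    ((1 - X) * C y₀ + X * C (f yF))
  let c := max E₁ E₂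
  -- The exponent c + 2 matches θ = 1 in the interpolation, where the quadratic factor contributes
  -- Φ².
  let pF : (ringW R V x')[X] := pS.map (algebraMap R _) * X ^ (c + 2)
  have hpF : pF.Monic := (hpS.map _).mul (monic_X_pow _)
  have : Nontrivial (ringW R V x') :=
    (semiLocMap (A := A) R (fibrePoints R V x')).toRingHom.domain_nontrivial
  have hF := hE₁ pF hpF (by
    rw [(hpS.map _).natDegree_mul (monic_X_pow _), natDegree_X_pow]
    omega)
  have hph := monic_interpolation (pS.map (algebraMap R (ringW' R V x')[X])) (hpS.map _) c (C φ) X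
  have hh := hE₂ _ hph.1 ((le_max_right _ _).trans hph.2)
  have hFeq : yF + eval₂ (algebraMap (ringW R V x') (ringW R V x' ⊗[R] A')) (1 ⊗ₜ Φ) pF =
      yF + (1 ⊗ₜ s) * (1 ⊗ₜ Φ) ^ (c + 2) := by
    rw [eval₂_mul, eval₂_X_pow, eval₂_map, ← IsScalarTower.algebraMap_eq, ← aeval_def]
    congr 2
    exact aeval_algHom_apply (Algebra.TensorProduct.includeRight : A' →ₐ[R] _) Φ pS
  rw [hFeq] at hF
  set F := yF + (1 ⊗ₜ s) * (1 ⊗ₜ Φ) ^ (c + 2)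
  set h₀ := y₀ + (1 ⊗ₜ s) * (1 ⊗ₜ Φ) ^ c * ((1 : ringW' R V x') ⊗ₜ[R] Φ - φ ⊗ₜ[R] (1 : A')) ^ 2
  set h : (ringW' R V x' ⊗[R] A')[X] := (1 - X) * C h₀ + X * C (f F)
  have hheq : (1 - X) * C y₀ + X * C (f yF) +
      eval₂ (mapRingHom (algebraMap (ringW' R V x') (ringW' R V x' ⊗[R] A'))) (C (1 ⊗ₜ[R] Φ))
        (pS.map (algebraMap R (ringW' R V x')[X]) * X ^ c *
          (C (1 - X) * (X - C (C φ)) ^ 2 + C X * X ^ 2)) = h := by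
    have h1 : eval₂ (mapRingHom (algebraMap (ringW' R V x') (ringW' R V x' ⊗[R] A')))
        (C ((1 : ringW' R V x') ⊗ₜ[R] Φ)) (pS.map (algebraMap R (ringW' R V x')[X])) =
        C ((1 : ringW' R V x') ⊗ₜ[R] s) := by
      have h2 : (mapRingHom (algebraMap (ringW' R V x') (ringW' R V x' ⊗[R] A'))).comp
          (algebraMap R (ringW' R V x')[X]) = (C : _ →+* (ringW' R V x' ⊗[R] A')[X]).comp
            (algebraMap R (ringW' R V x' ⊗[R] A')) := by
        ext r : 1
        simp [Polynomial.algebraMap_apply, ← IsScalarTower.algebraMap_apply]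
      rw [eval₂_map, h2, ← hom_eval₂, ← aeval_def]
      congr 1
      exact aeval_algHom_apply (Algebra.TensorProduct.includeRight : A' →ₐ[R] _) Φ pS
    have h3 : f F = f yF + (1 ⊗ₜ s) * (1 ⊗ₜ Φ) ^ (c + 2) := by
      rw [map_add, map_mul, map_pow]
      simp [f]
    refine (congrArg ((1 - X) * C y₀ + X * C (f yF) + ·)
      (eval₂_interpolation _ _ _ c (C φ) X)).trans ?_
    rw [h1]
    simp only [h, h₀, h3, coe_mapRingHom, map_X, map_C, map_add, map_mul, map_pow, map_sub,
      Algebra.TensorProduct.algebraMap_apply, Algebra.algebraMap_self, RingHom.id_apply]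
    ring
  rw [hheq] at hh
  have hev0 : h.eval 0 = h₀ := by simp [h]
  have hev1 : h.eval 1 = f F := by simp [h]
  have hh₀ : h₀ - w ⊗ₜ[R] (1 : A') * δ' ∈ J ^ 2 := by
    have h1 : ((1 : ringW' R V x') ⊗ₜ[R] Φ - φ ⊗ₜ[R] (1 : A')) ^ 2 ∈ J ^ 2 := Ideal.pow_mem_pow
      (one_tmul_sub_mem_graphIdeal (IsScalarTower.toAlgHom R A' (ringW' R V x')) Φ) 2
    convert! add_mem hε₀ (Ideal.mul_mem_left _ ((1 ⊗ₜ s) * (1 ⊗ₜ Φ) ^ c) h1) using 1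
    simp only [h₀, y₀]
    ring
  have hδ' : δ' ∈ J := one_tmul_sub_mem_graphIdeal (IsScalarTower.toAlgHom R A' (ringW' R V x')) _
  have hh₀J : h₀ ∈ J := by
    have := add_mem (Ideal.pow_le_self two_ne_zero hh₀) (Ideal.mul_mem_left J (w ⊗ₜ[R] (1 : A')) hδ')
    rwa [sub_add_cancel] at this
  have hS₀ : f F - h₀ ∈ vertIdeal R (ringW' R V x') (idealS' A' V) := by
    have h1 : (1 : ringW' R V x') ⊗ₜ[R] s ∈ vertIdeal R (ringW' R V x') (idealS' A' V) :=
      Ideal.mem_map_of_mem (Algebra.TensorProduct.includeRight : A' →ₐ[R] _) hs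
    have h2 : f F = f yF + (1 ⊗ₜ s) * (1 ⊗ₜ Φ) ^ (c + 2) := by
      rw [map_add, map_mul, map_pow]
      simp [f]
    convert! add_mem hε₀' (Ideal.mul_mem_right ((1 ⊗ₜ Φ) ^ (c + 2) -
      (1 ⊗ₜ Φ) ^ c * ((1 : ringW' R V x') ⊗ₜ[R] Φ - φ ⊗ₜ[R] (1 : A')) ^ 2) _ h1) using 1
    rw [h2]
    simp only [h₀]
    ring
  have hFz := hε' F (by
    have h1 : (1 : ringW R V x') ⊗ₜ[R] s ∈ vertIdeal R (ringW R V x') (idealS' A' V) :=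
      Ideal.mem_map_of_mem (Algebra.TensorProduct.includeRight : A' →ₐ[R] _) hs
    convert! Ideal.mul_mem_right ((1 ⊗ₜ Φ) ^ (c + 2)) _ h1 using 1
    exact add_sub_cancel_left _ _)
  have hJz := fun z hz ↦ graphIdeal_le_of_mem (R := R) (P := ringW R V x')
    (P' := ringW' R V x') (semiLocMap R (fibrePoints R V x')) hπ hI hIs hFz (z := z) hz
  refine ⟨F, h, ⟨hh.1, hh.2, ?_, hev1, ?_, hF.1, hF.2, ?_, ?_, ?_⟩, ?_⟩
  · obtain ⟨G, hG, hG', hhG⟩ := Ideal.exists_span_singleton_eq_inf (IsNoetherian.noetherian J) hh₀J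
      (graphIdeal_le_span_sup_sq_of_sub_mem hu' hw hh₀)
    refine ⟨G, by rw [hev0]; exact hG, hG', fun z hGz hz ↦ ?_⟩
    have hSz : vertIdeal R (ringW' R V x') (idealS' A' V) ≤ z.asIdeal :=
      Ideal.map_le_iff_le_comap.2 (mem_closedS'_iff.1 hz)
    -- A point of the residual part over S' is a zero of h₀, hence of the pull-back of F, hence lies
    -- on the diagonal; but the residual part is disjoint from the diagonal.
    have hJ := hJz _ z.isPrime hSz (by
      have := add_mem (hSz hS₀) (hGz hhG)
      rwa [sub_add_cancel] at this)
    exact z.isPrime.ne_top (top_le_iff.1 (hG' ▸ sup_le hJ hGz))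
  · intro z hz
    contrapose!
    intro hzS
    let z₀ := PrimeSpectrum.comap (C : _ →+* (ringW' R V x' ⊗[R] A')[X]) z
    have hSz : vertIdeal R (ringW' R V x') (idealS' A' V) ≤ z₀.asIdeal :=
      Ideal.map_le_iff_le_comap.2 (mem_closedS'_iff.1 hzS)
    have hFz₀ : f F ∈ z₀.asIdeal := by
      change C (f F) ∈ z.asIdeal
      -- Over S' the family does not depend on θ.
      have h1 : C (f F) = h + (1 - X) * C (f F - h₀) := by
        simp only [h, map_sub]
        ring
      rw [h1]
      exact add_mem hz (Ideal.mul_mem_left _ _ (hSz hS₀))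
    have hJ := hJz _ z₀.isPrime hSz hFz₀
    refine mem_closedS'_iff.2 fun i hi ↦ ?_
    have h2 := hJ (one_tmul_sub_mem_graphIdeal (IsScalarTower.toAlgHom R A' (ringW' R V x')) i)
    have h3 := hSz (Ideal.mem_map_of_mem
      (Algebra.TensorProduct.includeRight : A' →ₐ[R] ringW' R V x' ⊗[R] A') hi)
    -- On the diagonal, i ⊗ 1 and 1 ⊗ i agree, so the W'-coordinate lies in S' along with the
    -- X'-coordinate.
    have h4 := sub_mem h3 h2
    rw [Algebra.TensorProduct.includeRight_apply, sub_sub_cancel] at h4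
    exact h4
  · intro z hz
    contrapose!
    intro hzS
    have hSz : vertIdeal R (ringW R V x') (idealS' A' V) ≤ z.asIdeal :=
      Ideal.map_le_iff_le_comap.2 (mem_closedS'_iff.1 hzS)
    exact mem_closedS_iff.2 fun i hi ↦ hFz z.asIdeal z.isPrime hSz hz
      (tmul_one_mem_transposeIdeal (R := R) (P := ringW R V x') (idealS_le_comap A' V hi))
  · rw [hev0]
    exact hh₀J
  · have h1 := bijective_smul_toCotangent hu' hw hh₀J hh₀
    simp only [hev0]
    exact h1
  · rw [hev0]
    exact hh₀

end GoodPairs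

/-! ### Framings and the determinant -/

section FramingBases

lemma exists_basis_graphIdeal_cotangent {R P L : Type u} {ι : Type*} [CommRing R] [CommRing P] [CommRing L]
    [Algebra R P] [Algebra R L] [Algebra P L] [IsScalarTower R P L] (b : Module.Basis ι P Ω[P⁄R])
    {u : ι → P} (hb : ∀ i, b i = KaehlerDifferential.D R P (u i)) :
    ∃ bt : Module.Basis ι L (graphIdeal (IsScalarTower.toAlgHom R P L)).Cotangent,
      ∀ i, bt i = (graphIdeal (IsScalarTower.toAlgHom R P L)).toCotangent
        ⟨_, one_tmul_sub_mem_graphIdeal (IsScalarTower.toAlgHom R P L) (u i)⟩ := by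
  refine ⟨(b.baseChange L).map (tensorKaehlerEquivCotangent R P L), fun i ↦ ?_⟩
  rw [Module.Basis.map_apply, Module.Basis.baseChange_apply, hb]
  refine (tensorKaehlerToCotangent_tmul_D (1 : L) (u i)).trans ?_
  rw [one_smul]

namespace FramedExcision.Framing

variable {R A' : Type u} [CommRing R] [CommRing A'] [Algebra R A'] {d : ℕ}
  {C : Type u} [CommRing C] [Algebra R C] (Φ : Framing R A' d C)
  {L : Type u} [CommRing L] [Algebra R L] (g : A' →ₐ[R] L)

/-- 𝒱 is étale over affine space, so the dt_i form a basis of its differentials over B; the conormal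
module of the graph is their pull-back. -/
lemma exists_basis_tElem : ∃ bt : Module.Basis (Fin (d + 1)) L (Φ.ideal g).Cotangent,
    ∀ i, bt i = (Φ.ideal g).toCotangent (Φ.tElem g i) := by
  let S := MvPolynomial (Fin (d + 1)) R
  let : Algebra S C := Φ.ρ.toRingHom.toAlgebra
  have : IsScalarTower R S C := .of_algebraMap_eq' Φ.ρ.comp_algebraMap.symm
  have : Algebra.Etale S C := Φ.etale
  let : Algebra C L := (g.comp Φ.s).toRingHom.toAlgebra
  have : IsScalarTower R C L := .of_algebraMap_eq' (g.comp Φ.s).comp_algebraMap.symm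
  let b₁ : Module.Basis (Fin (d + 1)) C Ω[C⁄R] :=
    ((KaehlerDifferential.mvPolynomialBasis R (Fin (d + 1))).baseChange C).map
      (KaehlerDifferential.tensorKaehlerEquivOfFormallyEtale R S C)
  have hb₁ (i) : b₁ i = KaehlerDifferential.D R C (Φ.ρ (MvPolynomial.X i)) := by
    simp [b₁, S]
    rfl
  exact exists_basis_graphIdeal_cotangent b₁ hb₁

/-- Split c as (c − r(s(c))) + r(s(c)): the first summand lies in the kernel of s, generated by the
φ_i, and the second is pulled back from X', where e generates modulo the square. -/
lemma ideal_le_span_eElem {e : L ⊗[R] A'} (he : e ∈ graphIdeal g)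
    (hle : graphIdeal g ≤ Ideal.span {e} ⊔ graphIdeal g ^ 2) :
    Φ.ideal g ≤ Ideal.span (Set.range fun i ↦ (Φ.eElem g he i : L ⊗[R] C)) ⊔ Φ.ideal g ^ 2 := by
  set N := Ideal.span (Set.range fun i ↦ (Φ.eElem g he i : L ⊗[R] C))
  let f : L ⊗[R] A' →ₐ[L] L ⊗[R] C := Algebra.TensorProduct.map (AlgHom.id L L) Φ.r
  have hfe : f e ∈ N := Ideal.subset_span ⟨0, rfl⟩
  have hφ (i) : (1 : L) ⊗ₜ[R] Φ.φ i ∈ N := Ideal.subset_span ⟨i.succ, rfl⟩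
  have h1 : (graphIdeal g).map f ≤ Φ.ideal g := Ideal.map_le_iff_le_comap.2 fun x ↦ Φ.map_r_mem g
  have h2 : (graphIdeal g).map f ≤ N ⊔ Φ.ideal g ^ 2 := by
    refine (Ideal.map_mono hle).trans ?_
    rw [Ideal.map_sup, Ideal.map_span, Set.image_singleton, Ideal.map_pow]
    exact sup_le_sup ((Ideal.span_singleton_le_iff_mem _).2 hfe) (Ideal.pow_right_mono h1 2)
  have h3 : (RingHom.ker Φ.s).map (Algebra.TensorProduct.includeRight : C →ₐ[R] L ⊗[R] C) ≤ N := by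
    rw [← Φ.generates, Ideal.map_span, Ideal.span_le]
    rintro _ ⟨_, ⟨i, rfl⟩, rfl⟩
    exact hφ i
  have hrs (c : C) : c - Φ.r (Φ.s c) ∈ RingHom.ker Φ.s := by
    have := DFunLike.congr_fun Φ.retraction (Φ.s c)
    rw [AlgHom.comp_apply, AlgHom.id_apply] at this
    rw [RingHom.mem_ker, map_sub, this, sub_self]
  refine (graphIdeal_eq_span _).le.trans (Ideal.span_le.2 ?_)
  rintro _ ⟨c, rfl⟩
  have h4 := Ideal.mem_sup_left (T := Φ.ideal g ^ 2) (h3 (Ideal.mem_map_of_mem _ (hrs c)))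
  have h5 := h2 (Ideal.mem_map_of_mem f (one_tmul_sub_mem_graphIdeal g (Φ.s c)))
  convert! add_mem h4 h5 using 1
  simp [f, TensorProduct.tmul_sub]

lemma top_le_span_eElem {e : L ⊗[R] A'} (he : e ∈ graphIdeal g)
    (hle : graphIdeal g ≤ Ideal.span {e} ⊔ graphIdeal g ^ 2) :
    ⊤ ≤ Submodule.span L (Set.range fun i ↦ (Φ.ideal g).toCotangent (Φ.eElem g he i)) := by
  intro x _
  obtain ⟨x, rfl⟩ := (Φ.ideal g).toCotangent_surjective x
  obtain ⟨y, hy, z, hz, hyz⟩ := Submodule.mem_sup.1 (Φ.ideal_le_span_eElem g he hle x.2)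
  have key (y : L ⊗[R] C) (hy : y ∈ Ideal.span (Set.range fun i ↦ (Φ.eElem g he i : L ⊗[R] C))) :
      ∃ hy' : y ∈ Φ.ideal g, (Φ.ideal g).toCotangent ⟨y, hy'⟩ ∈
        Submodule.span L (Set.range fun i ↦ (Φ.ideal g).toCotangent (Φ.eElem g he i)) := by
    induction hy using Submodule.span_induction with
    | mem y hy =>
      obtain ⟨i, rfl⟩ := hy
      exact ⟨(Φ.eElem g he i).2, Submodule.subset_span ⟨i, rfl⟩⟩
    | zero =>
      refine ⟨zero_mem _, ?_⟩
      have : (Φ.ideal g).toCotangent ⟨0, zero_mem _⟩ = 0 := map_zero _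
      rw [this]
      exact zero_mem _
    | add y z _ _ hy hz =>
      obtain ⟨hy, hy'⟩ := hy
      obtain ⟨hz, hz'⟩ := hz
      refine ⟨add_mem hy hz, ?_⟩
      exact add_mem hy' hz'
    | smul a y _ hy =>
      obtain ⟨hy, hy'⟩ := hy
      refine ⟨Ideal.mul_mem_left _ a hy, ?_⟩
      convert! Submodule.smul_mem _ (graphEval (g.comp Φ.s) a) hy'
      rw [← smul_graphIdeal_cotangent]
      exact map_smul (Φ.ideal g).toCotangent a ⟨y, hy⟩
  obtain ⟨hy', hy''⟩ := key y hy
  convert! hy'' using 1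
  rw [Ideal.toCotangent_eq]
  rw [← hyz]
  simpa using hz

/-- A spanning family with as many members as the rank is a basis; the rank is read off the
coordinate basis. -/
lemma exists_basis_eElem [Nontrivial L] {e : L ⊗[R] A'} (he : e ∈ graphIdeal g)
    (hle : graphIdeal g ≤ Ideal.span {e} ⊔ graphIdeal g ^ 2) :
    ∃ be : Module.Basis (Fin (d + 1)) L (Φ.ideal g).Cotangent,
      ∀ i, be i = (Φ.ideal g).toCotangent (Φ.eElem g he i) := by
  obtain ⟨bt, -⟩ := Φ.exists_basis_tElem g
  have h := Φ.top_le_span_eElem g he hle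
  exact ⟨Module.Basis.mk (linearIndependent_of_top_le_span_of_card_eq_finrank h
    (Module.finrank_eq_card_basis bt).symm) h, fun i ↦ by simp⟩

/-- The class of `h_0` modulo `J²` can be scaled by a unit so that the determinant becomes `1`. -/
lemma exists_isUnit_hasUnitDeterminant [Nontrivial L] {δ : L ⊗[R] A'} (hδ : δ ∈ graphIdeal g)
    (hle : graphIdeal g ≤ Ideal.span {δ} ⊔ graphIdeal g ^ 2) :
    ∃ w : L, IsUnit w ∧ ∀ (e : L ⊗[R] A') (he : e ∈ graphIdeal g),
      e - w ⊗ₜ[R] (1 : A') * δ ∈ graphIdeal g ^ 2 →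
      graphIdeal g ≤ Ideal.span {e} ⊔ graphIdeal g ^ 2 → Φ.HasUnitDeterminant g he := by
  obtain ⟨bt, hbt⟩ := Φ.exists_basis_tElem g
  obtain ⟨bδ, hbδ⟩ := Φ.exists_basis_eElem g hδ hle
  -- D is the determinant belonging to δ. Only the first vector changes when δ is replaced by wδ
  -- modulo J², so w = D⁻¹ normalizes it.
  obtain ⟨D, hD⟩ := bt.isUnit_det bδ
  refine ⟨((D⁻¹ : Lˣ) : L), D⁻¹.isUnit, fun e he heδ hle' ↦ ?_⟩
  obtain ⟨be, hbe⟩ := Φ.exists_basis_eElem g he hle'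
  refine ⟨bt, be, hbt, hbe, ?_⟩
  let m (i : Fin d) := (Φ.ideal g).toCotangent ⟨(1 : L) ⊗ₜ[R] Φ.φ i, Φ.one_tmul_φ_mem g i⟩
  have h1 : ⇑bδ = Fin.cons ((Φ.ideal g).toCotangent ⟨_, Φ.map_r_mem g hδ⟩) m := by
    ext i
    rw [hbδ]
    refine Fin.cases ?_ (fun i ↦ ?_) i <;> rfl
  have h2 : ⇑be = Fin.cons ((Φ.ideal g).toCotangent ⟨_, Φ.map_r_mem g he⟩) m := by
    ext i
    rw [hbe]
    refine Fin.cases ?_ (fun i ↦ ?_) i <;> rfl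
  have h3 : (Φ.ideal g).toCotangent ⟨_, Φ.map_r_mem g he⟩ =
      ((D⁻¹ : Lˣ) : L) • (Φ.ideal g).toCotangent ⟨_, Φ.map_r_mem g hδ⟩ := by
    rw [← LinearMap.map_smul_of_tower, Ideal.toCotangent_eq]
    let f : L ⊗[R] A' →ₐ[L] L ⊗[R] C := Algebra.TensorProduct.map (AlgHom.id L L) Φ.r
    have hf : (graphIdeal g).map f ≤ Φ.ideal g :=
      Ideal.map_le_iff_le_comap.2 fun x ↦ Φ.map_r_mem g
    have h4 := Ideal.mem_map_of_mem f heδ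
    rw [Ideal.map_pow] at h4
    have h5 := Ideal.pow_right_mono hf 2 h4
    convert! h5 using 1
    rw [map_sub, map_mul]
    congr 1
    change ((D⁻¹ : Lˣ) : L) • f δ = _
    rw [Algebra.smul_def]
    simp [f]
  rw [← Module.Basis.det_apply, h2, h3]
  refine (bt.det.toMultilinearMap.cons_smul m _ _).trans ?_
  have h6 := hD
  rw [h1] at h6
  change ((D⁻¹ : Lˣ) : L) * bt.det _ = 1
  rw [← h6, Units.inv_mul]

end FramedExcision.Framing

end FramingBases

/-! ### Fibre dimension from a trivial exterior power -/

section ExteriorPowers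

variable {A M : Type*} [CommRing A] [AddCommGroup M] [Module A M]

/-- If an exterior power of `M` is free of rank one, then the corresponding exterior powers of the
fibres of `M` have dimension at most one. -/
lemma choose_finrank_tensorProduct_le_one {n : ℕ} (e : (⋀[A]^n M) ≃ₗ[A] A)
    (K : Type*) [Field K] [Algebra A K] [Module.Finite K (K ⊗[A] M)] :
    (Module.finrank K (K ⊗[A] M)).choose n ≤ 1 := by
  rw [← exteriorPower.finrank_eq K n]
  let f : M [⋀^Fin n]→ₗ[A] (⋀[K]^n (K ⊗[A] M)) :=
    { ((exteriorPower.ιMulti K n (M := K ⊗[A] M)).toMultilinearMap.restrictScalars A).compLinearMap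
        (fun _ ↦ TensorProduct.mk A K M 1) with
      map_eq_zero_of_eq' := fun v i j h hij ↦
        (exteriorPower.ιMulti K n (M := K ⊗[A] M)).map_eq_zero_of_eq _
          (congrArg (TensorProduct.mk A K M 1) h) hij }
  let ψ := exteriorPower.alternatingMapLinearEquiv f
  have hspan : Submodule.span K (Set.range (TensorProduct.mk A K M 1)) = ⊤ := by
    refine top_le_iff.1 fun x _ ↦ ?_
    induction x with
    | zero => exact zero_mem _
    | add x y hx hy => exact add_mem (hx trivial) (hy trivial)
    | tmul k m =>
      have : k ⊗ₜ[A] m = k • (1 : K) ⊗ₜ[A] m := by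
        rw [TensorProduct.smul_tmul', smul_eq_mul, mul_one]
      rw [this]
      exact Submodule.smul_mem _ _ (Submodule.subset_span ⟨m, rfl⟩)
  -- Wedges of the vectors 1 ⊗ m span, and each comes from the exterior power over A, where
  -- everything is a multiple of `e.symm 1`.
  refine finrank_le_one (ψ (e.symm 1)) fun w ↦ ?_
  have hw : w ∈ Submodule.span K (exteriorPower.ιMulti K n '' {a | Set.range a ⊆
      Set.range (TensorProduct.mk A K M 1)}) := by
    rw [exteriorPower.ιMulti_span_of_span K n (K ⊗[A] M) hspan]
    trivial
  refine Submodule.mem_span_singleton.1 (Submodule.span_le.2 ?_ hw)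
  rintro _ ⟨a, ha, rfl⟩
  choose v hv using fun i ↦ ha ⟨i, rfl⟩
  have h1 : exteriorPower.ιMulti K n a = ψ (exteriorPower.ιMulti A n v) := by
    rw [exteriorPower.alternatingMapLinearEquiv_apply_ιMulti]
    exact congrArg (exteriorPower.ιMulti K n) (funext fun i ↦ (hv i).symm)
  have h2 : exteriorPower.ιMulti A n v = e (exteriorPower.ιMulti A n v) • e.symm 1 := by
    rw [← map_smul, smul_eq_mul, mul_one, e.symm_apply_apply]
  rw [h1, h2, map_smul, ← algebraMap_smul K]
  exact Submodule.smul_mem _ _ (Submodule.mem_span_singleton_self _)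

/-- If an exterior power of `M` is free of rank one, then its degree is at most the dimension of each
fibre of `M` over a closed point. -/
lemma le_finrank_quotient_tensorProduct {n : ℕ} (e : (⋀[A]^n M) ≃ₗ[A] A) [Module.Finite A M]
    (𝔪 : Ideal A) [h𝔪 : 𝔪.IsMaximal] : n ≤ Module.finrank (A ⧸ 𝔪) ((A ⧸ 𝔪) ⊗[A] M) := by
  let := Ideal.Quotient.field 𝔪
  by_contra! hlt
  let b := Module.finBasis (A ⧸ 𝔪) ((A ⧸ 𝔪) ⊗[A] M)
  choose m hm using fun i ↦ TensorProduct.mk_surjective A M (A ⧸ 𝔪) Ideal.Quotient.mk_surjective (b i)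
  let φ := Fintype.linearCombination A m
  -- By Nakayama some r ≡ 1 modulo 𝔪 moves M into the span of fewer than n vectors. Then r^n kills
  -- the n-th exterior power, which is free of rank one, so r^n = 0 and r ∈ 𝔪, a contradiction.
  have hle : (⊤ : Submodule A M) ≤ LinearMap.range φ ⊔ 𝔪 • ⊤ := by
    intro x _
    let c := b.repr ((1 : A ⧸ 𝔪) ⊗ₜ x)
    choose c' hc' using fun i ↦ Ideal.Quotient.mk_surjective (c i)
    have h1 : (1 : A ⧸ 𝔪) ⊗ₜ[A] (x - φ c') = 0 := by
      rw [TensorProduct.tmul_sub, sub_eq_zero, Fintype.linearCombination_apply,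
        TensorProduct.tmul_sum]
      rw [← b.sum_repr ((1 : A ⧸ 𝔪) ⊗ₜ x)]
      refine Finset.sum_congr rfl fun i _ ↦ ?_
      rw [TensorProduct.tmul_smul, ← hm i, ← algebraMap_smul (A ⧸ 𝔪) (c' i)]
      congr 1
      exact (hc' i).symm
    have h2 : x - φ c' ∈ 𝔪 • (⊤ : Submodule A M) := by
      have h3 := congrArg (TensorProduct.quotTensorEquivQuotSMul M 𝔪) h1
      rw [map_zero] at h3
      rw [← Submodule.Quotient.mk_eq_zero]
      simpa using h3
    rw [← sub_add_cancel x (φ c')]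
    exact add_mem (Submodule.mem_sup_right h2) (Submodule.mem_sup_left ⟨c', rfl⟩)
  obtain ⟨r, hr, hr'⟩ := Submodule.exists_sub_one_mem_and_smul_le_of_fg_of_le_sup
    Module.Finite.fg_top le_rfl hle
  choose y hy using fun x : M ↦ hr' (Submodule.smul_mem_pointwise_smul x r ⊤ trivial)
  have : Subsingleton (⋀[A]^n (Fin (Module.finrank (A ⧸ 𝔪) ((A ⧸ 𝔪) ⊗[A] M)) → A)) := by
    have : Nontrivial A := (Ideal.Quotient.mk 𝔪).domain_nontrivial
    refine Module.subsingleton_of_rank_zero (R := A) ?_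
    rw [← Module.finrank_eq_rank, exteriorPower.finrank_eq, Module.finrank_fin_fun,
      Nat.choose_eq_zero_of_lt hlt, Nat.cast_zero]
  have h1 (v : Fin n → M) : r ^ n • exteriorPower.ιMulti A n v = 0 := by
    have h2 : (fun i ↦ r • v i) = φ ∘ fun i ↦ y (v i) := funext fun i ↦ (hy (v i)).symm
    have h3 := (exteriorPower.ιMulti A n (M := M)).map_smul_univ (fun _ ↦ r) v
    rw [Finset.prod_const, Finset.card_univ, Fintype.card_fin, h2] at h3
    rw [← h3, ← exteriorPower.map_apply_ιMulti, Subsingleton.elim (exteriorPower.ιMulti A n _) 0,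
      map_zero]
  have h2 (x : ⋀[A]^n M) : r ^ n • x = 0 := by
    have hx : x ∈ Submodule.span A (Set.range (exteriorPower.ιMulti A n)) := by
      rw [exteriorPower.ιMulti_span]
      trivial
    induction hx using Submodule.span_induction with
    | mem x hx => obtain ⟨v, rfl⟩ := hx; exact h1 v
    | zero => exact smul_zero _
    | add x y _ _ hx hy => rw [smul_add, hx, hy, add_zero]
    | smul a x _ hx => rw [smul_comm, hx, smul_zero]
  have h3 : r ^ n = 0 := by
    have := congrArg e (h2 (e.symm 1))
    simpa using this
  have h4 : r ∈ 𝔪 := h𝔪.isPrime.mem_of_pow_mem n (h3 ▸ zero_mem _)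
  exact h𝔪.ne_top ((Ideal.eq_top_iff_one _).2 (by simpa using sub_mem h4 hr))

end ExteriorPowers

/-! ### Invertibility from one-dimensional fibres -/

section RankOne

variable {A M : Type*} [CommRing A] [AddCommGroup M] [Module A M]

/-- A finite projective module with one-dimensional fibres at closed points is invertible. -/
lemma Module.Invertible.of_forall_finrank_eq_one [Module.Finite A M] [Module.Projective A M]
    (h : ∀ (𝔪 : Ideal A), 𝔪.IsMaximal → Module.finrank (A ⧸ 𝔪) ((A ⧸ 𝔪) ⊗[A] M) = 1) :
    Module.Invertible A M := by
  have hcyc (𝔪 : Ideal A) (h𝔪 : 𝔪.IsMaximal) :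
      ∃ (s : A) (x : M), s ∉ 𝔪 ∧ ∀ m : M, ∃ a : A, s • m = a • x := by
    let := Ideal.Quotient.field 𝔪
    obtain ⟨v, hv0, hv⟩ := finrank_eq_one_iff'.1 (h 𝔪 h𝔪)
    obtain ⟨x, rfl⟩ := TensorProduct.mk_surjective A M (A ⧸ 𝔪) Ideal.Quotient.mk_surjective v
    have hle : (⊤ : Submodule A M) ≤ Submodule.span A {x} ⊔ 𝔪 • ⊤ := by
      intro m _
      obtain ⟨c, hc⟩ := hv ((1 : A ⧸ 𝔪) ⊗ₜ m)
      obtain ⟨c, rfl⟩ := Ideal.Quotient.mk_surjective c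
      have h1 : (1 : A ⧸ 𝔪) ⊗ₜ[A] (m - c • x) = 0 := by
        rw [TensorProduct.tmul_sub, ← hc, TensorProduct.tmul_smul, sub_eq_zero]
        exact algebraMap_smul (A ⧸ 𝔪) c _
      have h2 : m - c • x ∈ 𝔪 • (⊤ : Submodule A M) := by
        have h3 := congrArg (TensorProduct.quotTensorEquivQuotSMul M 𝔪) h1
        rw [map_zero] at h3
        rw [← Submodule.Quotient.mk_eq_zero]
        simpa using h3
      rw [← sub_add_cancel m (c • x)]
      exact add_mem (Submodule.mem_sup_right h2)
        (Submodule.mem_sup_left (Submodule.smul_mem _ _ (Submodule.mem_span_singleton_self x)))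
    obtain ⟨r, hr, hr'⟩ := Submodule.exists_sub_one_mem_and_smul_le_of_fg_of_le_sup
      Module.Finite.fg_top le_rfl hle
    refine ⟨r, x, fun hr𝔪 ↦ h𝔪.ne_top ((Ideal.eq_top_iff_one _).2 (by simpa using sub_mem hr𝔪 hr)),
      fun m ↦ ?_⟩
    obtain ⟨a, ha⟩ := Submodule.mem_span_singleton.1
      (hr' (Submodule.smul_mem_pointwise_smul m r ⊤ trivial))
    exact ⟨a, ha.symm⟩
  -- This identity is clear for cyclic modules, and M is cyclic up to a multiplier s outside any
  -- given maximal ideal. It yields injectivity of the contraction below.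
  have hswap (f : Module.Dual A M) (m n : M) : f m • n = f n • m := by
    rw [← sub_eq_zero]
    have : (Submodule.span A {f m • n - f n • m}).annihilator = ⊤ := by
      by_contra hne
      obtain ⟨𝔪, h𝔪, hle⟩ := Ideal.exists_le_maximal _ hne
      obtain ⟨s, x, hs, hsx⟩ := hcyc 𝔪 h𝔪
      obtain ⟨a, ha⟩ := hsx m
      obtain ⟨b, hb⟩ := hsx n
      have h1 : s * s ∈ 𝔪 := hle (by
        rw [Submodule.mem_annihilator_span_singleton]
        have e1 : (s * s) • f m • n = f (s • m) • s • n := by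
          rw [map_smul]; simp only [smul_smul, smul_eq_mul]; ring_nf
        have e2 : (s * s) • f n • m = f (s • n) • s • m := by
          rw [map_smul]; simp only [smul_smul, smul_eq_mul]; ring_nf
        rw [smul_sub, e1, e2, ha, hb, map_smul, map_smul]
        simp only [smul_smul, smul_eq_mul, ← sub_smul]
        ring_nf
        exact zero_smul _ _)
      exact hs ((h𝔪.isPrime.mem_or_mem h1).elim id id)
    have h1 : (1 : A) ∈ (Submodule.span A {f m • n - f n • m}).annihilator := this ▸ trivial
    rwa [Submodule.mem_annihilator_span_singleton, one_smul] at h1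
  -- If all values f(m) lay in 𝔪, a splitting of the projective module would give M = 𝔪M.
  have hsurj : Function.Surjective (contractLeft A M) := by
    rw [← LinearMap.range_eq_top]
    by_contra hne
    obtain ⟨𝔪, h𝔪, hle⟩ := Ideal.exists_le_maximal _ hne
    obtain ⟨s, hs⟩ := Module.projective_def'.1 ‹Module.Projective A M›
    have h1 : (⊤ : Submodule A M) ≤ 𝔪 • ⊤ := by
      intro m _
      have h2 := DFunLike.congr_fun hs m
      rw [LinearMap.comp_apply, Finsupp.linearCombination_apply, LinearMap.id_apply] at h2
      rw [← h2]
      refine Submodule.sum_mem _ fun i _ ↦ Submodule.smul_mem_smul (hle ?_) trivial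
      exact ⟨(Finsupp.lapply i ∘ₗ s) ⊗ₜ m, by simp⟩
    have h2 : Subsingleton ((A ⧸ 𝔪) ⊗[A] M) := by
      have := Submodule.Quotient.subsingleton_iff.2 (top_le_iff.1 h1)
      exact (TensorProduct.quotTensorEquivQuotSMul M 𝔪).toEquiv.subsingleton
    have := h 𝔪 h𝔪
    rw [Module.finrank_zero_of_subsingleton] at this
    exact zero_ne_one this
  refine ⟨⟨?_, hsurj⟩⟩
  rw [injective_iff_map_eq_zero]
  obtain ⟨y, hy⟩ := hsurj 1
  intro x hx
  have key (x y : Module.Dual A M ⊗[A] M) : contractLeft A M y • x = contractLeft A M x • y := by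
    induction x with
    | zero => simp
    | add x x' hx hx' => rw [smul_add, hx, hx', map_add, add_smul]
    | tmul f m =>
      induction y with
      | zero => simp
      | add y y' hy hy' => rw [smul_add, ← hy, ← hy', map_add, add_smul]
      | tmul g n =>
        rw [contractLeft_apply, contractLeft_apply, ← TensorProduct.tmul_smul, hswap g n m,
          ← TensorProduct.smul_tmul, ← TensorProduct.smul_tmul']
        rw [TensorProduct.smul_tmul']
        congr 1
        ext p
        simp only [LinearMap.smul_apply, smul_eq_mul]
        have := congrArg f (hswap g m p)
        simp only [map_smul, smul_eq_mul] at this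
        rw [this, mul_comm]
  rw [← one_smul A x, ← hy, key, hx, zero_smul]

end RankOne

/-! ### Relative differentials have rank one -/

section RelativeRank

lemma Nat.eq_of_choose_le_one {N n : ℕ} (hn : n ≠ 0) (hle : n ≤ N) (h : N.choose n ≤ 1) : N = n := by
  by_contra hne
  have h1 : (n + 1).choose n ≤ N.choose n := Nat.choose_le_choose n (by omega)
  rw [Nat.choose_succ_self_right] at h1
  omega

/-- Relative differentials are of rank one if the canonical sheaves, of consecutive degrees, are
trivial. -/
lemma Module.Invertible.kaehlerDifferential_of_exteriorPower {k R A : Type*} [Field k] [CommRing R]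
    [CommRing A] [Algebra k R] [Algebra k A] [Algebra R A] [IsScalarTower k R A]
    [Algebra.FiniteType k R] [Algebra.Smooth k A] [Algebra.Smooth R A] {m : ℕ}
    (eR : (⋀[R]^m Ω[R⁄k]) ≃ₗ[R] R) (eA : (⋀[A]^(m + 1) Ω[A⁄k]) ≃ₗ[A] A)
    (hm : m = 0 → Subsingleton Ω[R⁄k]) : Module.Invertible A Ω[A⁄R] := by
  refine .of_forall_finrank_eq_one fun 𝔪 h𝔪 ↦ ?_
  let K := A ⧸ 𝔪
  let : Field K := Ideal.Quotient.field 𝔪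
  -- Smoothness of A over R makes the cotangent sequence exact on the left and split, so fibre
  -- dimensions add up.
  have hinj : Function.Injective (KaehlerDifferential.mapBaseChange k R A) := by
    rw [injective_iff_map_eq_zero]
    intro x hx
    obtain ⟨x, rfl⟩ := (Algebra.H1Cotangent.exact_δ_mapBaseChange k R A x).mp hx
    rw [Subsingleton.elim x 0, map_zero]
  obtain ⟨l, hl⟩ := Module.projective_lifting_property (KaehlerDifferential.map k R A A)
    LinearMap.id (KaehlerDifferential.map_surjective k R A)
  obtain ⟨e, -⟩ := (KaehlerDifferential.exact_mapBaseChange_map k R A).splitSurjectiveEquiv hinj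
    ⟨l, hl⟩
  let e₁ : K ⊗[A] Ω[A⁄k] ≃ₗ[K] K ⊗[A] ((A ⊗[R] Ω[R⁄k]) × Ω[A⁄R]) :=
    LinearEquiv.baseChange A K _ _ e
  let eK := e₁.trans (TensorProduct.prodRight A K K (A ⊗[R] Ω[R⁄k]) Ω[A⁄R])
  have : Module.Finite A (A ⊗[R] Ω[R⁄k]) :=
    .of_surjective (LinearMap.fst A (A ⊗[R] Ω[R⁄k]) Ω[A⁄R] ∘ₗ e.toLinearMap)
      fun x ↦ ⟨e.symm (x, 0), by simp⟩
  let e' : K ⊗[A] (A ⊗[R] Ω[R⁄k]) ≃ₗ[K] K ⊗[R] Ω[R⁄k] :=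
    TensorProduct.AlgebraTensorModule.cancelBaseChange R A K K Ω[R⁄k]
  have hsum : Module.finrank K (K ⊗[A] Ω[A⁄k]) = Module.finrank K (K ⊗[R] Ω[R⁄k]) +
      Module.finrank K (K ⊗[A] Ω[A⁄R]) := by
    rw [eK.finrank_eq, Module.finrank_prod, e'.finrank_eq]
  have hA : Module.finrank K (K ⊗[A] Ω[A⁄k]) = m + 1 :=
    Nat.eq_of_choose_le_one (Nat.succ_ne_zero m) (le_finrank_quotient_tensorProduct eA 𝔪)
      (choose_finrank_tensorProduct_le_one eA K)
  have hR : Module.finrank K (K ⊗[R] Ω[R⁄k]) = m := by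
    -- The zeroth exterior power is always free of rank one and carries no information, so `hm`
    -- takes over.
    by_cases h0 : m = 0
    · have := hm h0
      rw [h0, Module.finrank_zero_of_subsingleton]
    refine Nat.eq_of_choose_le_one h0 ?_ (choose_finrank_tensorProduct_le_one eR K)
    let 𝔮 := 𝔪.comap (algebraMap R A)
    -- By the Nullstellensatz the residue field at 𝔪 is finite over k, and R/𝔮 embeds into it.
    have h𝔮 : 𝔮.IsMaximal := by
      have : Module.Finite k K := finite_of_finite_type_of_isJacobsonRing k K
      have : Algebra.IsIntegral k (R ⧸ 𝔮) := by
        let f : R ⧸ 𝔮 →ₐ[k] K := Ideal.Quotient.liftₐ 𝔮 (IsScalarTower.toAlgHom k R K) fun r hr ↦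
          Ideal.Quotient.eq_zero_iff_mem.2 hr
        refine ⟨fun x ↦ (isIntegral_algHom_iff f ?_).1 (Algebra.IsIntegral.isIntegral (f x))⟩
        rw [injective_iff_map_eq_zero]
        intro x hx
        obtain ⟨x, rfl⟩ := Ideal.Quotient.mk_surjective x
        have h1 : algebraMap R A x ∈ 𝔪 := Ideal.Quotient.eq_zero_iff_mem.1 hx
        exact Ideal.Quotient.eq_zero_iff_mem.2 h1
      exact Ideal.Quotient.maximal_of_isField _
        (isField_of_isIntegral_of_isField' (Field.toIsField k))
    let K₀ := R ⧸ 𝔮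
    let : Field K₀ := Ideal.Quotient.field 𝔮
    have : 𝔪.LiesOver 𝔮 := ⟨rfl⟩
    let : Algebra K₀ K := Ideal.Quotient.algebraOfLiesOver 𝔪 𝔮
    let e₀ : K ⊗[K₀] (K₀ ⊗[R] Ω[R⁄k]) ≃ₗ[K] K ⊗[R] Ω[R⁄k] :=
      TensorProduct.AlgebraTensorModule.cancelBaseChange R K₀ K K Ω[R⁄k]
    rw [← e₀.finrank_eq, Module.finrank_baseChange]
    exact le_finrank_quotient_tensorProduct eR 𝔮
  have h1 : Module.finrank K (K ⊗[A] Ω[A⁄R]) = 1 := by omega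
  exact h1

end RelativeRank

/-! ### Projective space: finite type, and dimension zero -/

section ProjectiveSpace

open MvPolynomial HomogeneousLocalization

attribute [local instance] MvPolynomial.gradedAlgebra

variable {σ k : Type u} [CommRing k]

lemma MvPolynomial.adjoin_homogeneousSubmodule_zero_range_X (σ k : Type*) [CommRing k] :
    Algebra.adjoin (homogeneousSubmodule σ k 0) (Set.range (X : σ → MvPolynomial σ k)) = ⊤ := by
  refine eq_top_iff.mpr fun p _ ↦ ?_
  induction p using MvPolynomial.induction_on with
  | C a =>
    exact Subalgebra.algebraMap_mem _ (⟨C a, isHomogeneous_C σ a⟩ : homogeneousSubmodule σ k 0)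
  | add p q hp hq => exact add_mem (hp trivial) (hq trivial)
  | mul_X p i hp => exact mul_mem (hp trivial) (Algebra.subset_adjoin ⟨i, rfl⟩)

instance MvPolynomial.finiteType_homogeneousSubmodule_zero (σ k : Type*) [Finite σ] [CommRing k] :
    Algebra.FiniteType (homogeneousSubmodule σ k 0) (MvPolynomial σ k) :=
  ⟨(Set.finite_range X).toFinset, by
    simpa using adjoin_homogeneousSubmodule_zero_range_X σ k⟩

lemma MvPolynomial.algebraMap_homogeneousSubmodule_zero_surjective (σ k : Type*) [CommRing k] :
    Function.Surjective (algebraMap k (homogeneousSubmodule σ k 0)) := by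
  rintro ⟨p, hp⟩
  have hp' : p.IsHomogeneous 0 := hp
  rw [← totalDegree_zero_iff_isHomogeneous, totalDegree_eq_zero_iff_eq_C] at hp'
  exact ⟨p.coeff 0, Subtype.ext hp'.symm⟩

instance FramedExcision.ProjSpace.locallyOfFiniteType_toSpec (m : ℕ) (k : Type u) [CommRing k] :
    LocallyOfFiniteType (ProjSpace.toSpec m k) := by
  have : LocallyOfFiniteType (Spec.map (CommRingCat.ofHom
      (algebraMap k (homogeneousSubmodule (Fin (m + 1)) k 0)))) :=
    HasRingHomProperty.Spec_iff.mpr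
      (RingHom.FiniteType.of_surjective _ (algebraMap_homogeneousSubmodule_zero_surjective _ k))
  exact MorphismProperty.comp_mem _ _ _
    (inferInstanceAs (LocallyOfFiniteType (Proj.toSpecZero _))) this

lemma MvPolynomial.IsHomogeneous.eq_C_mul_X_pow {k : Type*} [CommRing k] {n : ℕ}
    {p : MvPolynomial (Fin 1) k} (hp : p.IsHomogeneous n) : ∃ c, p = C c * X 0 ^ n := by
  refine ⟨p.coeff (Finsupp.single 0 n), ?_⟩
  rw [C_mul_X_pow_eq_monomial]
  ext e
  rw [coeff_monomial]
  split_ifs with h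
  · rw [h]
  · refine hp.coeff_eq_zero fun he ↦ h ?_
    ext
    simpa [Finsupp.degree_eq_sum] using he.symm

/-- The chart where the only variable is invertible is everything, and k surjects onto its ring,
since forms in one variable are multiples of a power. -/
instance FramedExcision.ProjSpace.mono_toSpec_zero (k : Type u) [CommRing k] :
    Mono (ProjSpace.toSpec 0 k) := by
  let 𝒜 := homogeneousSubmodule (Fin 1) k
  have hX : (X 0 : MvPolynomial (Fin 1) k) ∈ 𝒜 1 := isHomogeneous_X k 0
  have htop : Proj.basicOpen 𝒜 (X 0) = ⊤ := by
    rw [← Proj.iSup_basicOpen_eq_top' 𝒜 X (fun i ↦ ⟨1, isHomogeneous_X k i⟩)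
      (adjoin_homogeneousSubmodule_zero_range_X _ k)]
    simp
  have hiso : IsIso (Proj.awayι 𝒜 (X 0) hX one_pos) :=
    isIso_of_isOpenImmersion_of_opensRange_eq_top _ ((Proj.opensRange_awayι ..).trans htop)
  have hsurj : Function.Surjective ((fromZeroRingHom 𝒜 (Submonoid.powers (X 0))).comp
      (algebraMap k (𝒜 0))) := by
    intro z
    obtain ⟨n, a, ha, rfl⟩ := Away.mk_surjective 𝒜 hX z
    obtain ⟨c, rfl⟩ := IsHomogeneous.eq_C_mul_X_pow ha
    refine ⟨c, ?_⟩
    ext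
    rw [Away.val_mk]
    change Localization.mk (C c) 1 = _
    rw [Localization.mk_eq_mk_iff, Localization.r_iff_exists]
    exact ⟨1, by simp [mul_comm]⟩
  have hclosed : IsClosedImmersion (Spec.map (CommRingCat.ofHom
      ((fromZeroRingHom 𝒜 (Submonoid.powers (X 0))).comp (algebraMap k (𝒜 0))))) :=
    .spec_of_surjective _ hsurj
  have hcomp : Proj.awayι 𝒜 (X 0) hX one_pos ≫ ProjSpace.toSpec 0 k = Spec.map
      (CommRingCat.ofHom ((fromZeroRingHom 𝒜 (Submonoid.powers (X 0))).comp
      (algebraMap k (𝒜 0)))) := by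
    rw [CommRingCat.ofHom_comp, Spec.map_comp]
    exact Proj.awayι_toSpecZero_assoc ..
  have : Mono (Proj.awayι 𝒜 (X 0) hX one_pos ≫ ProjSpace.toSpec 0 k) := hcomp ▸ inferInstance
  have h := (MorphismProperty.cancel_left_of_respectsIso (.monomorphisms _)
    (Proj.awayι 𝒜 (X 0) hX one_pos) (ProjSpace.toSpec 0 k)).mp this
  exact h

end ProjectiveSpace

lemma KaehlerDifferential.subsingleton_of_isEpi (k R : Type*) [CommRing k] [CommRing R] [Algebra k R]
    [Algebra.IsEpi k R] : Subsingleton Ω[R⁄k] := by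
  have h : Submodule.span R (Set.range (D k R)) ≤ ⊥ := by
    rw [Submodule.span_le]
    rintro _ ⟨x, rfl⟩
    have hx := (Algebra.isEpi_iff_forall_one_tmul_eq k R).mp inferInstance x
    refine (D_apply k R x).trans ((Ideal.toCotangent_eq_zero _ _).mpr ?_)
    change (1 : R) ⊗ₜ[k] x - x ⊗ₜ[k] (1 : R) ∈ _
    rw [hx, sub_self]
    exact zero_mem _
  rw [span_range_derivation] at h
  exact (Submodule.subsingleton_iff R).mp (subsingleton_of_top_le_bot h)

lemma Algebra.FiniteType.of_isOpenImmersion_projSpace {k R : Type u} [CommRing k] [CommRing R]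
    [Algebra k R] {m : ℕ} (β : Spec (CommRingCat.of R) ⟶ ProjSpace m k) [IsOpenImmersion β]
    (hβ : β ≫ ProjSpace.toSpec m k = Spec.map (CommRingCat.ofHom (algebraMap k R))) :
    Algebra.FiniteType k R := by
  have : LocallyOfFiniteType (Spec.map (CommRingCat.ofHom (algebraMap k R))) :=
    hβ ▸ inferInstance
  exact RingHom.finiteType_algebraMap.mp
    ((HasRingHomProperty.Spec_iff (P := @LocallyOfFiniteType)).mp this)

/-- Then B → Spec k is a monomorphism, that is, k → R is an epimorphism. This settles the case m = 0
of the rank count. -/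
lemma KaehlerDifferential.subsingleton_of_isOpenImmersion_projSpace {k R : Type u} [CommRing k]
    [CommRing R] [Algebra k R] (β : Spec (CommRingCat.of R) ⟶ ProjSpace 0 k) [IsOpenImmersion β]
    (hβ : β ≫ ProjSpace.toSpec 0 k = Spec.map (CommRingCat.ofHom (algebraMap k R))) :
    Subsingleton Ω[R⁄k] := by
  have : Mono (Spec.map (CommRingCat.ofHom (algebraMap k R))) := hβ ▸ inferInstance
  have : Mono (Scheme.Spec.map (CommRingCat.ofHom (algebraMap k R)).op) := this
  have : Epi (CommRingCat.ofHom (algebraMap k R)) :=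
    have := Scheme.Spec.mono_of_mono_map this
    unop_epi_of_mono (CommRingCat.ofHom (algebraMap k R)).op
  have := CommRingCat.epi_iff_epi.mp this
  exact KaehlerDifferential.subsingleton_of_isEpi k R

lemma FramedExcision.IsAlmostElementaryFibration.smooth {R A : Type u} [CommRing R] [CommRing A]
    [Algebra R A]
    (hq : IsAlmostElementaryFibration (Spec.map (CommRingCat.ofHom (algebraMap R A)))) :
    Algebra.Smooth R A := by
  obtain ⟨Xbar, Xinf, j, qbar, i, hj, hj', -, -, hsm, -⟩ := hq
  have : AlgebraicGeometry.Smooth (Spec.map (CommRingCat.ofHom (algebraMap R A))) :=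
    hj ▸ inferInstance
  exact RingHom.smooth_algebraMap.mp
    ((HasRingHomProperty.Spec_iff (P := @AlgebraicGeometry.Smooth)).mp this)

/-! ### Sections of O(nD) in general position -/

section SectionsOfMultiples

/-- Two different bad values of c would put y, and then x, in the maximal ideal. -/
lemma IsLocalRing.subsingleton_setOf_not_isUnit_add_mul {k L : Type*} [Field k] [CommRing L]
    [IsLocalRing L] (σ : k →+* L) {x y : L} (hxy : IsUnit x ∨ IsUnit y) :
    {c : k | ¬ IsUnit (x + σ c * y)}.Subsingleton := by
  intro c hc c' hc'
  by_contra hne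
  have hc : x + σ c * y ∈ maximalIdeal L := hc
  have hc' : x + σ c' * y ∈ maximalIdeal L := hc'
  have hy : y ∈ maximalIdeal L := by
    have h := sub_mem hc hc'
    rw [show x + σ c * y - (x + σ c' * y) = σ (c - c') * y by rw [map_sub]; ring] at h
    exact (Ideal.unit_mul_mem_iff_mem _ ((IsUnit.mk0 _ (sub_ne_zero.mpr hne)).map σ)).mp h
  have hx : x ∈ maximalIdeal L := by
    simpa using sub_mem hc (Ideal.mul_mem_left _ (σ c) hy)
  exact hxy.elim hx hy

namespace FramedExcision

variable {D Y : Scheme.{u}} {i : D ⟶ Y} {U : Y.Opens}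

lemma IsSectionOfMultiple.add {n : ℕ} {f g : Γ(Y, U)} (hf : IsSectionOfMultiple i U n f)
    (hg : IsSectionOfMultiple i U n g) : IsSectionOfMultiple i U n (f + g) := by
  intro V hV a ha
  obtain ⟨x, hx⟩ := hf V hV a ha
  obtain ⟨y, hy⟩ := hg V hV a ha
  exact ⟨x + y, by rw [map_add, map_add, hx, hy, mul_add]⟩

lemma IsSectionOfMultiple.mul {m n : ℕ} {f g : Γ(Y, U)} (hf : IsSectionOfMultiple i U m f)
    (hg : IsSectionOfMultiple i U n g) : IsSectionOfMultiple i U (m + n) (f * g) := by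
  intro V hV a ha
  rw [pow_add] at ha
  induction ha using Submodule.mul_induction_on' with
  | mem_mul_mem a ha b hb =>
    obtain ⟨x, hx⟩ := hf V hV a ha
    obtain ⟨y, hy⟩ := hg V hV b hb
    exact ⟨x * y, by simp only [map_mul, hx, hy]; ring⟩
  | add a _ b _ ha hb =>
    obtain ⟨x, hx⟩ := ha
    obtain ⟨y, hy⟩ := hb
    exact ⟨x + y, by rw [map_add, map_add, hx, hy, add_mul]⟩

lemma IsSectionOfMultiple.map_top (r : Γ(Y, ⊤)) :
    IsSectionOfMultiple i U 0 (Y.presheaf.map (homOfLE le_top).op r) := by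
  intro V hV a _
  refine ⟨a * Y.presheaf.map (homOfLE le_top).op r, ?_⟩
  rw [map_mul, ← CommRingCat.comp_apply, ← CommRingCat.comp_apply, ← Functor.map_comp,
    ← Functor.map_comp]
  rfl

lemma IsSectionOfMultiple.pow {n : ℕ} {f : Γ(Y, U)} (hf : IsSectionOfMultiple i U n f) (m : ℕ) :
    IsSectionOfMultiple i U (n * m) (f ^ m) := by
  induction m with
  | zero => simpa using IsSectionOfMultiple.map_top (i := i) (U := U) 1
  | succ m ih => exact pow_succ f m ▸ ih.mul hf

lemma mem_nonvanishingLocus_pow {n : ℕ} {f : Γ(Y, U)} {y : Y}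
    (hy : y ∈ nonvanishingLocus i U n f) (m : ℕ) :
    y ∈ nonvanishingLocus i U (n * m) (f ^ m) := by
  obtain ⟨V, hV, a, ha, g, hg, hyg⟩ := hy
  refine ⟨V, hV, a ^ m, pow_mul (idealOn i V) n m ▸ Ideal.pow_mem_pow ha m, g ^ m, ?_, ?_⟩
  · simp only [map_pow, hg, mul_pow]
  · have hyV := Y.basicOpen_le g hyg
    rw [Scheme.mem_basicOpen _ _ _ hyV] at hyg ⊢
    rw [map_pow]
    exact hyg.pow m

lemma isOpen_nonvanishingLocus (n : ℕ) (f : Γ(Y, U)) : IsOpen (nonvanishingLocus i U n f) := by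
  rw [isOpen_iff_forall_mem_open]
  rintro y ⟨V, hV, a, ha, g, hg, hyg⟩
  exact ⟨Y.basicOpen g, fun z hz ↦ ⟨V, hV, a, ha, g, hg, hz⟩, (Y.basicOpen g).isOpen, hyg⟩

lemma subsingleton_setOf_notMem_nonvanishingLocus {k : Type*} [Field k] (σ : k →+* Γ(Y, ⊤))
    {n : ℕ} {f g : Γ(Y, U)} (hf : IsSectionOfMultiple i U n f) (hg : IsSectionOfMultiple i U n g)
    {y : Y} (hy : y ∈ nonvanishingLocus i U n f ∨ y ∈ nonvanishingLocus i U n g) :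
    {c : k | y ∉ nonvanishingLocus i U n
      (f + Y.presheaf.map (homOfLE le_top).op (σ c) * g)}.Subsingleton := by
  obtain ⟨V, hV, a, ha, x, x', hx, hx', hyV, hyx⟩ : ∃ V : Y.Opens, IsAffineOpen V ∧
      ∃ a ∈ idealOn i V ^ n, ∃ x x' : Γ(Y, V),
      Y.presheaf.map (homOfLE (inf_le_left : V ⊓ U ≤ V)).op x =
        Y.presheaf.map (homOfLE (inf_le_left : V ⊓ U ≤ V)).op a *
          Y.presheaf.map (homOfLE (inf_le_right : V ⊓ U ≤ U)).op f ∧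
      Y.presheaf.map (homOfLE (inf_le_left : V ⊓ U ≤ V)).op x' =
        Y.presheaf.map (homOfLE (inf_le_left : V ⊓ U ≤ V)).op a *
          Y.presheaf.map (homOfLE (inf_le_right : V ⊓ U ≤ U)).op g ∧
      ∃ hyV : y ∈ V, IsUnit (Y.presheaf.germ V y hyV x) ∨ IsUnit (Y.presheaf.germ V y hyV x') := by
    rcases hy with ⟨V, hV, a, ha, x, hx, hyx⟩ | ⟨V, hV, a, ha, x, hx, hyx⟩
    · obtain ⟨x', hx'⟩ := hg V hV a ha
      have hyV := Y.basicOpen_le _ hyx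
      exact ⟨V, hV, a, ha, x, x', hx, hx', hyV, .inl ((Y.mem_basicOpen _ _ hyV).mp hyx)⟩
    · obtain ⟨x', hx'⟩ := hf V hV a ha
      have hyV := Y.basicOpen_le _ hyx
      exact ⟨V, hV, a, ha, x', x, hx', hx, hyV, .inr ((Y.mem_basicOpen _ _ hyV).mp hyx)⟩
  refine (IsLocalRing.subsingleton_setOf_not_isUnit_add_mul
    ((Y.presheaf.germ ⊤ y trivial).hom.comp σ) hyx).anti fun c hc hu ↦ hc ?_
  refine ⟨V, hV, a, ha, x + Y.presheaf.map (homOfLE le_top).op (σ c) * x', ?_, ?_⟩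
  · have h : Y.presheaf.map (homOfLE (inf_le_left : V ⊓ U ≤ V)).op
        (Y.presheaf.map (homOfLE le_top).op (σ c)) =
        Y.presheaf.map (homOfLE (inf_le_right : V ⊓ U ≤ U)).op
          (Y.presheaf.map (homOfLE le_top).op (σ c)) := by
      rw [← CommRingCat.comp_apply, ← CommRingCat.comp_apply, ← Functor.map_comp,
        ← Functor.map_comp]
      rfl
    simp only [map_add, map_mul, hx, hx', h]
    ring
  · rw [Y.mem_basicOpen _ _ hyV, map_add, map_mul, TopCat.Presheaf.germ_res_apply]
    exact hu

/-- Powers bring two sections to the common degree mn; among the combinations f^n + c g^m each of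
the finitely many points excludes at most one c. -/
lemma exists_isSectionOfMultiple_of_finite {k : Type*} [Field k] [Infinite k]
    (σ : k →+* Γ(Y, ⊤)) (h : ∀ y : Y, ∃ n : ℕ, 1 ≤ n ∧ ∃ f : Γ(Y, U),
      IsSectionOfMultiple i U n f ∧ y ∈ nonvanishingLocus i U n f) {T : Set Y} (hT : T.Finite) :
    ∃ n : ℕ, 1 ≤ n ∧ ∃ f : Γ(Y, U), IsSectionOfMultiple i U n f ∧
      T ⊆ nonvanishingLocus i U n f := by
  induction T, hT using Set.Finite.induction_on with
  | empty =>
    exact ⟨1, le_rfl, 0, fun V _ a _ ↦ ⟨0, by simp⟩, Set.empty_subset _⟩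
  | @insert y T _ hT ih =>
    obtain ⟨m, hm, f, hf, hfT⟩ := ih
    obtain ⟨n, hn, g, hg, hgy⟩ := h y
    have hf' := hf.pow n
    have hg' := mul_comm n m ▸ hg.pow m
    have hfin : (⋃ z ∈ insert y T, {c : k | z ∉ nonvanishingLocus i U (m * n)
        (f ^ n + Y.presheaf.map (homOfLE le_top).op (σ c) * g ^ m)}).Finite := by
      refine (hT.insert y).biUnion fun z hz ↦
        (subsingleton_setOf_notMem_nonvanishingLocus σ hf' hg' ?_).finite
      rcases hz with rfl | hz
      · exact .inr (mul_comm n m ▸ mem_nonvanishingLocus_pow hgy m)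
      · exact .inl (mem_nonvanishingLocus_pow (hfT hz) n)
    obtain ⟨c, hc⟩ := hfin.exists_notMem
    simp only [Set.mem_iUnion, not_exists, Set.mem_ofPred_eq, not_not] at hc
    refine ⟨m * n, Nat.mul_pos hm hn, _, hf'.add ?_, hc⟩
    simpa using (IsSectionOfMultiple.map_top (i := i) (U := U) (σ c)).mul hg'

end FramedExcision

end SectionsOfMultiples

/-! ### Integrality of (pr, Φ) by the valuative criterion -/

section ValuativeCriterion

lemma AlgebraicGeometry.Spec.basicOpen_eq_top_iff {L : CommRingCat.{u}} (g : Γ(Spec L, ⊤)) :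
    (Spec L).basicOpen g = ⊤ ↔ IsUnit g := by
  refine ⟨fun h ↦ RingedSpace.isUnit_of_isUnit_germ (Spec L).toRingedSpace _ _ fun x _ ↦
    ((Spec L).mem_basicOpen_top g x).mp ?_, fun h ↦ Scheme.basicOpen_of_isUnit _ h⟩
  rw [h]
  trivial

lemma AlgebraicGeometry.Scheme.Hom.comp_appLE_top {X Y Z : Scheme.{u}} (f : X ⟶ Y) (g : Y ⟶ Z)
    (U : Z.Opens) (h : ⊤ ≤ g ⁻¹ᵁ U) (h' : ⊤ ≤ (f ≫ g) ⁻¹ᵁ U) :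
    (f ≫ g).appLE U ⊤ h' = g.appLE U ⊤ h ≫ f.appTop := by
  have hf : f.appTop = f.appLE ⊤ ⊤ le_rfl := f.app_eq_appLE
  exact (congr(g.appLE U ⊤ h ≫ $hf).trans (appLE_comp_appLE f g U ⊤ ⊤ h _)).symm

/-- Nonvanishing means that g = af is a unit at the point for some a in the n-th power of the ideal
of D. If the point lay on D, then a would be a nonunit as n ≥ 1, while g = aτ over the valuation
ring: f cannot be regular there. -/
lemma FramedExcision.closedPoint_notMem_range {O : Type u} [CommRing O] [IsLocalRing O]
    {T D Y : Scheme.{u}} {i : D ⟶ Y} {U : Y.Opens} {n : ℕ} (hn : 1 ≤ n) {f : Γ(Y, U)}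
    (l : Spec (CommRingCat.of O) ⟶ Y) (η : T ⟶ Spec (CommRingCat.of O))
    (hη : Function.Injective η.appTop) (hU : ⊤ ≤ (η ≫ l) ⁻¹ᵁ U)
    (hl : l (IsLocalRing.closedPoint O) ∈ nonvanishingLocus i U n f)
    (τ : Γ(Spec (CommRingCat.of O), ⊤)) (hτ : (η ≫ l).appLE U ⊤ hU f = η.appTop τ) :
    l (IsLocalRing.closedPoint O) ∉ Set.range i := by
  rintro ⟨z, hz⟩
  obtain ⟨V, hV, a, ha, g, hg, hyg⟩ := hl
  have htop (W : Y.Opens) (hW : l (IsLocalRing.closedPoint O) ∈ W) : l ⁻¹ᵁ W = ⊤ :=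
    (IsLocalRing.closedPoint_mem_iff (l ⁻¹ᵁ W)).mp hW
  have hyV := Y.basicOpen_le _ hyg
  have hlV : ⊤ ≤ l ⁻¹ᵁ V := (htop V hyV).ge
  have hηV : ⊤ ≤ (η ≫ l) ⁻¹ᵁ V := fun x _ ↦ hlV (x := η x) trivial
  have hηVU : ⊤ ≤ (η ≫ l) ⁻¹ᵁ (V ⊓ U) := le_inf hηV hU
  have hgu : IsUnit (l.appLE V ⊤ hlV g) := by
    rw [← Spec.basicOpen_eq_top_iff, Scheme.basicOpen_appLE, htop _ hyg, top_inf_eq]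
  have hau : ¬ IsUnit (l.appLE V ⊤ hlV a) := by
    intro hu
    rw [← Spec.basicOpen_eq_top_iff, Scheme.basicOpen_appLE, top_inf_eq] at hu
    have hza : l (IsLocalRing.closedPoint O) ∈ Y.basicOpen a :=
      hu.ge (x := IsLocalRing.closedPoint O) trivial
    have hza' : z ∈ i ⁻¹ᵁ (Y.basicOpen a) := by
      change i z ∈ Y.basicOpen a
      rwa [hz]
    have ha0 : i.app V a = 0 := Ideal.pow_le_self (by omega) ha
    rw [Scheme.preimage_basicOpen, ha0, Scheme.basicOpen_zero] at hza'
    exact hza'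
  have hη' (x : Γ(Y, V)) : (η ≫ l).appLE V ⊤ hηV x = η.appTop (l.appLE V ⊤ hlV x) := by
    rw [Scheme.Hom.comp_appLE_top η l V hlV hηV, CommRingCat.comp_apply]
  have h := congr((η ≫ l).appLE (V ⊓ U) ⊤ hηVU $hg)
  simp only [map_mul, ← CommRingCat.comp_apply, Scheme.Hom.map_appLE] at h
  rw [hτ, hη', hη', ← map_mul] at h
  exact hau (isUnit_of_mul_isUnit_left (hη h ▸ hgu))

/-- An affine universally closed morphism is integral. Properness extends a K-valued point of X' to
an O-valued point of the compactification. Along it f extends to the image of the polynomial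
variable, so the closed point misses D, where f has a pole, and the whole point stays in X'. -/
lemma FramedExcision.isIntegral_aeval_of_isProper {R A' P : Type u} [CommRing R] [CommRing A']
    [CommRing P] [Algebra R A'] [Algebra R P] {D Y : Scheme.{u}}
    (j : Spec (CommRingCat.of A') ⟶ Y) (π : Y ⟶ Spec (CommRingCat.of R)) (i : D ⟶ Y)
    [IsOpenImmersion j] [IsProper π]
    (hπ : j ≫ π = Spec.map (CommRingCat.ofHom (algebraMap R A')))
    (hji : Set.range j = (Set.range i)ᶜ) {U : Y.Opens} (hU : ⊤ ≤ j ⁻¹ᵁ U) {n : ℕ} (hn : 1 ≤ n)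
    {f : Γ(Y, U)}
    (hf : ∀ y ∈ Set.range i, π y ∈ Set.range (PrimeSpectrum.comap (algebraMap R P)) →
      y ∈ nonvanishingLocus i U n f) :
    (Polynomial.aeval ((1 : P) ⊗ₜ[R] (Scheme.ΓSpecIso (CommRingCat.of A')).hom (j.appLE U ⊤ hU f)) :
      Polynomial P →ₐ[P] P ⊗[R] A').toRingHom.IsIntegral := by
  set Φ : A' := (Scheme.ΓSpecIso (CommRingCat.of A')).hom (j.appLE U ⊤ hU f) with hΦ
  set ψ := (Polynomial.aeval ((1 : P) ⊗ₜ[R] Φ) : Polynomial P →ₐ[P] P ⊗[R] A').toRingHom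
  suffices IsIntegralHom (Spec.map (CommRingCat.ofHom ψ)) from IsIntegralHom.SpecMap_iff.mp this
  rw [IsIntegralHom.iff_universallyClosed_and_isAffineHom]
  refine ⟨UniversallyClosed.of_valuativeCriterion _ fun S ↦ ?_, inferInstance⟩
  obtain ⟨O, K, i₁, i₂, ⟨hcomm⟩⟩ := S
  obtain ⟨u, rfl⟩ := Spec.map_surjective i₁
  obtain ⟨v, rfl⟩ := Spec.map_surjective i₂
  rw [← Spec.map_comp, ← Spec.map_comp] at hcomm
  have huv (q : Polynomial P) : u.hom (ψ q) = algebraMap O K (v.hom q) :=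
    congr($(Spec.map_injective hcomm).hom q)
  have hP (p : P) : u.hom (p ⊗ₜ 1) = algebraMap O K (v.hom (.C p)) := by
    rw [← huv]
    congr 1
    simp [ψ]
  let vP : P →+* O := v.hom.comp Polynomial.C
  let uA : A' →+* K := u.hom.comp Algebra.TensorProduct.includeRight.toRingHom
  let η := Spec.map (CommRingCat.ofHom (algebraMap O K))
  let m := Spec.map (CommRingCat.ofHom uA)
  have hsq : CommSq (m ≫ j) η π (Spec.map (CommRingCat.ofHom (vP.comp (algebraMap R P)))) := by
    constructor
    rw [Category.assoc, hπ, ← Spec.map_comp, ← Spec.map_comp, ← CommRingCat.ofHom_comp,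
      ← CommRingCat.ofHom_comp]
    congr 2
    ext r
    have h := hP (algebraMap R P r)
    rw [← Algebra.TensorProduct.algebraMap_apply, Algebra.TensorProduct.algebraMap_apply'] at h
    exact h
  have hval : ValuativeCriterion.Existence π := by
    have : UniversallyClosed π := inferInstance
    rw [UniversallyClosed.eq_valuativeCriterion] at this
    exact this.1
  obtain ⟨⟨l, hl₁, hl₂⟩⟩ := (hval ⟨O, K, _, _, hsq⟩).exists_lift
  change η ≫ l = m ≫ j at hl₁
  change l ≫ π = _ at hl₂
  have hηU : ⊤ ≤ (η ≫ l) ⁻¹ᵁ U := hl₁ ▸ fun x _ ↦ hU (x := m x) trivial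
  have hη' (x) : (Scheme.ΓSpecIso (.of K)).hom (η.appTop x) =
      algebraMap O K ((Scheme.ΓSpecIso (.of O)).hom x) :=
    congr($(Scheme.ΓSpecIso_naturality (CommRingCat.ofHom (algebraMap O K))) x)
  have hη : Function.Injective η.appTop := by
    intro x y hxy
    have h := congr((Scheme.ΓSpecIso (.of K)).hom $hxy)
    rw [hη', hη'] at h
    exact (ConcreteCategory.bijective_of_isIso (Scheme.ΓSpecIso (.of O)).hom).1
      (IsFractionRing.injective O K h)
  have hτ : (η ≫ l).appLE U ⊤ hηU f =
      η.appTop ((Scheme.ΓSpecIso (CommRingCat.of O)).inv (v.hom .X)) := by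
    have h (x : Spec (.of K) ⟶ Y) (hx : x = m ≫ j) (hxU : ⊤ ≤ x ⁻¹ᵁ U) :
        x.appLE U ⊤ hxU = j.appLE U ⊤ hU ≫ m.appTop := by
      subst hx
      exact Scheme.Hom.comp_appLE_top ..
    rw [h _ hl₁, CommRingCat.comp_apply]
    apply (ConcreteCategory.bijective_of_isIso (Scheme.ΓSpecIso (.of K)).hom).1
    have hm (x) : (Scheme.ΓSpecIso (.of K)).hom (m.appTop x) =
        uA ((Scheme.ΓSpecIso (.of A')).hom x) :=
      congr($(Scheme.ΓSpecIso_naturality (CommRingCat.ofHom uA)) x)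
    rw [hm, hη', ← hΦ]
    have hX : ψ .X = (1 : P) ⊗ₜ[R] Φ := Polynomial.aeval_X _
    have hO : (Scheme.ΓSpecIso (.of O)).hom ((Scheme.ΓSpecIso (.of O)).inv (v.hom .X)) =
        v.hom .X := congr($((Scheme.ΓSpecIso (.of O)).inv_hom_id) (v.hom .X))
    rw [hO, ← huv, hX]
    rfl
  have hcp : l (IsLocalRing.closedPoint O) ∉ Set.range i := by
    intro hmem
    refine closedPoint_notMem_range hn l η hη hηU (hf _ hmem ⟨PrimeSpectrum.comap vP
      (IsLocalRing.closedPoint O), ?_⟩) _ hτ hmem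
    exact congr($hl₂ (IsLocalRing.closedPoint O)).symm
  have hrange : Set.range l ⊆ Set.range j := by
    have hcp' : l (IsLocalRing.closedPoint O) ∈ j.opensRange := by
      change _ ∈ Set.range j
      rwa [hji]
    have h := (IsLocalRing.closedPoint_mem_iff (l ⁻¹ᵁ j.opensRange)).mp hcp'
    rintro _ ⟨x, rfl⟩
    exact h.ge (x := x) trivial
  obtain ⟨w, hw⟩ := Spec.map_surjective (IsOpenImmersion.lift j l hrange)
  have hwj : Spec.map w ≫ j = l := by rw [hw, IsOpenImmersion.lift_fac]
  have hwη : w ≫ CommRingCat.ofHom (algebraMap O K) = CommRingCat.ofHom uA := by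
    apply Spec.map_injective
    rw [← cancel_mono j, Spec.map_comp, Category.assoc, hwj, hl₁]
  have hwR : CommRingCat.ofHom (algebraMap R A') ≫ w =
      CommRingCat.ofHom (vP.comp (algebraMap R P)) := by
    apply Spec.map_injective
    refine .trans ?_ hl₂
    rw [← hwj, Category.assoc, hπ, Spec.map_comp]
  algebraize [vP.comp (algebraMap R P)]
  let w' : A' →ₐ[R] O := ⟨w.hom, fun r ↦ congr(CommRingCat.Hom.hom $hwR r)⟩
  let vP' : P →ₐ[R] O := ⟨vP, fun r ↦ rfl⟩
  let lam : P ⊗[R] A' →ₐ[R] O := Algebra.TensorProduct.lift vP' w' (fun _ _ ↦ Commute.all _ _)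
  have hlam (x : P ⊗[R] A') : algebraMap O K (lam x) = u.hom x := by
    induction x using TensorProduct.induction_on with
    | zero => simp
    | add x y hx hy => rw [map_add, map_add, map_add, hx, hy]
    | tmul p a =>
      have h : p ⊗ₜ[R] a = p ⊗ₜ[R] (1 : A') * (1 : P) ⊗ₜ[R] a := by simp
      have ha : algebraMap O K (w.hom a) = u.hom (1 ⊗ₜ a) := congr(CommRingCat.Hom.hom $hwη a)
      rw [h, map_mul lam, map_mul (algebraMap O K), map_mul u.hom, hP, ← ha]
      simp [lam, vP', w', vP]
  refine ⟨⟨⟨Spec.map (CommRingCat.ofHom lam.toRingHom), ?_, ?_⟩⟩⟩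
  · rw [← Spec.map_comp]
    exact congrArg Spec.map (CommRingCat.hom_ext (RingHom.ext hlam))
  · rw [← Spec.map_comp]
    congr 1
    ext1
    refine RingHom.ext fun q ↦ IsFractionRing.injective O K ?_
    exact (hlam _).trans (huv q)

/-- The section is chosen nonvanishing on the finite fibre of D over b. Its zeros on D have closed
image in B; this image misses b, hence all generizations of b, and Spec P maps into those. -/
lemma FramedExcision.exists_isIntegral_aeval {k : Type*} {R A' : Type u} [Field k] [Infinite k]
    [CommRing R] [CommRing A'] [Algebra k R] [Algebra R A'] {D Y : Scheme.{u}}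
    (j : Spec (CommRingCat.of A') ⟶ Y) (π : Y ⟶ Spec (CommRingCat.of R)) (i : D ⟶ Y)
    [IsOpenImmersion j] [IsProper π] [IsFinite (i ≫ π)]
    (hπ : j ≫ π = Spec.map (CommRingCat.ofHom (algebraMap R A')))
    (hji : Set.range j = (Set.range i)ᶜ) (hi : IsAmpleCartier i) (b : PrimeSpectrum R) :
    ∃ Φ : A', ∀ (P : Type u) [CommRing P] [Algebra R P],
      (∀ r : R, r ∉ b.asIdeal → IsUnit (algebraMap R P r)) →
      (Polynomial.aeval ((1 : P) ⊗ₜ[R] Φ) : Polynomial P →ₐ[P] P ⊗[R] A').toRingHom.IsIntegral := by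
  obtain ⟨⟨_, _⟩, _, U, hU, hample⟩ := hi
  let T : Set Y := i '' ((i ≫ π) ⁻¹' {b})
  have hT : T.Finite := ((i ≫ π).finite_preimage_singleton b).image _
  let σ : k →+* Γ(Y, ⊤) :=
    (π.appTop.hom.comp (Scheme.ΓSpecIso (CommRingCat.of R)).inv.hom).comp (algebraMap k R)
  obtain ⟨n, hn, f, -, hf⟩ := exists_isSectionOfMultiple_of_finite (i := i) (U := U) σ (fun y ↦ by
    obtain ⟨n, hn, f, hf, V, hV, -, hy⟩ := hample y
    exact ⟨n, hn, f, hf, hV ▸ hy⟩) hT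
  have hjU : ⊤ ≤ j ⁻¹ᵁ U := by
    intro x _
    change j x ∈ (U : Set Y)
    rw [hU, ← hji]
    exact ⟨x, rfl⟩
  refine ⟨_, fun P _ _ hP ↦ isIntegral_aeval_of_isProper j π i hπ hji hjU hn (f := f) ?_⟩
  rintro y hy ⟨p, hp⟩
  by_contra hyf
  have hZ : IsClosed (π '' (Set.range i ∩ (nonvanishingLocus i U n f)ᶜ)) :=
    π.isClosedMap _ ((i.isClosedEmbedding.isClosed_range).inter
      (isOpen_nonvanishingLocus n f).isClosed_compl)
  have hspec : PrimeSpectrum.comap (algebraMap R P) p ⤳ b := by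
    rw [← PrimeSpectrum.le_iff_specializes]
    intro r hr
    by_contra hrb
    exact p.isPrime.ne_top (Ideal.eq_top_of_isUnit_mem _ hr (hP r hrb))
  obtain ⟨z, ⟨⟨d, rfl⟩, hzf⟩, hzb⟩ := hspec.mem_closed hZ (hp ▸ ⟨y, ⟨hy, hyf⟩, rfl⟩)
  exact hzf (hf ⟨d, hzb, rfl⟩)

end ValuativeCriterion

/-! ### The theorem -/

theorem propositionh
    {k : Type u} [Field k] [Infinite k]
    -- the affine schemes `B = Spec R`, `X = Spec A`, `X' = Spec A'` and the maps between them
    {R A A' : Type u} [CommRing R] [CommRing A] [CommRing A']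
    [Algebra k R] [Algebra k A] [Algebra R A] [Algebra R A'] [Algebra A A']
    [IsScalarTower k R A] [IsScalarTower R A A']
    -- `X` is smooth over `k`; the square given by `V ⊆ X` and `X' ⟶ X` is elementary distinguished
    [Algebra.Smooth k A] (V : TopologicalSpace.Opens (PrimeSpectrum A))
    (hsq : IsElementaryDistinguished A' V)
    -- a closed point `x'` of `S'`
    (x' : PrimeSpectrum A') (hx'max : x'.asIdeal.IsMaximal) (hx'S : x' ∈ closedS' A' V)
    -- `B` is an open subscheme of the projective space of dimension `m` over `k`
    (m : ℕ) (β : Spec (CommRingCat.of R) ⟶ ProjSpace m k) (hβ : IsOpenImmersion β)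
    (hβk : β ≫ ProjSpace.toSpec m k = Spec.map (CommRingCat.ofHom (algebraMap k R)))
    -- `X ⟶ B` is an almost elementary fibration; canonical sheaves of `B` and `X` are trivial
    (hq : IsAlmostElementaryFibration (Spec.map (CommRingCat.ofHom (algebraMap R A))))
    (hωB : Nonempty ((⋀[R]^m Ω[R⁄k]) ≃ₗ[R] R))
    (hωX : Nonempty ((⋀[A]^(m + 1) Ω[A⁄k]) ≃ₗ[A] A))
    -- the compactification of `X'` over `B`
    (Xbar' Xinf' : Scheme.{u}) (j' : Spec (CommRingCat.of A') ⟶ Xbar')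
    (qbar' : Xbar' ⟶ Spec (CommRingCat.of R)) (i' : Xinf' ⟶ Xbar')
    (hj' : IsOpenImmersion j')
    (hq' : j' ≫ qbar' = Spec.map (CommRingCat.ofHom (algebraMap R A')))
    (hproper : IsProper qbar')
    (hcompl : Set.range j' = (Set.range i')ᶜ)
    (hample : IsAmpleCartier i')
    (hfin : IsFinite (i' ≫ qbar')) (hsurj : Surjective (i' ≫ qbar'))
    -- `S'` is finite over `B`
    (hS' : ((Ideal.Quotient.mk (idealS' A' V)).comp (algebraMap R A')).Finite) :
    (∃ (F : ringW R V x' ⊗[R] A') (h : Polynomial (ringW' R V x' ⊗[R] A')),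
      IsGoodPair R V x' F h) ∧
    -- for each framing of `X'` one can also achieve that `det A(h_0) = 1`
    ∀ (d : ℕ) (C : Type u) [CommRing C] [Algebra R C] (Φ : Framing R A' d C),
      ∃ (F : ringW R V x' ⊗[R] A') (h : Polynomial (ringW' R V x' ⊗[R] A'))
        (hgood : IsGoodPair R V x' F h),
        Φ.HasUnitDeterminant (can R (fibrePoints R V x')) hgood.h0_mem := by
  have : Algebra.FiniteType k R := .of_isOpenImmersion_projSpace β hβk
  have : Algebra.Smooth R A := hq.smooth
  have : IsNoetherianRing A := Algebra.FiniteType.isNoetherianRing k A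
  obtain ⟨eR⟩ := hωB
  obtain ⟨eA⟩ := hωX
  have : Module.Invertible A Ω[A⁄R] := .kaehlerDifferential_of_exteriorPower eR eA (by
    rintro rfl
    exact KaehlerDifferential.subsingleton_of_isOpenImmersion_projSpace β hβk)
  -- One function serves for W and W': functions on B that are nonzero at b become units on both.
  obtain ⟨f, hf⟩ := exists_isIntegral_aeval (k := k) j' qbar' i' hq' hcompl hample
    (PrimeSpectrum.comap (algebraMap R A') x')
  obtain ⟨u, hu, hgood⟩ := exists_isGoodPair hsq hx'max hx'S hS'
    (hf (ringW R V x') fun r ↦ isUnit_algebraMap_ringW)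
    (hf (ringW' R V x') fun r ↦ isUnit_algebraMap_ringW')
  refine ⟨?_, fun d C _ _ Φ ↦ ?_⟩
  · obtain ⟨F, h, hFh, -⟩ := hgood 1 isUnit_one
    exact ⟨F, h, hFh⟩
  · have : Nontrivial (ringW' R V x') := by
      obtain ⟨q, -⟩ := exists_comap_semiLoc_eq
        (show x' ∈ fibrePoints R V x' from ⟨hx'S, rfl⟩)
      exact q.nontrivial
    obtain ⟨w, hw, hdet⟩ := Φ.exists_isUnit_hasUnitDeterminant (can R (fibrePoints R V x'))
      (one_tmul_sub_mem_graphIdeal _ u) (graphIdeal_le_span_sup_sq hu)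
    obtain ⟨F, h, hFh, hh⟩ := hgood w hw
    exact ⟨F, h, hFh, hdet _ hFh.h0_mem hh (graphIdeal_le_span_sup_sq_of_sub_mem hu hw hh)⟩
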